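/- Let $p\ge 7$ be a prime with $3\mid p-1$ and let $n\ge 1$ be an integer. Fix an algebraic closure $\overline{\mathbf Q}$ of $\mathbf Q$; for an elliptic curve $E/\mathbf Q$ let $\mathbf Q(E[m])\subset\overline{\mathbf Q}$ be the field generated by the coordinates of the points of $E(\overline{\mathbf Q})$ of order dividing $m$. There is a unique integer $k$ such that $4p=(3k-2)^2+27N^2$ for some integer $N$. There is a unique subfield $L\subset\mathbf Q(\zeta_{p^n})$ of degree $3$ over $\mathbf Q$; it is Galois (hence cyclic) over $\mathbf Q$, is contained in $\mathbf Q(\zeta_p)$, and is generated by an element whose minimal polynomial over $\mathbf Q$ is $$g(X)=X^3+X^2-\frac{p-1}{3}X-\frac{1}{9}\left(\frac{p-1}{3}+kp\right).$$ The substitution $X=x-\tfrac13$ turns $Y^2=g(X)$ into $$E\colon y^2=x^3+ax+b,\qquad a=-\frac p3,\quad b=\frac{p(2-3k)}{27}.$$ Put $D=p-\tfrac{(3k-2)^2}{4}$ and $M=\tfrac{(3k-2)^2}{4}$ (so that $D=\tfrac{27N^2}{4}\neq 0$), and for $t\in\mathbf Q$ let $$\mathbf E_t\colon\ y^2=x^3+a\,\frac{D+Mt^2}{D}\,x+b\,\frac{D+3Dt-3Mt^2-Mt^3}{D}.$$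 Equivalently, $\mathbf E_t$ is the Rubin–Silverberg family $$y^2=x^3+a\bigl(1+(J-1)t^2\bigr)x+b\bigl(1+3t-3(J-1)t^2-(J-1)t^3\bigr)$$ of $E$, where $J=\frac{4a^3}{4a^3+27b^2}=j(E)/1728$. Then for every $t\in\mathbf Q$ the curve $\mathbf E_t$ is an elliptic curve over $\mathbf Q$ with $$\mathbf Q(\mathbf E_t[2])\cap\mathbf Q(\mathbf E_t[p^n])=L,$$ and the set of $j$-invariants $\{j(\mathbf E_t): t\in\mathbf Q\}$ is infinite. In particular there are infinitely many elliptic curves over $\mathbf Q$, pairwise non-isomorphic over $\overline{\mathbf Q}$, with $\mathbf Q(E[2])\cap\mathbf Q(E[p^n])\cong L$. -/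

import Mathlib

open Polynomial IntermediateField

noncomputable section

namespace Entanglement

/-- A fixed algebraic closure of `ℚ`, in which all the number fields below live. -/
abbrev Qbar : Type := AlgebraicClosure ℚ

open Classical in
/-- The `m`-division field `ℚ(E[m])`: the subfield of `Qbar` generated by the coordinates of all
affine points `P` of `E(Qbar)` with `m • P = 0`. -/
def divisionField (E : WeierstrassCurve ℚ) (m : ℕ) : IntermediateField ℚ Qbar :=
  adjoin ℚ {z : Qbar | ∃ (x y : Qbar) (h : (E.baseChange Qbar).toAffine.Nonsingular x y),
    m • WeierstrassCurve.Affine.Point.some x y h = 0 ∧ (z = x ∨ z = y)}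

/-- The cyclotomic field `ℚ(ζ_m)` inside `Qbar`, generated by all `m`-th roots of unity. -/
def cyclotomicSubfield (m : ℕ) : IntermediateField ℚ Qbar :=
  adjoin ℚ {z : Qbar | z ^ m = 1}

/-- `4p = (3k - 2)² + 27N²` for some integer `N`. -/
def IsGaussParameter (p : ℕ) (k : ℤ) : Prop :=
  ∃ N : ℤ, 4 * (p : ℤ) = (3 * k - 2) ^ 2 + 27 * N ^ 2

/-- Gauss's cubic period polynomial `X³ + X² - (p-1)/3 X - ((p-1)/3 + kp)/9`. -/
def gaussPoly (p : ℕ) (k : ℤ) : ℚ[X] :=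
  X ^ 3 + X ^ 2 - C (((p : ℚ) - 1) / 3) * X - C ((((p : ℚ) - 1) / 3 + (k : ℚ) * (p : ℚ)) / 9)

/-- The curve `Y² = g(X)`, where `g` is Gauss's cubic period polynomial. -/
def gaussCurve (p : ℕ) (k : ℤ) : WeierstrassCurve ℚ where
  a₁ := 0
  a₂ := (gaussPoly p k).coeff 2
  a₃ := 0
  a₄ := (gaussPoly p k).coeff 1
  a₆ := (gaussPoly p k).coeff 0

/-- The curve `E : y² = x³ - (p/3) x + p(2 - 3k)/27`. -/
def baseCurve (p : ℕ) (k : ℤ) : WeierstrassCurve ℚ where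
  a₁ := 0
  a₂ := 0
  a₃ := 0
  a₄ := -(p : ℚ) / 3
  a₆ := (p : ℚ) * (2 - 3 * (k : ℚ)) / 27

/-- The Rubin–Silverberg family of curves with the same mod 2 representation as
`y² = x³ + a x + b` (for `a`, `b` nonzero):
`y² = x³ + a (1 + (J - 1) t²) x + b (1 + 3 t - 3 (J - 1) t² - (J - 1) t³)`,
where `J = 4 a³ / (4 a³ + 27 b²)` is the `j`-invariant of `y² = x³ + a x + b` divided by `1728`.
The curve `y² = x³ + a x + b` is the member `t = 0`. -/
def rubinSilverberg (a b t : ℚ) : WeierstrassCurve ℚ where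
  a₁ := 0
  a₂ := 0
  a₃ := 0
  a₄ := a * (1 + (4 * a ^ 3 / (4 * a ^ 3 + 27 * b ^ 2) - 1) * t ^ 2)
  a₆ := b * (1 + 3 * t - 3 * (4 * a ^ 3 / (4 * a ^ 3 + 27 * b ^ 2) - 1) * t ^ 2
    - (4 * a ^ 3 / (4 * a ^ 3 + 27 * b ^ 2) - 1) * t ^ 3)

/-- The family `E_t`, with `D = p - (3k-2)²/4`:
`y² = x³ - (p/3) ((D + ((3k-2)²/4) t²)/D) x
  + (p(2-3k)/27) ((D + 3 D t - 3 ((3k-2)²/4) t² - ((3k-2)²/4) t³)/D)`. -/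
def familyCurve (p : ℕ) (k : ℤ) (t : ℚ) : WeierstrassCurve ℚ where
  a₁ := 0
  a₂ := 0
  a₃ := 0
  a₄ := -(p : ℚ) / 3 *
    (((p : ℚ) - (3 * k - 2) ^ 2 / 4 + (3 * k - 2) ^ 2 / 4 * t ^ 2)
      / ((p : ℚ) - (3 * k - 2) ^ 2 / 4))
  a₆ := (p : ℚ) * (2 - 3 * (k : ℚ)) / 27 *
    (((p : ℚ) - (3 * k - 2) ^ 2 / 4 + 3 * ((p : ℚ) - (3 * k - 2) ^ 2 / 4) * t
        - 3 * ((3 * k - 2) ^ 2 / 4) * t ^ 2 - (3 * k - 2) ^ 2 / 4 * t ^ 3)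
      / ((p : ℚ) - (3 * k - 2) ^ 2 / 4))

end Entanglement

end

open Polynomial IntermediateField

noncomputable section

/-! The entanglement statement follows from the chain L = ℚ(E_t[2]) ⊆ ℚ(ζ_p) ⊆ ℚ(E_t[p]) ⊆
ℚ(E_t[p^n]).

For the first two terms, let χ be a cubic character mod p with Gauss sum G(χ) and Jacobi sum J =
J(χ, χ). Then s = G(χ) + G(χ⁻¹) lies in ℚ(ζ_p), and G(χ)³ = pJ gives s³ = 3ps + p(3k-2), where 3k-2
is the trace of J and 4p = (3k-2)² + 27N² is four times its norm (`exists_cubic_gauss_sum`). This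
cubic is Eisenstein at p, so L = ℚ(s) is cubic, and it is Galois because ℚ(ζ_p) is abelian. The
cubic of E has root s/3, and g has root (s-1)/3. An explicit quadratic expression in α = s/3 is a
root of the cubic of E_t and still generates L (`exists_adjoin_eq_rubinSilverberg_root`).

The inclusion ℚ(ζ_p) ⊆ ℚ(E_t[p]) is usually read off the Weil pairing. Here it comes from theta
operators (`exists_isPrimitiveRoot_of_torsion`). Let n = p (not the exponent of the theorem). For an
n-torsion point P, some f has divisor n(-P) - n(O), and g ↦ f · τ_P(g) acts on the n-dimensional
space of functions with at most an n-fold pole at O. Two such operators commute up to a constant c,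
and determinants give cⁿ = 1. If the field of definition of the torsion had no primitive n-th root
of unity, all of them would commute and share an eigenvector r. The zeros of r would then be stable
under almost all translations by n² torsion points, although r has at most n zeros: impossible for n
≥ 3.

That there are n² such points (`exists_finset_torsion`) follows by writing x(nP) as a reduced
fraction of degree n² in x(P) and counting a fibre over a noncritical value.

Uniqueness of k is a composition argument for the form L² + 27N²; uniqueness of the cubic field
holds because the Galois group of ℚ(ζ_{p^n}) is cyclic. The j-invariants are infinite in number
because each is attained at finitely many t. -/

namespace Entanglement

open WeierstrassCurve
open WeierstrassCurve.Affine (CoordinateRing)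

open scoped Classical


/-! ### Coordinate ring and pole order at infinity -/

section CoordinateRing

variable {k K : Type*} [Field k] [Field K] [Algebra k K] (W : WeierstrassCurve k)

variable (K) in
/-- The affine coordinate ring of `W` over `K`. -/
abbrev CoordRing : Type _ := (W⁄K).toAffine.CoordinateRing

variable (K) in
/-- The function field of `W` over `K`. -/
abbrev FunField : Type _ := (W⁄K).toAffine.FunctionField

instance : DecidableEq (FunField K W) := fun a b => Classical.propDecidable (a = b)

variable (K) in
/-- The coordinate function `x`. -/
def xFun : CoordRing K W := algebraMap K[X] (CoordRing K W) X

variable (K) in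
/-- The coordinate function `y`. -/
def yFun : CoordRing K W := AdjoinRoot.root _

instance [W.IsShortNF] : (W⁄K).IsShortNF := by
  constructor <;> simp [baseChange]

instance [W.IsElliptic] : (W⁄K).IsElliptic := inferInstanceAs (W.map _).IsElliptic

variable {W}

/-- The ring homomorphism from the coordinate ring given by a point with values in an algebra. -/
def evalHom {A : Type*} [CommRing A] [Algebra k A] [Algebra K A] [IsScalarTower k K A] {x y : A}
    (h : (W⁄A).toAffine.Equation x y) : CoordRing K W →ₐ[K] A :=
  AdjoinRoot.liftAlgHom _ (aeval x) y <| by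
    have e : (W⁄K)⁄A = W⁄A := by
      simp only [baseChange, WeierstrassCurve.map_map, ← IsScalarTower.algebraMap_eq]
    rw [← e] at h
    rw [← h]
    simp [Affine.polynomial, evalEval, baseChange, eval₂_pow]

section evalHom

variable {A : Type*} [CommRing A] [Algebra k A] [Algebra K A] [IsScalarTower k K A] {x y : A}
    (h : (W⁄A).toAffine.Equation x y)

@[simp] lemma evalHom_algebraMap (p : K[X]) :
    evalHom h (algebraMap K[X] (CoordRing K W) p) = aeval x p :=
  AdjoinRoot.liftAlgHom_of ..

@[simp] lemma evalHom_xFun : evalHom h (xFun K W) = x := by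
  rw [xFun, evalHom_algebraMap, aeval_X]

@[simp] lemma evalHom_yFun : evalHom h (yFun K W) = y :=
  AdjoinRoot.liftAlgHom_root ..

end evalHom

lemma exists_eq_add_mul_yFun (r : CoordRing K W) : ∃ p q : K[X],
    r = algebraMap K[X] (CoordRing K W) p + algebraMap K[X] (CoordRing K W) q * yFun K W := by
  obtain ⟨p, q, h⟩ := CoordinateRing.exists_smul_basis_eq (W' := (W⁄K).toAffine) r
  refine ⟨p, q, ?_⟩
  rw [← h, Algebra.smul_def, Algebra.smul_def, mul_one]
  rfl

lemma map_algebraMap_poly {A : Type*} [CommRing A] [Algebra K A] (f : CoordRing K W →ₐ[K] A)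
    (p : K[X]) : f (algebraMap K[X] (CoordRing K W) p) = aeval (f (xFun K W)) p := by
  have : f.comp (IsScalarTower.toAlgHom K K[X] (CoordRing K W)) = aeval (f (xFun K W)) := by
    refine Polynomial.algHom_ext ?_
    rw [aeval_X]
    rfl
  exact congr($this p)

lemma coordRing_algHom_ext {A : Type*} [CommRing A] [Algebra K A] {f g : CoordRing K W →ₐ[K] A}
    (hx : f (xFun K W) = g (xFun K W)) (hy : f (yFun K W) = g (yFun K W)) : f = g := by
  refine AlgHom.ext fun r => ?_
  obtain ⟨p, q, rfl⟩ := exists_eq_add_mul_yFun r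
  simp only [map_add, map_mul, map_algebraMap_poly, hx, hy]

lemma coordRing_map_mem {A : Type*} [CommRing A] [Algebra K A] (f : CoordRing K W →ₐ[K] A)
    (S : Subalgebra K A) (hx : f (xFun K W) ∈ S) (hy : f (yFun K W) ∈ S) (r : CoordRing K W) :
    f r ∈ S := by
  obtain ⟨p, q, rfl⟩ := exists_eq_add_mul_yFun r
  have (p : K[X]) : aeval (f (xFun K W)) p ∈ S :=
    Algebra.adjoin_le (Set.singleton_subset_iff.2 hx) (aeval_mem_adjoin_singleton K _)
  simp only [map_add, map_mul, map_algebraMap_poly]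
  exact S.add_mem (this p) (S.mul_mem (this q) hy)

/-- The pole order at infinity of a regular function on the affine curve. -/
def poleDeg (r : CoordRing K W) : WithBot ℕ := (Algebra.norm K[X] r).degree

/-- `x` has a double and `y` a triple pole at infinity, so the two terms have orders of opposite
parity and cannot cancel. -/
lemma poleDeg_add_mul_yFun (p q : K[X]) : poleDeg (algebraMap K[X] (CoordRing K W) p +
    algebraMap K[X] (CoordRing K W) q * yFun K W) = max (2 • p.degree) (2 • q.degree + 3) := by
  rw [poleDeg, ← CoordinateRing.degree_norm_smul_basis (W' := (W⁄K).toAffine)]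
  simp only [Algebra.smul_def, mul_one]
  rfl

lemma poleDeg_mul (r s : CoordRing K W) : poleDeg (r * s) = poleDeg r + poleDeg s := by
  rw [poleDeg, map_mul, degree_mul]; rfl

instance : Module.Finite K[X] (CoordRing K W) :=
  .of_basis (CoordinateRing.basis (W⁄K).toAffine)

lemma poleDeg_eq_bot {r : CoordRing K W} : poleDeg r = ⊥ ↔ r = 0 := by
  rw [poleDeg, degree_eq_bot, Algebra.norm_eq_zero_iff]

lemma exists_poleDeg_eq {r : CoordRing K W} (h : r ≠ 0) : ∃ n : ℕ, poleDeg r = n :=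
  ⟨_, degree_eq_natDegree (by rwa [Ne, Algebra.norm_eq_zero_iff])⟩

lemma poleDeg_one : poleDeg (1 : CoordRing K W) = 0 := by
  rw [poleDeg, map_one, degree_one]

lemma poleDeg_algebraMap (p : K[X]) :
    poleDeg (algebraMap K[X] (CoordRing K W) p) = 2 • p.degree := by
  have := poleDeg_add_mul_yFun (W := W) p 0
  simpa using this

lemma poleDeg_pow (r : CoordRing K W) (n : ℕ) : poleDeg (r ^ n) = n • poleDeg r := by
  rw [poleDeg, map_pow, degree_pow]; rfl

lemma poleDeg_add_le (r s : CoordRing K W) : poleDeg (r + s) ≤ max (poleDeg r) (poleDeg s) := by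
  obtain ⟨p, q, rfl⟩ := exists_eq_add_mul_yFun r
  obtain ⟨p', q', rfl⟩ := exists_eq_add_mul_yFun s
  have e : algebraMap K[X] (CoordRing K W) p + algebraMap K[X] (CoordRing K W) q * yFun K W +
      (algebraMap K[X] (CoordRing K W) p' + algebraMap K[X] (CoordRing K W) q' * yFun K W) =
      algebraMap K[X] (CoordRing K W) (p + p') +
        algebraMap K[X] (CoordRing K W) (q + q') * yFun K W := by
    simp only [map_add]; ring
  rw [e, poleDeg_add_mul_yFun, poleDeg_add_mul_yFun, poleDeg_add_mul_yFun]
  have h1 := degree_add_le p p'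
  have h2 := degree_add_le q q'
  rcases le_max_iff.1 h1 with h1 | h1 <;> rcases le_max_iff.1 h2 with h2 | h2 <;>
    (apply max_le <;> [grw [h1]; grw [h2]] <;> simp)

lemma eq_algebraMap_of_poleDeg_le_zero {r : CoordRing K W} (h : poleDeg r ≤ 0) :
    ∃ c : K, r = algebraMap K _ c := by
  obtain ⟨p, q, rfl⟩ := exists_eq_add_mul_yFun r
  rw [poleDeg_add_mul_yFun, max_le_iff] at h
  have hq : q = 0 := by
    by_contra hq
    have := h.2
    rw [degree_eq_natDegree hq] at this
    norm_cast at this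
  have hp : p.degree ≤ 0 := by
    by_cases hp : p = 0
    · simp [hp]
    have := h.1
    rw [degree_eq_natDegree hp, nsmul_eq_mul] at this
    rw [degree_eq_natDegree hp]
    have h0 : 2 * p.natDegree ≤ 0 := by exact_mod_cast this
    exact_mod_cast (by omega : p.natDegree ≤ 0)
  refine ⟨p.coeff 0, ?_⟩
  rw [hq, map_zero, zero_mul, add_zero, IsScalarTower.algebraMap_apply K K[X] (CoordRing K W)]
  exact congrArg _ (eq_C_of_degree_le_zero hp)

end CoordinateRing


/-! ### Ideals of points, torsion and the hyperelliptic involution -/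

section Ideals

variable {k K : Type*} [Field k] [Field K] [Algebra k K] {W : WeierstrassCurve k}

lemma equation_iff_short [W.IsShortNF] {A : Type*} [CommRing A] [Algebra k A] {x y : A} :
    (W⁄A).toAffine.Equation x y ↔
      y ^ 2 = x ^ 3 + algebraMap k A W.a₄ * x + algebraMap k A W.a₆ := by
  simp [Affine.equation_iff]

lemma coordRing_relation :
    (yFun K W) ^ 2 + algebraMap k _ W.a₁ * xFun K W * yFun K W + algebraMap k _ W.a₃ * yFun K W =
      xFun K W ^ 3 + algebraMap k _ W.a₂ * xFun K W ^ 2 + algebraMap k _ W.a₄ * xFun K W +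
        algebraMap k _ W.a₆ := by
  have h : AdjoinRoot.mk (W⁄K).toAffine.polynomial (X ^ 2 +
      C (C (W⁄K).a₁ * X + C (W⁄K).a₃) * X -
      C (X ^ 3 + C (W⁄K).a₂ * X ^ 2 + C (W⁄K).a₄ * X + C (W⁄K).a₆)) = 0 :=
    AdjoinRoot.mk_self
  simp only [map_add, map_sub, map_mul, map_pow] at h
  rw [← sub_eq_zero, ← h]
  simp only [IsScalarTower.algebraMap_apply k K (CoordRing K W),
    IsScalarTower.algebraMap_apply K K[X] (CoordRing K W)]
  have e (p : K[X]) : AdjoinRoot.mk (W⁄K).toAffine.polynomial (C p) =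
    algebraMap K[X] (CoordRing K W) p := rfl
  have e' : AdjoinRoot.mk (W⁄K).toAffine.polynomial X = yFun K W := rfl
  have e'' (a : K) : algebraMap K K[X] a = C a := rfl
  have ex : algebraMap K[X] (CoordRing K W) X = xFun K W := rfl
  have h1 : (W⁄K).a₁ = algebraMap k K W.a₁ := rfl
  have h2 : (W⁄K).a₂ = algebraMap k K W.a₂ := rfl
  have h3 : (W⁄K).a₃ = algebraMap k K W.a₃ := rfl
  have h4 : (W⁄K).a₄ = algebraMap k K W.a₄ := rfl
  have h6 : (W⁄K).a₆ = algebraMap k K W.a₆ := rfl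
  simp only [e, e', e'', ex, h1, h2, h3, h4, h6]
  ring

lemma equation_xFun_yFun {A : Type*} [CommRing A] [Algebra k A] [Algebra K A]
    [IsScalarTower k K A] (f : CoordRing K W →ₐ[K] A) :
    (W⁄A).toAffine.Equation (f (xFun K W)) (f (yFun K W)) := by
  have h := congrArg (f.restrictScalars k) (coordRing_relation (W := W) (K := K))
  simp only [map_add, map_mul, map_pow, AlgHom.commutes] at h
  rw [Affine.equation_iff]
  exact h

/-- The ideal of the functions vanishing at a point; it is trivial for the point at infinity. -/
def pointIdeal : (W⁄K).toAffine.Point → Ideal (CoordRing K W)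
  | .zero => ⊤
  | .some x y _ => CoordinateRing.XYIdeal (W⁄K).toAffine x (C y)

lemma pointIdeal_some {x y : K} (h : (W⁄K).toAffine.Nonsingular x y) :
    pointIdeal (.some x y h) = Ideal.span {xFun K W - algebraMap K _ x,
      yFun K W - algebraMap K _ y} := by
  rw [pointIdeal, CoordinateRing.XYIdeal, CoordinateRing.XClass, CoordinateRing.YClass]
  simp only [map_sub]
  rfl

/-- Sending a point to its ideal class is a group homomorphism, so an `n`-torsion point has an ideal
whose `n`-th power is principal. For `P ≠ 0` the generator has divisor n(P) - n(O). -/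
lemma exists_pointIdeal_pow_eq_span {n : ℕ} (P : (W⁄K).toAffine.Point) (hP : n • P = 0) :
    ∃ f : CoordRing K W, pointIdeal P ^ n = Ideal.span {f} := by
  rcases P with _ | ⟨x, y, h⟩
  · exact ⟨1, by simp [pointIdeal, Ideal.span_singleton_one, Ideal.top_pow]⟩
  have h1 := congrArg (Affine.Point.toClass (W := (W⁄K).toAffine)) hP
  rw [map_nsmul, map_zero, Affine.Point.toClass_some] at h1
  have h2 : ClassGroup.mk (FunField K W)
    (CoordinateRing.XYIdeal' (W := (W⁄K).toAffine) h ^ n) = 1 := by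
    rw [map_pow]; exact h1
  rw [ClassGroup.mk_eq_one_of_coe_ideal (I' := CoordinateRing.XYIdeal (W⁄K).toAffine x (C y) ^ n)] at h2
  · obtain ⟨f, -, hf⟩ := h2
    exact ⟨f, hf⟩
  · rw [Units.val_pow_eq_pow_val, CoordinateRing.XYIdeal'_eq, FractionalIdeal.coeIdeal_pow]

lemma pointIdeal_mul_neg {x y : K} (h : (W⁄K).toAffine.Nonsingular x y) :
    pointIdeal (.some x y h) * pointIdeal (-.some x y h) =
      Ideal.span {xFun K W - algebraMap K _ x} := by
  rw [mul_comm]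
  refine (CoordinateRing.XYIdeal_neg_mul h).trans ?_
  rw [CoordinateRing.XIdeal, CoordinateRing.XClass]
  simp only [map_sub]
  rfl

lemma poleDeg_le_of_dvd {f g : CoordRing K W} (h : f ∣ g) (hg : g ≠ 0) :
    poleDeg f ≤ poleDeg g := by
  obtain ⟨c, rfl⟩ := h
  have hc : poleDeg c ≠ ⊥ := fun h => hg (by rw [poleDeg_eq_bot.1 h, mul_zero])
  obtain ⟨d, hd⟩ := WithBot.ne_bot_iff_exists.1 hc
  rw [poleDeg_mul, ← hd]
  exact le_add_of_nonneg_right (WithBot.coe_le_coe.2 d.zero_le)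

lemma poleDeg_xFun_sub (x : K) : poleDeg (xFun K W - algebraMap K _ x) = 2 := by
  have : xFun K W - algebraMap K _ x = algebraMap K[X] (CoordRing K W) (X - C x) := by
    rw [map_sub]; rfl
  rw [this, poleDeg_algebraMap, degree_X_sub_C]
  rfl

variable [W.IsShortNF]

variable (K W) in
/-- The hyperelliptic involution on the coordinate ring. -/
def conj : CoordRing K W →ₐ[K] CoordRing K W :=
  evalHom (x := xFun K W) (y := -yFun K W) <| by
    rw [equation_iff_short, neg_sq]
    exact equation_iff_short.1 (equation_xFun_yFun (AlgHom.id K (CoordRing K W)))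

lemma conj_algebraMap (p : K[X]) :
    conj K W (algebraMap K[X] (CoordRing K W) p) = algebraMap K[X] (CoordRing K W) p := by
  rw [conj, evalHom_algebraMap, ← AlgHom.id_apply (R := K) (algebraMap K[X] (CoordRing K W) p),
    map_algebraMap_poly]
  rfl

lemma norm_conj (r : CoordRing K W) :
    Algebra.norm K[X] (conj K W r) = Algebra.norm K[X] r := by
  obtain ⟨p, q, rfl⟩ := exists_eq_add_mul_yFun r
  have h1 (q : K[X]) : algebraMap K[X] (CoordRing K W) p + algebraMap K[X] _ q * yFun K W =
      p • 1 + q • CoordinateRing.mk (W⁄K).toAffine X := by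
    rw [Algebra.smul_def, Algebra.smul_def, mul_one]
    rfl
  have h2 : conj K W (algebraMap K[X] (CoordRing K W) p + algebraMap K[X] _ q * yFun K W) =
      algebraMap K[X] (CoordRing K W) p + algebraMap K[X] _ (-q) * yFun K W := by
    rw [map_add, map_mul, conj_algebraMap, conj_algebraMap, conj, evalHom_yFun, map_neg]
    ring
  rw [h2, h1, h1, CoordinateRing.norm_smul_basis, CoordinateRing.norm_smul_basis]
  simp

/-- With `r = p + q y` this is (p + qy)(p - qy) = p² - q²(x³ + a₄x + a₆). It links zeros of `r` to
roots of a polynomial in `x`. -/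
lemma mul_conj (r : CoordRing K W) :
    r * conj K W r = algebraMap K[X] _ (Algebra.norm K[X] r) := by
  obtain ⟨p, q, rfl⟩ := exists_eq_add_mul_yFun r
  have h1 : algebraMap K[X] (CoordRing K W) p + algebraMap K[X] _ q * yFun K W =
      p • 1 + q • CoordinateRing.mk (W⁄K).toAffine X := by
    rw [Algebra.smul_def, Algebra.smul_def, mul_one]
    rfl
  have h4 : algebraMap K[X] (CoordRing K W) (C (W⁄K).a₄) = algebraMap k _ W.a₄ := rfl
  have h6 : algebraMap K[X] (CoordRing K W) (C (W⁄K).a₆) = algebraMap k _ W.a₆ := rfl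
  have hx : algebraMap K[X] (CoordRing K W) X = xFun K W := rfl
  have h := equation_iff_short.1 (equation_xFun_yFun (AlgHom.id K (CoordRing K W)))
  simp only [AlgHom.id_apply] at h
  nth_rw 3 [h1]
  rw [CoordinateRing.norm_smul_basis, map_add, map_mul, conj_algebraMap, conj_algebraMap, conj,
    evalHom_yFun]
  simp only [a₁_of_isShortNF, a₂_of_isShortNF, a₃_of_isShortNF, map_sub, map_add, map_mul, map_pow,
    h4, h6, hx, map_zero]
  linear_combination -(algebraMap K[X] (CoordRing K W) q) ^ 2 * h

lemma neg_some_short {x y : K} (h : (W⁄K).toAffine.Nonsingular x y) :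
    ∃ h', -Affine.Point.some x y h = .some x (-y) h' := by
  have e : (W⁄K).toAffine.negY x y = -y := by simp [Affine.negY]
  have h' := (Affine.nonsingular_neg x y).2 h
  rw [e] at h'
  refine ⟨h', ?_⟩
  simp only [Affine.Point.neg_some, e]

lemma map_conj_pointIdeal (P : (W⁄K).toAffine.Point) :
    (pointIdeal P).map (conj K W) = pointIdeal (-P) := by
  rcases P with _ | ⟨x, y, h⟩
  · exact Ideal.map_top _
  obtain ⟨h', e⟩ := neg_some_short h
  rw [e, pointIdeal_some, pointIdeal_some, Ideal.map_span, Set.image_pair]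
  have e1 : conj K W (xFun K W - algebraMap K _ x) = xFun K W - algebraMap K _ x := by
    rw [map_sub, AlgHom.commutes, conj, evalHom_xFun]
  have e2 : conj K W (yFun K W - algebraMap K _ y) = -(yFun K W - algebraMap K _ (-y)) := by
    rw [map_sub, AlgHom.commutes, conj, evalHom_yFun, map_neg]
    ring
  rw [e1, e2, Ideal.span_insert, Ideal.span_insert, Ideal.span_singleton_neg]

/-- The product of `f` and its conjugate generates the `n`-th power of the ideal of P times that of
-P, which is generated by `(x - x(P)) ^ n` of pole order 2n; the involution preserves pole orders,
so each factor contributes n. -/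
lemma poleDeg_of_pointIdeal_pow_eq_span {n : ℕ} {P : (W⁄K).toAffine.Point} (hP : P ≠ 0)
    {f : CoordRing K W} (hf : pointIdeal P ^ n = Ideal.span {f}) : poleDeg f = n := by
  rcases P with _ | ⟨x, y, h⟩
  · exact absurd rfl hP
  have h1 := congrArg (Ideal.map (conj K W)) hf
  rw [Ideal.map_pow, map_conj_pointIdeal, Ideal.map_span, Set.image_singleton] at h1
  have h2 : Ideal.span {f * conj K W f} = Ideal.span {(xFun K W - algebraMap K _ x) ^ n} := by
    rw [← Ideal.span_singleton_mul_span_singleton, ← hf, ← h1, ← mul_pow, pointIdeal_mul_neg,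
      Ideal.span_singleton_pow]
  have h0 : (xFun K W - algebraMap K _ x) ^ n ≠ 0 := by
    refine pow_ne_zero _ fun h => ?_
    have := poleDeg_xFun_sub (W := W) x
    rw [poleDeg_eq_bot.2 h] at this
    exact absurd this (by decide)
  have h3 := Ideal.span_singleton_eq_span_singleton.1 h2
  have h4 : poleDeg (f * conj K W f) = poleDeg ((xFun K W - algebraMap K _ x) ^ n) :=
    le_antisymm (poleDeg_le_of_dvd h3.dvd h0) (poleDeg_le_of_dvd h3.symm.dvd (h3.ne_zero_iff.2 h0))
  have h5 : poleDeg (conj K W f) = poleDeg f := by rw [poleDeg, norm_conj, poleDeg]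
  rw [poleDeg_mul, h5, poleDeg_pow, poleDeg_xFun_sub] at h4
  have hf0 : f ≠ 0 := by rintro rfl; exact h3.ne_zero_iff.2 h0 (zero_mul _)
  have hd : poleDeg f = (Algebra.norm K[X] f).natDegree :=
    degree_eq_natDegree (by rwa [Ne, Algebra.norm_eq_zero_iff])
  rw [hd] at h4 ⊢
  rw [nsmul_eq_mul] at h4
  norm_cast at h4 ⊢
  have : (Algebra.norm K[X] f).natDegree + (Algebra.norm K[X] f).natDegree = n * 2 := by
    exact_mod_cast h4
  omega

end Ideals


/-! ### Translations acting on the function field -/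

section Translation

variable {k K : Type*} [Field k] [Field K] [Algebra k K] {W : WeierstrassCurve k}

variable (K W) in
/-- The coordinate function `x` in the function field. -/
def xGen : FunField K W := algebraMap _ _ (xFun K W)

variable (K W) in
/-- The coordinate function `y` in the function field. -/
def yGen : FunField K W := algebraMap _ _ (yFun K W)

lemma transcendental_xGen : Transcendental K (xGen K W) := by
  rw [transcendental_iff_injective]
  have : ((aeval (xGen K W) : K[X] →ₐ[K] FunField K W) : K[X] → FunField K W) =
      algebraMap (CoordRing K W) (FunField K W) ∘ algebraMap K[X] (CoordRing K W) := by
    ext p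
    rw [xGen, aeval_algebraMap_apply, Function.comp_apply]
    exact congrArg _ (map_algebraMap_poly (AlgHom.id K (CoordRing K W)) p).symm
  rw [this]
  exact (IsFractionRing.injective _ _).comp (FaithfulSMul.algebraMap_injective _ _)

/-- The points of `W` over `K`, as constant points over a field extension. -/
abbrev constPoint (L : Type*) [Field L] [Algebra k L] [Algebra K L] [IsScalarTower k K L]
    (P : (W⁄K).toAffine.Point) : (W⁄L).toAffine.Point :=
  Affine.Point.map (IsScalarTower.toAlgHom k K L) P

lemma constPoint_add (L : Type*) [Field L] [Algebra k L] [Algebra K L] [IsScalarTower k K L]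
    (P Q : (W⁄K).toAffine.Point) : constPoint L (P + Q) = constPoint L P + constPoint L Q :=
  map_add _ _ _

section

variable [W.IsElliptic]

variable (K W) in
/-- The generic point. -/
def genericPoint : (W⁄(FunField K W)).toAffine.Point :=
  .some (xGen K W) (yGen K W) <| Affine.equation_iff_nonsingular.1 <|
    equation_xFun_yFun (IsScalarTower.toAlgHom K (CoordRing K W) (FunField K W))

/-- Coordinates of the generic point generate the function field, so identities between
homomorphisms reduce to identities in the group of points. -/
lemma funField_algHom_ext {L : Type*} [Field L] [Algebra k L] [Algebra K L] [IsScalarTower k K L]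
    {f g : FunField K W →ₐ[K] L}
    (h : Affine.Point.map (f.restrictScalars k) (genericPoint K W) =
      Affine.Point.map (g.restrictScalars k) (genericPoint K W)) : f = g := by
  rw [genericPoint, Affine.Point.map_some, Affine.Point.map_some, Affine.Point.some.injEq] at h
  have : f.comp (IsScalarTower.toAlgHom K (CoordRing K W) _) =
      g.comp (IsScalarTower.toAlgHom K (CoordRing K W) _) :=
    coordRing_algHom_ext h.1 h.2
  apply AlgHom.coe_ringHom_injective
  exact IsLocalization.ringHom_ext (nonZeroDivisors (CoordRing K W))
    (RingHom.ext fun r => congr($this r))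

end

variable [W.IsShortNF]

/-- A nonzero `r` in the kernel would make its norm, a nonzero polynomial, vanish at the image of
`x`. -/
lemma algHom_injective {L : Type*} [Field L] [Algebra K L] (f : CoordRing K W →ₐ[K] L)
    (hf : Transcendental K (f (xFun K W))) : Function.Injective f := by
  rw [injective_iff_map_eq_zero]
  intro r hr
  by_contra h0
  have h1 : Algebra.norm K[X] r ≠ 0 := by rwa [Ne, Algebra.norm_eq_zero_iff]
  have h3 := congrArg f (mul_conj r)
  rw [map_algebraMap_poly, map_mul, hr, zero_mul, eq_comm] at h3
  exact hf ⟨_, h1, h3⟩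

variable [W.IsElliptic]

/-- A point which is not algebraic stays so after translation by a constant point. -/
lemma exists_add_constPoint (P : (W⁄K).toAffine.Point) :
    ∃ x y h, genericPoint K W + constPoint _ P = .some x y h ∧ Transcendental K x := by
  by_contra! hc
  have : IsScalarTower k (algebraicClosure K (FunField K W)) (FunField K W) :=
    IsScalarTower.of_algebraMap_eq fun _ => rfl
  let _ : DecidableEq (algebraicClosure K (FunField K W)) :=
    fun a b => Classical.propDecidable (a = b)
  -- If the translated point were at infinity or had algebraic `x`, it would be defined over the
  -- algebraic closure of `K` in the function field; subtracting `P` would make the generic point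
  -- algebraic too.
  have key : ∃ Q : (W⁄(algebraicClosure K (FunField K W))).toAffine.Point,
      constPoint (FunField K W) Q = genericPoint K W + constPoint (FunField K W) P := by
    rcases h : genericPoint K W + constPoint (FunField K W) P with _ | ⟨x, y, hxy⟩
    · exact ⟨0, rfl⟩
    have hx := hc x y hxy h
    rw [Transcendental, not_not, ← mem_algebraicClosure_iff] at hx
    have hy : y ∈ algebraicClosure K (FunField K W) := by
      rw [mem_algebraicClosure_iff]
      refine IsAlgebraic.of_pow two_pos ?_
      rw [equation_iff_short.1 hxy.1, ← mem_algebraicClosure_iff,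
        IsScalarTower.algebraMap_apply k K, IsScalarTower.algebraMap_apply k K]
      exact add_mem (add_mem (pow_mem hx 3) (mul_mem (IntermediateField.algebraMap_mem _ _) hx))
        (IntermediateField.algebraMap_mem _ _)
    have hn : (W⁄(algebraicClosure K (FunField K W))).toAffine.Nonsingular ⟨x, hx⟩ ⟨y, hy⟩ := by
      rw [← Affine.equation_iff_nonsingular, equation_iff_short]
      exact Subtype.ext (equation_iff_short.1 hxy.1)
    exact ⟨.some ⟨x, hx⟩ ⟨y, hy⟩ hn, rfl⟩
  obtain ⟨Q, hQ⟩ := key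
  have h2 : constPoint (FunField K W) (Q - constPoint (algebraicClosure K (FunField K W)) P) =
      genericPoint K W := by
    rw [constPoint, map_sub, ← constPoint, hQ, constPoint, Affine.Point.map_map]
    exact add_sub_cancel_right _ _
  rcases hQP : Q - constPoint (algebraicClosure K (FunField K W)) P with _ | ⟨x, y, h⟩
  · rw [hQP] at h2
    exact absurd h2.symm (Affine.Point.some_ne_zero _)
  · rw [hQP, constPoint, Affine.Point.map_some, genericPoint, Affine.Point.some.injEq] at h2
    refine transcendental_xGen (K := K) (W := W) ?_
    rw [← h2.1, ← mem_algebraicClosure_iff]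
    exact x.2

/-- The translated generic point is a point of the curve with transcendental `x`, so evaluating at
it is injective on regular functions and extends to the fraction field. -/
lemma exists_translation (P : (W⁄K).toAffine.Point) : ∃ τ : FunField K W →ₐ[K] FunField K W,
    Affine.Point.map (τ.restrictScalars k) (genericPoint K W) =
      genericPoint K W + constPoint _ P := by
  obtain ⟨x, y, h, e, hx⟩ := exists_add_constPoint P
  let f : CoordRing K W →ₐ[K] FunField K W := evalHom h.1
  have hf : Function.Injective f := algHom_injective f (by simpa [f] using hx)
  refine ⟨IsFractionRing.liftAlgHom hf, ?_⟩
  rw [e, genericPoint, Affine.Point.map_some]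
  simp [xGen, yGen, f]

/-- Translation by a point, acting on the function field. -/
def translation (P : (W⁄K).toAffine.Point) : FunField K W →ₐ[K] FunField K W :=
  (exists_translation P).choose

lemma map_translation (P : (W⁄K).toAffine.Point) :
    Affine.Point.map ((translation P).restrictScalars k) (genericPoint K W) =
      genericPoint K W + constPoint _ P :=
  (exists_translation P).choose_spec

lemma translation_comp (P Q : (W⁄K).toAffine.Point) :
    (translation P).comp (translation Q) = translation (P + Q) := by
  apply funField_algHom_ext
  have h1 : ((translation P).comp (translation Q)).restrictScalars k =
    ((translation P).restrictScalars k).comp ((translation Q).restrictScalars k) := rfl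
  have h2 : Affine.Point.map ((translation P).restrictScalars k) (constPoint (FunField K W) Q) =
      constPoint (FunField K W) Q := by
    rw [constPoint, Affine.Point.map_map]
    congr 1
    exact congrArg _ (AlgHom.ext fun x => (translation P).commutes x)
  rw [h1, ← Affine.Point.map_map, map_translation Q, map_add, map_translation P, h2,
    map_translation (P + Q), constPoint_add, add_assoc]

end Translation


/-! ### Chord formula and bounds on poles -/

lemma some_add_some_short {L : Type*} [Field L] {W : WeierstrassCurve L} [W.IsShortNF]
    {x₁ y₁ x₂ y₂ : L} (h₁ : W.toAffine.Nonsingular x₁ y₁) (h₂ : W.toAffine.Nonsingular x₂ y₂)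
    (hx : x₁ ≠ x₂) : ∃ h, Affine.Point.some x₁ y₁ h₁ + .some x₂ y₂ h₂ =
      .some (((y₁ - y₂) / (x₁ - x₂)) ^ 2 - x₁ - x₂)
        (-((y₁ - y₂) / (x₁ - x₂) * (((y₁ - y₂) / (x₁ - x₂)) ^ 2 - x₁ - x₂ - x₁) + y₁)) h := by
  rw [Affine.Point.add_of_X_ne hx]
  have e : W.toAffine.addX x₁ x₂ (W.toAffine.slope x₁ x₂ y₁ y₂) =
      ((y₁ - y₂) / (x₁ - x₂)) ^ 2 - x₁ - x₂ := by
    simp [Affine.addX, Affine.slope_of_X_ne hx]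
  have e' : W.toAffine.addY x₁ x₂ y₁ (W.toAffine.slope x₁ x₂ y₁ y₂) =
      -((y₁ - y₂) / (x₁ - x₂) * (((y₁ - y₂) / (x₁ - x₂)) ^ 2 - x₁ - x₂ - x₁) + y₁) := by
    rw [Affine.addY, Affine.negAddY, e, Affine.slope_of_X_ne hx]
    simp [Affine.negY]
  have h := Affine.nonsingular_add h₁ h₂ fun hxy => hx hxy.left
  rw [e, e'] at h
  exact ⟨h, by simp only [e, e']⟩

section Estimates

variable {k K : Type*} [Field k] [Field K] [Algebra k K] {W : WeierstrassCurve k}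

/-- The functions `g` such that `u * g` is regular for all `u ∈ I ^ m`. -/
def poleSubmodule (I : Ideal (CoordRing K W)) (m : ℕ) : Submodule K (FunField K W) where
  carrier := {g | ∀ u ∈ I ^ m, ∃ s : CoordRing K W,
    algebraMap _ (FunField K W) s = algebraMap _ _ u * g}
  add_mem' {g h} hg hh u hu := by
    obtain ⟨s, hs⟩ := hg u hu
    obtain ⟨t, ht⟩ := hh u hu
    exact ⟨s + t, by rw [map_add, hs, ht, mul_add]⟩
  zero_mem' u _ := ⟨0, by simp⟩
  smul_mem' c g hg u hu := by
    obtain ⟨s, hs⟩ := hg u hu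
    refine ⟨c • s, ?_⟩
    rw [Algebra.smul_def, Algebra.smul_def, map_mul, hs,
      ← IsScalarTower.algebraMap_apply K (CoordRing K W)]
    ring

lemma mul_mem_poleSubmodule {I : Ideal (CoordRing K W)} {m n : ℕ} {g h : FunField K W}
    (hg : g ∈ poleSubmodule I m) (hh : h ∈ poleSubmodule I n) :
    g * h ∈ poleSubmodule I (m + n) := by
  intro u hu
  rw [pow_add] at hu
  refine Submodule.mul_induction_on hu (fun v hv w hw => ?_) fun v w hv hw => ?_
  · obtain ⟨s, hs⟩ := hg v hv
    obtain ⟨t, ht⟩ := hh w hw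
    exact ⟨s * t, by rw [map_mul, map_mul, hs, ht]; ring⟩
  · obtain ⟨s, hs⟩ := hv
    obtain ⟨t, ht⟩ := hw
    exact ⟨s + t, by rw [map_add, hs, ht, map_add, add_mul]⟩

lemma algebraMap_mem_poleSubmodule (I : Ideal (CoordRing K W)) (m : ℕ) (r : CoordRing K W) :
    algebraMap _ (FunField K W) r ∈ poleSubmodule I m :=
  fun u _ => ⟨u * r, map_mul _ _ _⟩

lemma poleSubmodule_mono (I : Ideal (CoordRing K W)) {m n : ℕ} (h : m ≤ n) :
    poleSubmodule I m ≤ poleSubmodule I n :=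
  fun _ hg u hu => hg u (Ideal.pow_le_pow_right h hu)

lemma pow_mem_poleSubmodule {I : Ideal (CoordRing K W)} {m : ℕ} {g : FunField K W}
    (hg : g ∈ poleSubmodule I m) (n : ℕ) : g ^ n ∈ poleSubmodule I (m * n) := by
  induction n with
  | zero => simpa using algebraMap_mem_poleSubmodule I 0 1
  | succ n ih => rw [pow_succ, mul_add, mul_one]; exact mul_mem_poleSubmodule ih hg

lemma aeval_mem_poleSubmodule {I : Ideal (CoordRing K W)} {m : ℕ} {g : FunField K W}
    (hg : g ∈ poleSubmodule I m) (p : K[X]) :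
    aeval g p ∈ poleSubmodule I (m * p.natDegree) := by
  rw [aeval_eq_sum_range]
  refine Submodule.sum_mem _ fun i hi => Submodule.smul_mem _ _ ?_
  refine poleSubmodule_mono I ?_ (pow_mem_poleSubmodule hg i)
  exact Nat.mul_le_mul_left _ (Finset.mem_range_succ_iff.1 hi)

variable (K W) in
/-- The functions without pole at infinity. -/
def regularAtInfinity : Subalgebra K (FunField K W) where
  carrier := {g | ∃ s d : CoordRing K W, d ≠ 0 ∧
    algebraMap _ (FunField K W) d * g = algebraMap _ _ s ∧ poleDeg s ≤ poleDeg d}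
  mul_mem' := by
    rintro g h ⟨s, d, hd, e, l⟩ ⟨s', d', hd', e', l'⟩
    refine ⟨s * s', d * d', mul_ne_zero hd hd', ?_, ?_⟩
    · rw [map_mul, map_mul, ← e, ← e']; ring
    · rw [poleDeg_mul, poleDeg_mul]; exact add_le_add l l'
  add_mem' := by
    rintro g h ⟨s, d, hd, e, l⟩ ⟨s', d', hd', e', l'⟩
    refine ⟨s * d' + d * s', d * d', mul_ne_zero hd hd', ?_, ?_⟩
    · rw [map_mul, map_add, map_mul, map_mul, ← e, ← e']; ring
    · refine (poleDeg_add_le _ _).trans (max_le ?_ ?_) <;> rw [poleDeg_mul, poleDeg_mul]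
      · exact add_le_add l le_rfl
      · exact add_le_add le_rfl l'
  algebraMap_mem' c := by
    refine ⟨algebraMap K _ c, 1, one_ne_zero, ?_, ?_⟩
    · rw [map_one, one_mul]; rfl
    · have : algebraMap K (CoordRing K W) c = algebraMap K[X] _ (C c) := rfl
      rw [poleDeg_one, this, poleDeg_algebraMap]
      rcases eq_or_ne c 0 with rfl | hc
      · simp
      · rw [degree_C hc]; simp

/-- Squaring doubles the pole order at infinity. This passes regularity from the translate of `x` to
that of `y` through the equation of the curve. -/
lemma mem_regularAtInfinity_of_sq {g : FunField K W} (h : g ^ 2 ∈ regularAtInfinity K W) :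
    g ∈ regularAtInfinity K W := by
  obtain ⟨s, d, hd, e, l⟩ := h
  obtain ⟨r, t, ht, rfl⟩ := IsFractionRing.div_surjective (A := CoordRing K W) g
  have ht := nonZeroDivisors.ne_zero ht
  have ht' : algebraMap (CoordRing K W) (FunField K W) t ≠ 0 := by simpa using ht
  refine ⟨r, t, ht, by field_simp, ?_⟩
  have e2 : d * r ^ 2 = s * t ^ 2 := by
    apply IsFractionRing.injective (CoordRing K W) (FunField K W)
    rw [map_mul, map_mul, ← e]
    simp only [map_pow]
    field_simp
  have e3 := congrArg poleDeg e2
  rw [poleDeg_mul, poleDeg_mul, poleDeg_pow, poleDeg_pow] at e3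
  by_contra! hlt
  have hr : r ≠ 0 := by
    rintro rfl
    rw [poleDeg_eq_bot.2 rfl] at hlt
    exact not_lt_bot hlt
  obtain ⟨n, hn⟩ := exists_poleDeg_eq hd
  obtain ⟨m, hm⟩ := exists_poleDeg_eq ht
  obtain ⟨q, hq⟩ := exists_poleDeg_eq hr
  rw [hm, hq] at hlt
  rw [hm, hn, hq] at e3
  rw [hn] at l
  have l2 := e3.le.trans (add_le_add l le_rfl)
  rw [nsmul_eq_mul, nsmul_eq_mul] at l2
  have l3 : n + 2 * q ≤ n + 2 * m := by exact_mod_cast l2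
  have l4 : m < q := by exact_mod_cast hlt
  omega

lemma xGen_ne (a : K) : xGen K W ≠ algebraMap K _ a := fun h =>
  transcendental_xGen (W := W) (h ▸ isAlgebraic_algebraMap a)

variable [W.IsElliptic] [W.IsShortNF]

lemma translation_gen {a b : K} (h : (W⁄K).toAffine.Nonsingular a b) :
    translation (.some a b h) (xGen K W) =
      ((yGen K W - algebraMap K _ b) / (xGen K W - algebraMap K _ a)) ^ 2 - xGen K W -
        algebraMap K _ a ∧
    translation (.some a b h) (yGen K W) =
      -((yGen K W - algebraMap K _ b) / (xGen K W - algebraMap K _ a) *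
        (translation (.some a b h) (xGen K W) - xGen K W) + yGen K W) := by
  have h1 := map_translation (.some a b h)
  rw [genericPoint, constPoint, Affine.Point.map_some, Affine.Point.map_some] at h1
  obtain ⟨h2, e⟩ := some_add_some_short _ _ (xGen_ne a) |>.imp fun _ h => h1.trans h
  rw [Affine.Point.some.injEq] at e
  refine ⟨e.1, e.2.trans ?_⟩
  rw [e.1.symm]
  rfl

lemma translation_zero : translation (0 : (W⁄K).toAffine.Point) = AlgHom.id K _ := by
  apply funField_algHom_ext
  rw [map_translation, constPoint, map_zero, add_zero]
  rfl

end Estimates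


/-! ### The space of functions with bounded pole at infinity, and poles of translated coordinates -/

section Operators

variable {k K : Type*} [Field k] [Field K] [Algebra k K] {W : WeierstrassCurve k}

lemma xGen_sub_ne_zero (a : K) : xGen K W - algebraMap K _ a ≠ 0 := sub_ne_zero.2 (xGen_ne a)

variable (K W) in
/-- The regular functions on the affine curve with a pole of order at most `n` at infinity. -/
def boundedPole (n : ℕ) : Submodule K (FunField K W) where
  carrier := {g | ∃ r : CoordRing K W, poleDeg r ≤ n ∧ algebraMap _ _ r = g}
  add_mem' := by
    rintro _ _ ⟨r, hr, rfl⟩ ⟨s, hs, rfl⟩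
    exact ⟨r + s, (poleDeg_add_le _ _).trans (max_le hr hs), map_add _ _ _⟩
  zero_mem' := ⟨0, by simp [poleDeg_eq_bot.2], map_zero _⟩
  smul_mem' := by
    rintro c _ ⟨r, hr, rfl⟩
    refine ⟨algebraMap K[X] _ (C c) * r, ?_, ?_⟩
    · rw [poleDeg_mul, poleDeg_algebraMap]
      have : 2 • (C c).degree ≤ 0 := by
        rcases eq_or_ne c 0 with rfl | hc
        · simp
        · rw [degree_C hc]; simp
      exact (add_le_add this hr).trans (zero_add _).le
    · rw [map_mul, Algebra.smul_def]
      rfl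

lemma algebraMap_add_mul_yFun_mem_iff {p q : K[X]} {m : ℕ} :
    poleDeg (algebraMap K[X] (CoordRing K W) p + algebraMap K[X] (CoordRing K W) q * yFun K W) ≤
      (2 * m + 1 : ℕ) ↔ p ∈ degreeLT K (m + 1) ∧ q ∈ degreeLT K m := by
  rw [poleDeg_add_mul_yFun, max_le_iff, mem_degreeLT, mem_degreeLT]
  refine and_congr ?_ ?_
  · rcases eq_or_ne p 0 with rfl | hp
    · simp
    · rw [degree_eq_natDegree hp, nsmul_eq_mul]
      constructor <;> intro h
      · have h1 : 2 * p.natDegree ≤ 2 * m + 1 := by exact_mod_cast h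
        exact_mod_cast (by omega : p.natDegree < m + 1)
      · have h1 : p.natDegree < m + 1 := by exact_mod_cast h
        exact_mod_cast (by omega : 2 * p.natDegree ≤ 2 * m + 1)
  · rcases eq_or_ne q 0 with rfl | hq
    · simp
    · rw [degree_eq_natDegree hq, nsmul_eq_mul]
      constructor <;> intro h
      · have h1 : 2 * q.natDegree + 3 ≤ 2 * m + 1 := by exact_mod_cast h
        exact_mod_cast (by omega : q.natDegree < m)
      · have h1 : q.natDegree < m := by exact_mod_cast h
        exact_mod_cast (by omega : 2 * q.natDegree + 3 ≤ 2 * m + 1)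

/-- A basis is given by `x ^ i` with i ≤ m, of orders 2i, and `x ^ j * y` with j < m, of orders 2j +
3: in total (m + 1) + m. -/
lemma finrank_boundedPole (m : ℕ) :
    Module.finrank K (boundedPole K W (2 * m + 1)) = 2 * m + 1 := by
  let Φ : (degreeLT K (m + 1) × degreeLT K m) →ₗ[K] FunField K W :=
    (IsScalarTower.toAlgHom K (CoordRing K W) (FunField K W)).toLinearMap ∘ₗ
      (LinearMap.coprod
        ((IsScalarTower.toAlgHom K K[X] (CoordRing K W)).toLinearMap ∘ₗ (degreeLT K (m + 1)).subtype)
        (LinearMap.mulRight K (yFun K W) ∘ₗ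
          (IsScalarTower.toAlgHom K K[X] (CoordRing K W)).toLinearMap ∘ₗ (degreeLT K m).subtype))
  have hΦ (v) : Φ v = algebraMap _ _ (algebraMap K[X] (CoordRing K W) v.1 +
      algebraMap K[X] (CoordRing K W) v.2 * yFun K W) := rfl
  have hinj : Function.Injective Φ := by
    rw [injective_iff_map_eq_zero]
    rintro ⟨⟨p, hp⟩, ⟨q, hq⟩⟩ h
    rw [hΦ] at h
    have h1 := (map_eq_zero_iff _ (IsFractionRing.injective (CoordRing K W) (FunField K W))).1 h
    rw [← poleDeg_eq_bot, poleDeg_add_mul_yFun, max_eq_bot] at h1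
    have hp0 : p = 0 := by
      by_contra hp0
      rw [degree_eq_natDegree hp0] at h1
      exact absurd h1.1 (by rw [nsmul_eq_mul]; exact_mod_cast WithBot.coe_ne_bot)
    have hq0 : q = 0 := by
      by_contra hq0
      rw [degree_eq_natDegree hq0] at h1
      exact absurd h1.2 (by rw [nsmul_eq_mul]; exact_mod_cast WithBot.coe_ne_bot)
    simp [hp0, hq0]
  have hrange : LinearMap.range Φ = boundedPole K W (2 * m + 1) := by
    ext g
    constructor
    · rintro ⟨v, rfl⟩
      exact ⟨_, algebraMap_add_mul_yFun_mem_iff.2 ⟨v.1.2, v.2.2⟩, (hΦ v).symm⟩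
    · rintro ⟨r, hr, rfl⟩
      obtain ⟨p, q, rfl⟩ := exists_eq_add_mul_yFun r
      obtain ⟨hp, hq⟩ := algebraMap_add_mul_yFun_mem_iff.1 hr
      exact ⟨(⟨p, hp⟩, ⟨q, hq⟩), hΦ _⟩
  rw [← hrange, LinearMap.finrank_range_of_inj hinj, Module.finrank_prod,
    (degreeLTEquiv K (m + 1)).finrank_eq, (degreeLTEquiv K m).finrank_eq, Module.finrank_fin_fun,
    Module.finrank_fin_fun]
  ring

variable [W.IsShortNF]

lemma yFun_sq : yFun K W ^ 2 = xFun K W ^ 3 + algebraMap K _ (algebraMap k K W.a₄) * xFun K W +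
    algebraMap K _ (algebraMap k K W.a₆) := by
  have := equation_iff_short.1 (equation_xFun_yFun (AlgHom.id K (CoordRing K W)))
  rw [IsScalarTower.algebraMap_apply k K (CoordRing K W),
    IsScalarTower.algebraMap_apply k K (CoordRing K W)] at this
  exact this

lemma yGen_sq : yGen K W ^ 2 = xGen K W ^ 3 + algebraMap K _ (algebraMap k K W.a₄) * xGen K W +
    algebraMap K _ (algebraMap k K W.a₆) := by
  have := equation_iff_short.1 (equation_xFun_yFun
    (IsScalarTower.toAlgHom K (CoordRing K W) (FunField K W)))
  rw [IsScalarTower.algebraMap_apply k K (FunField K W),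
    IsScalarTower.algebraMap_apply k K (FunField K W)] at this
  exact this

/-- The only affine pole is a simple one at (a, -b). Multiplying by the generator y + b of its ideal
clears the denominator, since y² - b² is divisible by x - a. -/
lemma slope_mem_poleSubmodule {a b : K} (h : (W⁄K).toAffine.Nonsingular a b) :
    (yGen K W - algebraMap K _ b) / (xGen K W - algebraMap K _ a) ∈
      poleSubmodule (pointIdeal (-.some a b h)) 1 := by
  obtain ⟨h', e⟩ := neg_some_short h
  intro u hu
  rw [pow_one, e, pointIdeal_some, Ideal.mem_span_pair] at hu
  obtain ⟨c, d, rfl⟩ := hu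
  refine ⟨c * (yFun K W - algebraMap K _ b) + d * (xFun K W ^ 2 + algebraMap K _ a * xFun K W +
    algebraMap K _ a ^ 2 + algebraMap K _ (algebraMap k K W.a₄)), ?_⟩
  have hb := congrArg (algebraMap K (FunField K W)) (equation_iff_short.1 h.1)
  simp only [map_add, map_mul, map_pow] at hb
  have hy := yGen_sq (K := K) (W := W)
  have hx := xGen_sub_ne_zero (W := W) a
  rw [mul_div_assoc', eq_div_iff hx]
  have ex : algebraMap (CoordRing K W) (FunField K W) (xFun K W) = xGen K W := rfl
  have ey : algebraMap (CoordRing K W) (FunField K W) (yFun K W) = yGen K W := rfl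
  have ec (c : K) : algebraMap (CoordRing K W) (FunField K W) (algebraMap K _ c) =
    algebraMap K _ c := rfl
  simp only [map_add, map_mul, map_sub, map_pow, ex, ey, ec, map_neg]
  generalize algebraMap (CoordRing K W) (FunField K W) c = c'
  generalize algebraMap (CoordRing K W) (FunField K W) d = d'
  linear_combination d' * hb - d' * hy

variable [W.IsElliptic]

lemma translation_xGen_mem_poleSubmodule {a b : K} (h : (W⁄K).toAffine.Nonsingular a b) :
    translation (.some a b h) (xGen K W) ∈ poleSubmodule (pointIdeal (-.some a b h)) 2 := by
  rw [(translation_gen h).1]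
  refine Submodule.sub_mem _ (Submodule.sub_mem _ ?_ ?_) ?_
  · exact pow_mem_poleSubmodule (slope_mem_poleSubmodule h) 2
  · exact algebraMap_mem_poleSubmodule _ _ _
  · exact algebraMap_mem_poleSubmodule _ _ (algebraMap K _ a)

lemma translation_yGen_mem_poleSubmodule {a b : K} (h : (W⁄K).toAffine.Nonsingular a b) :
    translation (.some a b h) (yGen K W) ∈ poleSubmodule (pointIdeal (-.some a b h)) 3 := by
  rw [(translation_gen h).2]
  refine Submodule.neg_mem _ (Submodule.add_mem _ ?_ (algebraMap_mem_poleSubmodule _ _ _))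
  exact mul_mem_poleSubmodule (m := 1) (n := 2) (slope_mem_poleSubmodule h)
    (Submodule.sub_mem _ (translation_xGen_mem_poleSubmodule h)
      (algebraMap_mem_poleSubmodule _ _ _))

lemma translation_xGen_mem_regularAtInfinity {a b : K} (h : (W⁄K).toAffine.Nonsingular a b) :
    translation (.some a b h) (xGen K W) ∈ regularAtInfinity K W := by
  have h0 : xFun K W - algebraMap K _ a ≠ 0 := by
    intro h
    apply xGen_sub_ne_zero (W := W) a
    have := congrArg (algebraMap (CoordRing K W) (FunField K W)) h
    rw [map_sub, map_zero] at this
    exact this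
  refine ⟨(yFun K W - algebraMap K _ b) ^ 2 - (xFun K W + algebraMap K _ a) *
    (xFun K W - algebraMap K _ a) ^ 2, (xFun K W - algebraMap K _ a) ^ 2, pow_ne_zero 2 h0, ?_, ?_⟩
  · have ex : algebraMap (CoordRing K W) (FunField K W) (xFun K W) = xGen K W := rfl
    have ey : algebraMap (CoordRing K W) (FunField K W) (yFun K W) = yGen K W := rfl
    have ec (c : K) : algebraMap (CoordRing K W) (FunField K W) (algebraMap K _ c) =
      algebraMap K _ c := rfl
    have := xGen_sub_ne_zero (W := W) a
    rw [(translation_gen h).1]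
    simp only [map_pow, map_sub, map_mul, map_add, ex, ey, ec]
    field_simp
    ring
  · have e : (yFun K W - algebraMap K _ b) ^ 2 - (xFun K W + algebraMap K _ a) *
        (xFun K W - algebraMap K _ a) ^ 2 = algebraMap K[X] (CoordRing K W)
          (C a * X ^ 2 + C (algebraMap k K W.a₄ + a ^ 2) * X +
            C (algebraMap k K W.a₆ + b ^ 2 - a ^ 3)) +
        algebraMap K[X] (CoordRing K W) (C (-2 * b)) * yFun K W := by
      have hy := yFun_sq (K := K) (W := W)
      have ec (c : K) : algebraMap K[X] (CoordRing K W) (C c) = algebraMap K _ c := rfl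
      have ex : algebraMap K[X] (CoordRing K W) X = xFun K W := rfl
      have e2 : algebraMap K (CoordRing K W) 2 = 2 := map_ofNat _ 2
      simp only [map_add, map_mul, map_sub, map_pow, ec, ex, map_neg, e2]
      linear_combination hy
    rw [e, poleDeg_add_mul_yFun, poleDeg_pow, poleDeg_xFun_sub]
    refine max_le ?_ ?_
    · grw [degree_quadratic_le]
    · grw [degree_C_le]
      decide

lemma translation_yGen_mem_regularAtInfinity {a b : K} (h : (W⁄K).toAffine.Nonsingular a b) :
    translation (.some a b h) (yGen K W) ∈ regularAtInfinity K W := by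
  apply mem_regularAtInfinity_of_sq
  rw [← map_pow, yGen_sq]
  simp only [map_add, map_mul, map_pow, AlgHom.commutes]
  have hx := translation_xGen_mem_regularAtInfinity h
  exact add_mem (add_mem (pow_mem hx 3) (mul_mem (Subalgebra.algebraMap_mem _ _) hx))
    (Subalgebra.algebraMap_mem _ _)

end Operators


/-! ### Theta operators and their commutators -/

section Theta

variable {k K : Type*} [Field k] [Field K] [Algebra k K] {W : WeierstrassCurve k}

lemma one_mem_boundedPole (n : ℕ) : (1 : FunField K W) ∈ boundedPole K W n :=
  ⟨1, by rw [poleDeg_one]; exact_mod_cast n.zero_le, map_one _⟩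

/-- A function which stabilizes a space of functions with bounded poles is constant. -/
lemma exists_eq_algebraMap_of_mul_mem {n : ℕ} {c : FunField K W}
    (hc : ∀ v ∈ boundedPole K W n, c * v ∈ boundedPole K W n) :
    ∃ a : K, c = algebraMap K _ a := by
  have hpow (i : ℕ) : c ^ i ∈ boundedPole K W n := by
    induction i with
    | zero => rw [pow_zero]; exact one_mem_boundedPole n
    | succ i ih => rw [pow_succ']; exact hc _ ih
  obtain ⟨r, -, hr⟩ := hpow 1
  obtain ⟨s, hs, e⟩ := hpow (n + 1)
  rw [pow_one] at hr
  have hsr : s = r ^ (n + 1) := by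
    apply IsFractionRing.injective (CoordRing K W) (FunField K W)
    rw [map_pow, hr, e]
  rcases eq_or_ne r 0 with rfl | hr0
  · exact ⟨0, by rw [← hr, map_zero, map_zero]⟩
  obtain ⟨d, hd⟩ := exists_poleDeg_eq hr0
  -- If `c` has a pole of order d, then `c ^ (n + 1)` has one of order (n + 1)d, which can be at
  -- most n only if d = 0.
  rw [hsr, poleDeg_pow, hd, nsmul_eq_mul] at hs
  have h1 : (n + 1) * d ≤ n := by exact_mod_cast hs
  have hd0 : d = 0 := by
    by_contra h
    have := Nat.le_mul_of_pos_right (n + 1) (Nat.pos_of_ne_zero h)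
    omega
  obtain ⟨a, ha⟩ := eq_algebraMap_of_poleDeg_le_zero (r := r) (by rw [hd, hd0]; rfl)
  exact ⟨a, by rw [← hr, ha]; rfl⟩

variable [W.IsShortNF]

lemma ne_zero_of_pointIdeal_pow_eq_span {n : ℕ} {P : (W⁄K).toAffine.Point} {f : CoordRing K W}
    (hf : pointIdeal P ^ n = Ideal.span {f}) : f ≠ 0 := by
  rintro rfl
  rcases eq_or_ne P 0 with rfl | hP
  · have h1 : pointIdeal (0 : (W⁄K).toAffine.Point) = ⊤ := rfl
    rw [h1, Ideal.top_pow, Ideal.span_singleton_zero] at hf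
    exact top_ne_bot hf
  · have := poleDeg_of_pointIdeal_pow_eq_span hP hf
    rw [poleDeg_eq_bot.2 rfl] at this
    exact WithBot.bot_ne_coe this

variable [W.IsElliptic]

/-- Translation by `P` followed by multiplication by `f`. -/
def thetaOp (f : CoordRing K W) (P : (W⁄K).toAffine.Point) : FunField K W →ₗ[K] FunField K W :=
  LinearMap.mulLeft K (algebraMap _ _ f) ∘ₗ (translation P).toLinearMap

lemma thetaOp_apply (f : CoordRing K W) (P : (W⁄K).toAffine.Point) (g : FunField K W) :
    thetaOp f P g = algebraMap _ _ f * translation P g := rfl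

lemma translation_algebraMap (P : (W⁄K).toAffine.Point) (p q : K[X]) :
    translation P (algebraMap _ _ (algebraMap K[X] (CoordRing K W) p +
      algebraMap K[X] (CoordRing K W) q * yFun K W)) = aeval (translation P (xGen K W)) p +
      aeval (translation P (xGen K W)) q * translation P (yGen K W) := by
  have h := map_algebraMap_poly ((translation P).comp
    (IsScalarTower.toAlgHom K (CoordRing K W) (FunField K W)))
  rw [map_add, map_mul, map_add, map_mul]
  exact congrArg₂ _ (h p) (congrArg₂ _ (h q) rfl)

lemma translation_algebraMap_mem_regularAtInfinity {P : (W⁄K).toAffine.Point} (hP : P ≠ 0)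
    (r : CoordRing K W) : translation P (algebraMap _ _ r) ∈ regularAtInfinity K W := by
  rcases P with _ | ⟨a, b, h⟩
  · exact absurd rfl hP
  exact coordRing_map_mem ((translation (.some a b h)).comp
    (IsScalarTower.toAlgHom K (CoordRing K W) (FunField K W))) (regularAtInfinity K W)
    (translation_xGen_mem_regularAtInfinity h) (translation_yGen_mem_regularAtInfinity h) r

/-- Translation by P carries a pole at infinity to -P without raising its order. -/
lemma translation_mem_poleSubmodule {a b : K} (h : (W⁄K).toAffine.Nonsingular a b) {n : ℕ}
    {r : CoordRing K W} (hr : poleDeg r ≤ n) :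
    translation (.some a b h) (algebraMap _ _ r) ∈
      poleSubmodule (pointIdeal (-.some a b h)) n := by
  obtain ⟨p, q, rfl⟩ := exists_eq_add_mul_yFun r
  rw [poleDeg_add_mul_yFun, max_le_iff] at hr
  rw [translation_algebraMap]
  refine Submodule.add_mem _ ?_ ?_
  · rcases eq_or_ne p 0 with rfl | hp
    · simp
    simp only [degree_eq_natDegree hp, nsmul_eq_mul] at hr
    have h1 : 2 * p.natDegree ≤ n := by exact_mod_cast hr.1
    exact poleSubmodule_mono _ h1
      (aeval_mem_poleSubmodule (translation_xGen_mem_poleSubmodule h) p)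
  · rcases eq_or_ne q 0 with rfl | hq
    · simp
    simp only [degree_eq_natDegree hq, nsmul_eq_mul] at hr
    have h1 : 2 * q.natDegree + 3 ≤ n := by exact_mod_cast hr.2
    exact poleSubmodule_mono _ h1 (mul_mem_poleSubmodule
      (aeval_mem_poleSubmodule (translation_xGen_mem_poleSubmodule h) q)
      (translation_yGen_mem_poleSubmodule h))

/-- For P ≠ 0 the `n`-fold zero of `f` at -P absorbs the pole of the translated function there. At
infinity the translate is regular and `f` has a pole of order exactly n. For P = 0, `f` is a unit
and nothing moves. -/
lemma thetaOp_mem_boundedPole {n : ℕ} {P : (W⁄K).toAffine.Point} {f : CoordRing K W}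
    (hf : pointIdeal (-P) ^ n = Ideal.span {f}) {g : FunField K W} (hg : g ∈ boundedPole K W n) :
    thetaOp f P g ∈ boundedPole K W n := by
  obtain ⟨r, hr, rfl⟩ := hg
  rw [thetaOp_apply]
  rcases eq_or_ne P 0 with rfl | hP
  · rw [neg_zero] at hf
    have h1 : f ∣ 1 := by
      rw [← Ideal.mem_span_singleton, ← hf]
      have : pointIdeal (0 : (W⁄K).toAffine.Point) = ⊤ := rfl
      rw [this, Ideal.top_pow]
      trivial
    refine ⟨f * r, ?_, by rw [translation_zero, map_mul]; rfl⟩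
    rw [poleDeg_mul]
    have h2 := poleDeg_le_of_dvd h1 one_ne_zero
    rw [poleDeg_one] at h2
    exact (add_le_add h2 hr).trans (zero_add _).le
  · have hn : poleDeg f = n := poleDeg_of_pointIdeal_pow_eq_span (neg_ne_zero.2 hP) hf
    have hmem := translation_algebraMap_mem_regularAtInfinity hP r
    obtain ⟨s, hs⟩ : ∃ s : CoordRing K W, algebraMap _ (FunField K W) s =
        algebraMap _ _ f * translation P (algebraMap _ _ r) := by
      rcases P with _ | ⟨a, b, h⟩
      · exact absurd rfl hP
      exact translation_mem_poleSubmodule h hr f (hf ▸ Ideal.mem_span_singleton_self f)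
    refine ⟨s, ?_, hs⟩
    obtain ⟨t, d, hd, e, l⟩ := hmem
    have h1 : s * d = f * t := by
      apply IsFractionRing.injective (CoordRing K W) (FunField K W)
      rw [map_mul, map_mul, hs, ← e]
      ring
    have h2 := congrArg poleDeg h1
    rw [poleDeg_mul, poleDeg_mul, hn] at h2
    exact WithBot.le_of_add_le_add_right (mt poleDeg_eq_bot.1 hd)
      (h2.le.trans (add_le_add le_rfl l))

lemma thetaOp_injective {P : (W⁄K).toAffine.Point} {f : CoordRing K W} (hf : f ≠ 0) :
    Function.Injective (thetaOp f P) := by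
  rw [injective_iff_map_eq_zero]
  intro g hg
  rw [thetaOp_apply, mul_eq_zero] at hg
  rcases hg with hg | hg
  · exact absurd ((map_eq_zero_iff _ (IsFractionRing.injective _ _)).1 hg) hf
  · exact (map_eq_zero_iff _ (translation P).injective).1 hg

lemma thetaOp_comp_apply (f g : CoordRing K W) (P Q : (W⁄K).toAffine.Point) (v : FunField K W) :
    thetaOp f P (thetaOp g Q v) = algebraMap _ _ f * translation P (algebraMap _ _ g) *
      translation (P + Q) v := by
  rw [thetaOp_apply, thetaOp_apply, map_mul, ← translation_comp, AlgHom.comp_apply, mul_assoc]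

instance (m : ℕ) : Module.Finite K (boundedPole K W (2 * m + 1)) :=
  Module.finite_of_finrank_pos (by rw [finrank_boundedPole]; omega)

/-- The commutator of two theta operators is a root of unity. -/
lemma exists_commutator {m : ℕ} {P Q : (W⁄K).toAffine.Point} {f g : CoordRing K W}
    (hf : pointIdeal (-P) ^ (2 * m + 1) = Ideal.span {f})
    (hg : pointIdeal (-Q) ^ (2 * m + 1) = Ideal.span {g}) :
    ∃ c : K, c ^ (2 * m + 1) = 1 ∧
      algebraMap _ (FunField K W) f * translation P (algebraMap _ _ g) =
        algebraMap K _ c * (algebraMap _ _ g * translation Q (algebraMap _ _ f)) := by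
  have hf0 := ne_zero_of_pointIdeal_pow_eq_span hf
  have hg0 := ne_zero_of_pointIdeal_pow_eq_span hg
  let V := boundedPole K W (2 * m + 1)
  let A : V →ₗ[K] V := (thetaOp f P).restrict fun _ h => thetaOp_mem_boundedPole hf h
  let B : V →ₗ[K] V := (thetaOp g Q).restrict fun _ h => thetaOp_mem_boundedPole hg h
  have hA : Function.Injective A := fun x y h =>
    Subtype.ext (thetaOp_injective hf0 (congrArg Subtype.val h))
  have hB : Function.Injective B := fun x y h =>
    Subtype.ext (thetaOp_injective hg0 (congrArg Subtype.val h))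
  have hA' := LinearMap.injective_iff_surjective.1 hA
  have hB' := LinearMap.injective_iff_surjective.1 hB
  have hne : algebraMap _ (FunField K W) g * translation Q (algebraMap _ _ f) ≠ 0 := by
    simp [hf0, hg0]
  let c := algebraMap _ (FunField K W) f * translation P (algebraMap _ _ g) /
    (algebraMap _ _ g * translation Q (algebraMap _ _ f))
  have hc : algebraMap _ (FunField K W) f * translation P (algebraMap _ _ g) =
      c * (algebraMap _ _ g * translation Q (algebraMap _ _ f)) := (div_mul_cancel₀ _ hne).symm
  -- Both compositions translate by P + Q, so they differ only by the multiplier `c`.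
  have hcomm (v : FunField K W) :
      thetaOp f P (thetaOp g Q v) = c * thetaOp g Q (thetaOp f P v) := by
    rw [thetaOp_comp_apply, thetaOp_comp_apply, hc, add_comm Q P, mul_assoc c]
  -- Both operators are bijective on the space, so each `v` is of the form BAu and cv = ABu stays in
  -- it. Hence `c` is constant.
  obtain ⟨a, ha⟩ : ∃ a : K, c = algebraMap K _ a := by
    refine exists_eq_algebraMap_of_mul_mem (n := 2 * m + 1) fun v hv => ?_
    obtain ⟨w, hw⟩ := hB' ⟨v, hv⟩
    obtain ⟨u, hu⟩ := hA' w
    have h1 : thetaOp g Q (thetaOp f P u) = v := by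
      have := congrArg Subtype.val hw
      rw [← hu] at this
      exact this
    rw [← h1, ← hcomm]
    exact (A (B u)).2
  refine ⟨a, ?_, ha ▸ hc⟩
  have h2 : A * B = a • (B * A) := by
    ext v
    refine (hcomm v).trans ?_
    rw [ha, ← Algebra.smul_def]
    rfl
  -- On a space of dimension 2m + 1, det(AB) = a^(2m+1) det(BA), so the power of `a` is 1.
  have h3 := congrArg LinearMap.det h2
  rw [LinearMap.det_smul, map_mul, map_mul, finrank_boundedPole, mul_comm (LinearMap.det B)] at h3
  have hdet : LinearMap.det A * LinearMap.det B ≠ 0 :=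
    mul_ne_zero (fun h => (LinearMap.bot_lt_ker_of_det_eq_zero h).ne' (LinearMap.ker_eq_bot.2 hA))
      (fun h => (LinearMap.bot_lt_ker_of_det_eq_zero h).ne' (LinearMap.ker_eq_bot.2 hB))
  exact mul_right_cancel₀ hdet (by rw [← h3, one_mul])

end Theta


/-- A commuting family of endomorphisms has a common eigenvector. -/
lemma exists_common_eigenvector {F V ι : Type*} [Field F] [IsAlgClosed F] [AddCommGroup V]
    [Module F V] [Module.Finite F V] [Nontrivial V] (T : ι → Module.End F V)
    (hT : ∀ i j, Commute (T i) (T j)) : ∃ v : V, v ≠ 0 ∧ ∀ i, ∃ μ : F, T i v = μ • v := by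
  obtain ⟨S, ⟨hS, hinv⟩, hmin⟩ := IsArtinian.set_has_minimal
    {S : Submodule F V | S ≠ ⊥ ∧ ∀ i, ∀ v ∈ S, T i v ∈ S} ⟨⊤, top_ne_bot, by simp⟩
  obtain ⟨v, hv, hv0⟩ := S.ne_bot_iff.1 hS
  refine ⟨v, hv0, fun i => ?_⟩
  have : Nontrivial S := Submodule.nontrivial_iff_ne_bot.2 hS
  obtain ⟨μ, hμ⟩ := Module.End.exists_eigenvalue ((T i).restrict (hinv i))
  obtain ⟨w, hw⟩ := hμ.exists_hasEigenvector
  have hw1 : T i w = μ • (w : V) := congrArg Subtype.val hw.apply_eq_smul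
  -- `S` is a minimal nonzero stable subspace; by commutativity its intersection with an eigenspace
  -- is stable again, hence all of `S`.
  have hle : S ⊓ (T i).eigenspace μ = S := by
    by_contra hne
    refine hmin (S ⊓ (T i).eigenspace μ) ⟨?_, ?_⟩ (lt_of_le_of_ne inf_le_left hne)
    · exact (Submodule.ne_bot_iff _).2 ⟨w, ⟨w.2, Module.End.mem_eigenspace_iff.2 hw1⟩,
        fun h => hw.2 (Subtype.ext h)⟩
    · rintro j u ⟨hu, hu'⟩
      refine ⟨hinv j u hu, Module.End.mem_eigenspace_iff.2 ?_⟩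
      have h1 : T i (T j u) = T j (T i u) := congr($(hT i j) u)
      rw [h1, Module.End.mem_eigenspace_iff.1 hu', map_smul]
  rw [← hle] at hv
  exact ⟨μ, Module.End.mem_eigenspace_iff.1 hv.2⟩

/-! ### Values of functions at points -/

section Evaluation

variable {k F : Type*} [Field k] [Field F] [Algebra k F] {W : WeierstrassCurve k}

/-- Evaluation of a regular function at a point. -/
abbrev evalAt {x y : F} (h : (W⁄F).toAffine.Nonsingular x y) : CoordRing F W →ₐ[F] F :=
  evalHom h.1

/-- The pairs `(g, v)` such that `g` is regular at a point with value `v` there. -/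
def localSubalgebra {x y : F} (h : (W⁄F).toAffine.Nonsingular x y) :
    Subalgebra F (FunField F W × F) where
  carrier := {g | ∃ s d : CoordRing F W, evalAt h d ≠ 0 ∧
    algebraMap _ (FunField F W) d * g.1 = algebraMap _ _ s ∧ evalAt h s = g.2 * evalAt h d}
  mul_mem' := by
    rintro g g' ⟨s, d, hd, e, l⟩ ⟨s', d', hd', e', l'⟩
    refine ⟨s * s', d * d', by rw [map_mul]; exact mul_ne_zero hd hd', ?_, ?_⟩
    · rw [map_mul, map_mul, ← e, ← e', Prod.fst_mul]; ring
    · rw [map_mul, map_mul, l, l', Prod.snd_mul]; ring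
  add_mem' := by
    rintro g g' ⟨s, d, hd, e, l⟩ ⟨s', d', hd', e', l'⟩
    refine ⟨s * d' + d * s', d * d', by rw [map_mul]; exact mul_ne_zero hd hd', ?_, ?_⟩
    · rw [map_mul, map_add, map_mul, map_mul, ← e, ← e', Prod.fst_add]; ring
    · rw [map_add, map_mul, map_mul, map_mul, l, l', Prod.snd_add]; ring
  algebraMap_mem' c := by
    refine ⟨algebraMap F _ c, 1, by rw [map_one]; exact one_ne_zero, ?_, ?_⟩
    · rw [map_one, one_mul]; rfl
    · rw [AlgHom.commutes, map_one, mul_one]; rfl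

lemma algebraMap_mem_localSubalgebra {x y : F} (h : (W⁄F).toAffine.Nonsingular x y)
    (r : CoordRing F W) : ((algebraMap _ (FunField F W) r, evalAt h r) : _ × F) ∈
      localSubalgebra h :=
  ⟨r, 1, by rw [map_one]; exact one_ne_zero, by rw [map_one, one_mul], by rw [map_one, mul_one]⟩

variable [W.IsShortNF]

lemma evalAt_conj {x y : F} (h : (W⁄F).toAffine.Nonsingular x y)
    (h' : (W⁄F).toAffine.Nonsingular x (-y)) (r : CoordRing F W) :
    evalAt h (conj F W r) = evalAt h' r := by
  have : (evalAt h).comp (conj F W) = evalAt h' :=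
    coordRing_algHom_ext (by simp only [AlgHom.comp_apply, conj, evalHom_xFun])
      (by simp only [AlgHom.comp_apply, conj, evalHom_yFun, map_neg])
  exact congr($this r)

lemma isRoot_norm_of_evalAt_eq_zero {x y : F} (h : (W⁄F).toAffine.Nonsingular x y)
    {r : CoordRing F W} (hr : evalAt h r = 0) : (Algebra.norm F[X] r).IsRoot x := by
  have h1 := congrArg (evalAt h) (mul_conj r)
  rw [map_mul, hr, zero_mul, evalHom_algebraMap] at h1
  exact h1.symm

variable [W.IsElliptic]

/-- The value of a translated function at a point. -/
lemma translation_mem_localSubalgebra {a b x y x' y' : F} (hP : (W⁄F).toAffine.Nonsingular a b)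
    (hS : (W⁄F).toAffine.Nonsingular x y) (hQ : (W⁄F).toAffine.Nonsingular x' y') (hx : x ≠ a)
    (e : Affine.Point.some x y hS + .some a b hP = .some x' y' hQ) (r : CoordRing F W) :
    ((translation (.some a b hP) (algebraMap _ _ r), evalAt hQ r) : _ × F) ∈
      localSubalgebra hS := by
  obtain ⟨h', e'⟩ := some_add_some_short hS hP hx
  rw [e', Affine.Point.some.injEq] at e
  have hsub := sub_ne_zero.2 hx
  have hX : ((xGen F W, x) : _ × F) ∈ localSubalgebra hS := by
    have h := algebraMap_mem_localSubalgebra hS (xFun F W)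
    rw [evalAt, evalHom_xFun] at h
    exact h
  have hY : ((yGen F W, y) : _ × F) ∈ localSubalgebra hS := by
    have h := algebraMap_mem_localSubalgebra hS (yFun F W)
    rw [evalAt, evalHom_yFun] at h
    exact h
  have hc (c : F) : ((algebraMap F (FunField F W) c, c) : _ × F) ∈ localSubalgebra hS :=
    (localSubalgebra hS).algebraMap_mem c
  have hslope : (((yGen F W - algebraMap F _ b) / (xGen F W - algebraMap F _ a),
      (y - b) / (x - a)) : _ × F) ∈ localSubalgebra hS := by
    refine ⟨yFun F W - algebraMap F _ b, xFun F W - algebraMap F _ a, ?_, ?_, ?_⟩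
    · rwa [map_sub, AlgHom.commutes, evalHom_xFun]
    · rw [mul_comm, map_sub, map_sub]
      exact div_mul_cancel₀ _ (xGen_sub_ne_zero a)
    · rw [map_sub, map_sub, AlgHom.commutes, AlgHom.commutes, evalHom_xFun, evalHom_yFun]
      exact (div_mul_cancel₀ _ hsub).symm
  have hx' : ((translation (.some a b hP) (xGen F W), x') : _ × F) ∈ localSubalgebra hS := by
    rw [(translation_gen hP).1, ← e.1]
    exact sub_mem (sub_mem (pow_mem hslope 2) hX) (hc a)
  have hy' : ((translation (.some a b hP) (yGen F W), y') : _ × F) ∈ localSubalgebra hS := by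
    rw [(translation_gen hP).2, ← e.2, e.1]
    exact neg_mem (add_mem (mul_mem hslope (sub_mem hx' hX)) hY)
  exact coordRing_map_mem (AlgHom.prod ((translation (.some a b hP)).comp
    (IsScalarTower.toAlgHom F (CoordRing F W) (FunField F W))) (evalAt hQ)) (localSubalgebra hS)
    (by rw [AlgHom.prod_apply, evalHom_xFun]; exact hx')
    (by rw [AlgHom.prod_apply, evalHom_yFun]; exact hy') r

/-- A common eigenvector of theta operators vanishes at the translates of each of its zeros. -/
lemma evalAt_eq_zero_of_thetaOp_eq {a b x y x' y' : F} (hP : (W⁄F).toAffine.Nonsingular a b)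
    (hS : (W⁄F).toAffine.Nonsingular x y) (hQ : (W⁄F).toAffine.Nonsingular x' y') (hx : x ≠ a)
    (e : Affine.Point.some x y hS + .some a b hP = .some x' y' hQ) {f r : CoordRing F W} {μ : F}
    (hμ : μ ≠ 0) (hf : thetaOp f (.some a b hP) (algebraMap _ _ r) = μ • algebraMap _ _ r)
    (h0 : evalAt hQ r = 0) : evalAt hS r = 0 := by
  obtain ⟨s, d, hd, e1, e2⟩ := translation_mem_localSubalgebra hP hS hQ hx e r
  simp only [h0, zero_mul] at e1 e2
  rw [thetaOp_apply] at hf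
  -- The eigenvalue equation f · τ_P(r) = μ r, multiplied by a denominator `d` of τ_P(r) that does
  -- not vanish at S. There `s` takes the value r(S + P) d(S) = 0.
  have h1 : f * s = d * (algebraMap F _ μ * r) := by
    apply IsFractionRing.injective (CoordRing F W) (FunField F W)
    rw [map_mul, ← e1, map_mul, map_mul, ← IsScalarTower.algebraMap_apply F (CoordRing F W),
      ← Algebra.smul_def μ, ← hf]
    ring
  have h2 := congrArg (evalAt hS) h1
  rw [map_mul, e2, mul_zero, map_mul, map_mul, AlgHom.commutes, eq_comm] at h2
  simpa [hd, hμ] using h2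

/-- Over a root x of the norm, the product of the values of `r` at (x, y) and (x, -y) is the norm
evaluated at x, so one of them vanishes. -/
lemma exists_zero [IsAlgClosed F] {r : CoordRing F W} {n : ℕ} (hr : poleDeg r = n) (hn : n ≠ 0) :
    ∃ x y, ∃ h : (W⁄F).toAffine.Nonsingular x y, evalAt h r = 0 := by
  obtain ⟨x, hx⟩ := IsAlgClosed.exists_root (Algebra.norm F[X] r) (by
    rw [← poleDeg, hr]; exact_mod_cast hn)
  obtain ⟨y, hy⟩ := IsAlgClosed.exists_pow_nat_eq
    (x ^ 3 + algebraMap k F W.a₄ * x + algebraMap k F W.a₆) two_pos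
  have h : (W⁄F).toAffine.Nonsingular x y :=
    Affine.equation_iff_nonsingular.1 (equation_iff_short.2 hy)
  have h' : (W⁄F).toAffine.Nonsingular x (-y) :=
    Affine.equation_iff_nonsingular.1 (equation_iff_short.2 (by rw [neg_sq, hy]))
  have h1 := congrArg (evalAt h) (mul_conj r)
  have hx' : aeval x (Algebra.norm F[X] r) = 0 := hx
  rw [map_mul, evalAt_conj h h', evalHom_algebraMap, hx', mul_eq_zero] at h1
  rcases h1 with h1 | h1
  · exact ⟨x, y, h, h1⟩
  · exact ⟨x, -y, h', h1⟩

end Evaluation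


/-! ### Counting the zeros of a common eigenvector -/

section Counting

variable {k F : Type*} [Field k] [Field F] [Algebra k F] {W : WeierstrassCurve k}

/-- The `x`-coordinate of a point, with junk value at infinity. -/
def xCoord : (W⁄F).toAffine.Point → F
  | .zero => 0
  | .some x _ _ => x

lemma eq_or_eq_neg_of_xCoord_eq {P Q : (W⁄F).toAffine.Point} (hP : P ≠ 0) (hQ : Q ≠ 0)
    (h : xCoord P = xCoord Q) : P = Q ∨ P = -Q := by
  rcases P with _ | ⟨x, y, hxy⟩
  · exact absurd rfl hP
  rcases Q with _ | ⟨x', y', hxy'⟩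
  · exact absurd rfl hQ
  exact Affine.Point.X_eq_iff.1 h

variable [W.IsShortNF] [W.IsElliptic]

/-- If there are many `n`-torsion points, the associated theta operators have no common
eigenvector among the functions with a pole of order at most `n` at infinity. -/
lemma not_exists_theta_eigenvector [IsAlgClosed F] {m : ℕ} (hm : 1 ≤ m)
    (T : Finset (W⁄F).toAffine.Point) (hT : T.card = (2 * m + 1) ^ 2)
    (htors : ∀ P ∈ T, (2 * m + 1) • P = 0) {r : CoordRing F W} (hr0 : r ≠ 0)
    (hr : poleDeg r ≤ (2 * m + 1 : ℕ))
    (heig : ∀ P ∈ T, ∃ (f : CoordRing F W) (μ : F),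
      pointIdeal (-P) ^ (2 * m + 1) = Ideal.span {f} ∧
        thetaOp f P (algebraMap _ _ r) = μ • algebraMap _ _ r) : False := by
  obtain ⟨d, hd⟩ := exists_poleDeg_eq hr0
  have hr0' : algebraMap _ (FunField F W) r ≠ 0 := by simpa using hr0
  have hμ0 (P : (W⁄F).toAffine.Point) (f : CoordRing F W) (μ : F)
      (h1 : pointIdeal (-P) ^ (2 * m + 1) = Ideal.span {f})
      (h2 : thetaOp f P (algebraMap _ _ r) = μ • algebraMap _ _ r) : μ ≠ 0 := by
    rintro rfl
    rw [zero_smul] at h2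
    exact hr0' ((map_eq_zero_iff _
      (thetaOp_injective (ne_zero_of_pointIdeal_pow_eq_span h1))).1 h2)
  rcases eq_or_ne d 0 with rfl | hd0
  -- A constant eigenvector would force `f` to be constant, against its pole of order 2m + 1 at
  -- infinity.
  · obtain ⟨c, rfl⟩ := eq_algebraMap_of_poleDeg_le_zero (r := r) (by rw [hd]; rfl)
    obtain ⟨P, hPT, hP⟩ : ∃ P ∈ T, P ≠ 0 := by
      by_contra! h
      have := Finset.card_le_card (fun P hP => Finset.mem_singleton.2 (h P hP) : T ⊆ {0})
      rw [hT, Finset.card_singleton] at this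
      nlinarith
    obtain ⟨f, μ, h1, h2⟩ := heig P hPT
    have h3 : f * algebraMap F _ c = algebraMap F _ μ * algebraMap F _ c := by
      apply IsFractionRing.injective (CoordRing F W) (FunField F W)
      rw [map_mul, map_mul, ← IsScalarTower.algebraMap_apply F (CoordRing F W) _ μ,
        ← Algebra.smul_def μ, ← h2, thetaOp_apply, ← IsScalarTower.algebraMap_apply F _ _ c,
        AlgHom.commutes]
    have h4 := mul_right_cancel₀ hr0 h3
    have h5 := poleDeg_of_pointIdeal_pow_eq_span (neg_ne_zero.2 hP) h1
    have h6 : algebraMap F (CoordRing F W) μ = algebraMap F[X] _ (C μ) := rfl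
    rw [h4, h6, poleDeg_algebraMap, degree_C (hμ0 P f μ h1 h2), smul_zero] at h5
    have : 0 = 2 * m + 1 := by exact_mod_cast h5
    omega
  · obtain ⟨x, y, hQ, hQ0⟩ := exists_zero hd hd0
    set Q := Affine.Point.some x y hQ with hQdef
    have hNd : (Algebra.norm F[X] r).natDegree ≤ 2 * m + 1 := natDegree_le_iff_degree_le.2 hr
    have hN0 : Algebra.norm F[X] r ≠ 0 := by rwa [Ne, Algebra.norm_eq_zero_iff]
    -- Each Q - P is again a zero of `r`. Two values of P are left out: P = Q, where Q - P is
    -- infinity, and P = (m + 1)Q, the only torsion P for which Q - P = P may hold and the chord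
    -- formula would fail.
    have hroot : ∀ P ∈ T \ {Q, (m + 1) • Q},
        xCoord (Q - P) ∈ (Algebra.norm F[X] r).roots.toFinset := by
      intro P hP
      simp only [Finset.mem_sdiff, Finset.mem_insert, Finset.mem_singleton, not_or] at hP
      obtain ⟨hPT, hPQ, hPQ'⟩ := hP
      rw [Multiset.mem_toFinset, mem_roots hN0]
      rcases hPP : P with _ | ⟨a, b, hP'⟩
      · exact isRoot_norm_of_evalAt_eq_zero hQ hQ0
      rcases hSS : Q - P with _ | ⟨u, v, hS⟩
      · exact absurd (sub_eq_zero.1 hSS).symm hPQ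
      have hSP : Affine.Point.some u v hS + .some a b hP' = .some x y hQ := by
        rw [← hSS, ← hPP, sub_add_cancel]
      have hua : u ≠ a := by
        intro hua
        rcases Affine.Point.X_eq_iff (h₁ := hS) (h₂ := hP').1 hua with h | h
        · rw [← hSS, ← hPP] at h
          apply hPQ'
          have h2 : Q = 2 • P := by rw [two_nsmul, ← sub_eq_iff_eq_add, h]
          rw [h2, ← mul_smul, show (m + 1) * 2 = (2 * m + 1) + 1 by ring, succ_nsmul,
            htors P hPT, zero_add]
        · rw [h, neg_add_cancel] at hSP
          exact Affine.Point.some_ne_zero _ hSP.symm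
      obtain ⟨f, μ, h1, h2⟩ := heig P hPT
      have hμ := hμ0 P f μ h1 h2
      rw [hPP] at h2
      have := isRoot_norm_of_evalAt_eq_zero hS
        (evalAt_eq_zero_of_thetaOp_eq hP' hS hQ hua hSP hμ h2 hQ0)
      rw [← hPP, hSS]
      exact this
    -- At most two points share an `x`-coordinate, while the norm of `r` has at most n = 2m + 1
    -- roots. Thus n² - 2 ≤ 2n, which is false for n ≥ 3.
    have hc1 : (T \ {Q, (m + 1) • Q}).card ≤
        2 * ((T \ {Q, (m + 1) • Q}).image fun P => xCoord (Q - P)).card := by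
      refine Finset.card_le_mul_card_image _ _ fun b hb => ?_
      obtain ⟨P₀, hP₀, rfl⟩ := Finset.mem_image.1 hb
      refine (Finset.card_le_card (t := {P₀, 2 • Q - P₀}) fun P hP => ?_).trans Finset.card_le_two
      rw [Finset.mem_filter] at hP
      have hne (P) (hP : P ∈ T \ {Q, (m + 1) • Q}) : Q - P ≠ 0 := by
        simp only [Finset.mem_sdiff, Finset.mem_insert, Finset.mem_singleton, not_or] at hP
        exact sub_ne_zero.2 (Ne.symm hP.2.1)
      rw [Finset.mem_insert, Finset.mem_singleton]
      rcases eq_or_eq_neg_of_xCoord_eq (hne P hP.1) (hne P₀ hP₀) hP.2 with h | h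
      · exact Or.inl (sub_right_injective h)
      · right
        rw [two_nsmul, eq_sub_iff_add_eq]
        rw [sub_eq_iff_eq_add, neg_sub] at h
        calc P + P₀ = P₀ - Q + P + Q := by abel
          _ = Q + Q := congrArg (· + Q) h.symm
    have hc2 : ((T \ {Q, (m + 1) • Q}).image fun P => xCoord (Q - P)).card ≤ 2 * m + 1 := by
      refine (Finset.card_le_card (Finset.image_subset_iff.2 hroot)).trans ?_
      exact (Multiset.toFinset_card_le _).trans ((card_roots' _).trans hNd)
    have hc3 : T.card - 2 ≤ (T \ {Q, (m + 1) • Q}).card :=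
      (Nat.sub_le_sub_left Finset.card_le_two _).trans (Finset.le_card_sdiff _ _)
    rw [hT] at hc3
    have h4 : (2 * m + 1) ^ 2 ≤ 2 * (2 * m + 1) + 2 := by omega
    nlinarith

end Counting


/-! ### Extension of scalars -/

section BaseChange

variable {k K F : Type*} [Field k] [Field K] [Field F] [Algebra k K] [Algebra k F] [Algebra K F]
  [IsScalarTower k K F] {W : WeierstrassCurve k}

instance : IsScalarTower k K (CoordRing F W) := .of_algebraMap_eq fun x => by
  rw [IsScalarTower.algebraMap_apply k F (CoordRing F W), IsScalarTower.algebraMap_apply k K F,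
    ← IsScalarTower.algebraMap_apply K F (CoordRing F W)]

instance : IsScalarTower k K (FunField F W) := .of_algebraMap_eq fun x => by
  rw [IsScalarTower.algebraMap_apply k F (FunField F W), IsScalarTower.algebraMap_apply k K F,
    ← IsScalarTower.algebraMap_apply K F (FunField F W)]

example : IsScalarTower K (CoordRing F W) (FunField F W) := inferInstance

variable (K F W) in
/-- Extension of scalars for regular functions. -/
def coordBaseChange : CoordRing K W →ₐ[K] CoordRing F W :=
  evalHom (equation_xFun_yFun (AlgHom.id F (CoordRing F W)))

lemma map_pointIdeal (P : (W⁄K).toAffine.Point) :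
    (pointIdeal P).map (coordBaseChange K F W) = pointIdeal (constPoint F P) := by
  rcases P with _ | ⟨x, y, h⟩
  · exact Ideal.map_top _
  rw [constPoint, Affine.Point.map_some, pointIdeal_some, pointIdeal_some, Ideal.map_span,
    Set.image_pair, map_sub, map_sub, AlgHom.commutes, AlgHom.commutes, coordBaseChange,
    evalHom_xFun, evalHom_yFun]
  rfl

variable [W.IsShortNF]

lemma funBaseChange_aux : Function.Injective ((IsScalarTower.toAlgHom K (CoordRing F W)
    (FunField F W)).comp (coordBaseChange K F W)) := by
  refine algHom_injective _ ?_
  have h : Transcendental K (xGen F W) :=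
    Transcendental.of_tower_top K (transcendental_xGen (K := F) (W := W))
  have e : ((IsScalarTower.toAlgHom K (CoordRing F W) (FunField F W)).comp
      (coordBaseChange K F W)) (xFun K W) = xGen F W := by
    rw [AlgHom.comp_apply, coordBaseChange, evalHom_xFun]
    rfl
  rwa [e]

variable (K F W) in
/-- Extension of scalars for rational functions. -/
def funBaseChange : FunField K W →ₐ[K] FunField F W :=
  IsFractionRing.liftAlgHom (funBaseChange_aux (W := W) (K := K) (F := F))

lemma funBaseChange_algebraMap (r : CoordRing K W) :
    funBaseChange K F W (algebraMap _ _ r) = algebraMap _ _ (coordBaseChange K F W r) :=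
  IsFractionRing.lift_algebraMap funBaseChange_aux r

lemma funBaseChange_xGen : funBaseChange K F W (xGen K W) = xGen F W := by
  rw [xGen, funBaseChange_algebraMap, coordBaseChange, evalHom_xFun]
  rfl

lemma funBaseChange_yGen : funBaseChange K F W (yGen K W) = yGen F W := by
  rw [yGen, funBaseChange_algebraMap, coordBaseChange, evalHom_yFun]
  rfl

variable [W.IsElliptic]

lemma map_funBaseChange_genericPoint :
    Affine.Point.map ((funBaseChange K F W).restrictScalars k) (genericPoint K W) =
      genericPoint F W := by
  rw [genericPoint, genericPoint, Affine.Point.map_some, Affine.Point.some.injEq,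
    AlgHom.restrictScalars_apply, AlgHom.restrictScalars_apply, funBaseChange_xGen,
    funBaseChange_yGen]
  exact ⟨rfl, rfl⟩

lemma funBaseChange_translation (P : (W⁄K).toAffine.Point) (g : FunField K W) :
    funBaseChange K F W (translation P g) =
      translation (constPoint F P) (funBaseChange K F W g) := by
  have h : (funBaseChange K F W).comp (translation P) =
      ((translation (constPoint F P)).restrictScalars K).comp (funBaseChange K F W) := by
    apply funField_algHom_ext
    have h1 : ((funBaseChange K F W).comp (translation P)).restrictScalars k =
      ((funBaseChange K F W).restrictScalars k).comp ((translation P).restrictScalars k) := rfl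
    have h2 : (((translation (constPoint F P)).restrictScalars K).comp
      (funBaseChange K F W)).restrictScalars k =
      ((translation (constPoint F P)).restrictScalars k).comp
        ((funBaseChange K F W).restrictScalars k) := rfl
    rw [h1, h2, ← Affine.Point.map_map, ← Affine.Point.map_map, map_translation P,
      map_funBaseChange_genericPoint, map_translation, map_add, map_funBaseChange_genericPoint,
      constPoint, constPoint, Affine.Point.map_map, constPoint, Affine.Point.map_map]
    congr 2
    exact congrArg _ (AlgHom.ext fun x => (funBaseChange K F W).commutes x)
  exact congr($h g)

end BaseChange


/-! ### Roots of unity from rational torsion -/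

section RootsOfUnity

variable {k K F : Type*} [Field k] [Field K] [Field F] [Algebra k K] [Algebra k F] [Algebra K F]
  [IsScalarTower k K F] {W : WeierstrassCurve k} [W.IsShortNF] [W.IsElliptic]

/-- A field over which the full `p`-torsion is rational contains the `p`-th roots of unity. -/
theorem exists_isPrimitiveRoot_of_torsion [IsAlgClosed F] {m : ℕ} (hm : 1 ≤ m)
    (hp : (2 * m + 1).Prime) (T : Finset (W⁄F).toAffine.Point) (hT : T.card = (2 * m + 1) ^ 2)
    (htors : ∀ P ∈ T, (2 * m + 1) • P = 0)
    (hK : ∀ P ∈ T, ∃ Q : (W⁄K).toAffine.Point, constPoint F Q = P) :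
    ∃ ζ : K, IsPrimitiveRoot ζ (2 * m + 1) := by
  by_contra! hroot
  -- The exponent is prime, so a nontrivial root of unity of that order would be primitive.
  have hone (c : K) (hc : c ^ (2 * m + 1) = 1) : c = 1 := by
    by_contra hc1
    have : Fact (2 * m + 1).Prime := ⟨hp⟩
    have h := IsPrimitiveRoot.orderOf c
    rw [orderOf_eq_prime hc hc1] at h
    exact hroot c h
  have hex (Q : {Q : (W⁄K).toAffine.Point // (2 * m + 1) • Q = 0}) :
      ∃ f : CoordRing K W, pointIdeal (-Q.1) ^ (2 * m + 1) = Ideal.span {f} :=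
    exists_pointIdeal_pow_eq_span _ (by rw [smul_neg, Q.2, neg_zero])
  choose f hf using hex
  have hg (Q) : pointIdeal (-constPoint F Q.1) ^ (2 * m + 1) =
      Ideal.span {coordBaseChange K F W (f Q)} := by
    have h := congrArg (Ideal.map (coordBaseChange K F W)) (hf Q)
    rw [Ideal.map_pow, map_pointIdeal, Ideal.map_span, Set.image_singleton, constPoint, map_neg] at h
    exact h
  let A (Q : {Q : (W⁄K).toAffine.Point // (2 * m + 1) • Q = 0}) :
      Module.End F (boundedPole F W (2 * m + 1)) :=
    (thetaOp (coordBaseChange K F W (f Q)) (constPoint F Q.1)).restrict fun _ h =>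
      thetaOp_mem_boundedPole (hg Q) h
  -- The functions and translations are defined over `K`, so the commutator constant lies in `K` and
  -- equals 1. Eigenvectors need an algebraically closed field, hence the passage to `F`.
  have hcomm (P Q) : Commute (A P) (A Q) := by
    refine LinearMap.ext fun v => Subtype.ext ?_
    refine (thetaOp_comp_apply _ _ _ _ _).trans (Eq.trans ?_ (thetaOp_comp_apply _ _ _ _ _).symm)
    obtain ⟨c, hc, e⟩ := exists_commutator (hf P) (hf Q)
    rw [hone c hc, map_one, one_mul] at e
    have e' := congrArg (funBaseChange K F W) e
    rw [map_mul, map_mul, funBaseChange_translation, funBaseChange_translation,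
      funBaseChange_algebraMap, funBaseChange_algebraMap] at e'
    rw [e', add_comm (constPoint F P.1)]
  have : Nontrivial (boundedPole F W (2 * m + 1)) :=
    Module.nontrivial_of_finrank_pos (R := F) (by rw [finrank_boundedPole]; omega)
  obtain ⟨⟨v, r, hr, rfl⟩, hv0, hv⟩ := exists_common_eigenvector A hcomm
  refine not_exists_theta_eigenvector hm T hT htors (r := r) ?_ hr fun P hP => ?_
  · rintro rfl
    exact hv0 (Subtype.ext (map_zero _))
  · obtain ⟨Q, rfl⟩ := hK P hP
    have hQ : (2 * m + 1) • Q = 0 := by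
      apply Affine.Point.map_injective (IsScalarTower.toAlgHom k K F)
      rw [map_nsmul, map_zero]
      exact htors _ hP
    obtain ⟨μ, hμ⟩ := hv ⟨Q, hQ⟩
    exact ⟨_, μ, hg ⟨Q, hQ⟩, congrArg Subtype.val hμ⟩

end RootsOfUnity


/-! ### Polynomial tools: primitive triples and cofinite identities -/

section ProportionalTriples

variable {R : Type*} [CommRing R]

lemma dvd_of_span_triple_eq_top {u s t u' s' t' : R}
    (h : Ideal.span {u, s, t} = ⊤) (hs : u * s' = s * u') (ht : u * t' = t * u') : u ∣ u' := by
  have h1 : (1 : R) ∈ Ideal.span {u, s, t} := h ▸ Submodule.mem_top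
  rw [Ideal.mem_span_insert] at h1
  obtain ⟨a, z, hz, h1⟩ := h1
  obtain ⟨b, c, hz⟩ := Ideal.mem_span_pair.1 hz
  refine ⟨a * u' + b * s' + c * t', ?_⟩
  linear_combination u' * h1 - u' * hz - b * hs - c * ht

/-- Two proportional triples that both generate the unit ideal differ by a unit. -/
lemma exists_unit_mul_of_span_triple_eq_top [IsDomain R] {u s t u' s' t' : R}
    (h : Ideal.span {u, s, t} = ⊤) (h' : Ideal.span {u', s', t'} = ⊤) (hu : u ≠ 0)
    (hs : u * s' = s * u') (ht : u * t' = t * u') :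
    ∃ c : Rˣ, u' = c * u ∧ t' = c * t := by
  obtain ⟨c, hc⟩ : Associated u u' := associated_of_dvd_dvd (dvd_of_span_triple_eq_top h hs ht)
    (dvd_of_span_triple_eq_top (s' := s) (t' := t) h' (by linear_combination -hs)
      (by linear_combination -ht))
  refine ⟨c, by rw [← hc, mul_comm], mul_left_cancel₀ hu ?_⟩
  rw [ht, ← hc]
  ring

lemma span_triple_eq_top_of_eval {F : Type*} [Field F] [IsAlgClosed F] {u s t : F[X]}
    (h : ∀ x, u.eval x = 0 → s.eval x = 0 → t.eval x ≠ 0) : Ideal.span {u, s, t} = ⊤ := by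
  obtain ⟨g, hg⟩ := (IsPrincipalIdealRing.principal (Ideal.span {u, s, t})).principal
  have hg' : Ideal.span {u, s, t} = Ideal.span {g} := hg
  have hdvd {v : F[X]} (hv : v ∈ ({u, s, t} : Set F[X])) : g ∣ v :=
    Ideal.mem_span_singleton.1 (hg' ▸ Ideal.subset_span hv)
  rw [hg', Ideal.span_singleton_eq_top]
  by_contra hgu
  have hx : ∃ x, g.IsRoot x := by
    by_cases h0 : g = 0
    · exact ⟨0, by simp [h0]⟩
    · exact IsAlgClosed.exists_root g fun hd => hgu (isUnit_iff_degree_eq_zero.2 hd)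
  obtain ⟨x, hx⟩ := hx
  have hroot {v : F[X]} (hv : v ∈ ({u, s, t} : Set F[X])) : v.eval x = 0 :=
    IsRoot.dvd hx (hdvd hv)
  exact h x (hroot (by simp)) (hroot (by simp)) (hroot (by simp))

end ProportionalTriples

section Cofinite

variable {F : Type*} [Field F]

lemma eventually_eval_ne_zero {p : F[X]} (hp : p ≠ 0) :
    ∀ᶠ x in Filter.cofinite, p.eval x ≠ 0 := by
  rw [Filter.eventually_cofinite]
  simpa using finite_setOfPred_isRoot hp

lemma eq_of_eventually_eval_eq [Infinite F] {p q : F[X]}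
    (h : ∀ᶠ x in Filter.cofinite, p.eval x = q.eval x) : p = q := by
  refine eq_of_infinite_eval_eq p q ?_
  exact Filter.frequently_cofinite_iff_infinite.1 h.frequently

end Cofinite

/-! ### Multiplication by n on x-coordinates -/

section MulByN

variable {F : Type*} [Field F] {W : WeierstrassCurve F}

/-- `N / D` is the reduced rational function giving the `x`-coordinate of multiplication by `n`. -/
structure IsMulBy (W : WeierstrassCurve F) (n : ℕ) (N D : F[X]) : Prop where
  isCoprime : IsCoprime N D
  monic : N.Monic
  natDegree_num : N.natDegree = n ^ 2
  natDegree_denom : D.natDegree + 1 = n ^ 2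
  leadingCoeff_denom : D.leadingCoeff = (n : F) ^ 2
  smul_eq : ∀ᶠ x in Filter.cofinite, D.eval x ≠ 0 ∧ ∀ y (h : W.toAffine.Nonsingular x y),
    ∃ y' h', n • Affine.Point.some x y h = .some (N.eval x / D.eval x) y' h'

lemma isMulBy_one : IsMulBy W 1 X 1 where
  isCoprime := isCoprime_one_right
  monic := monic_X
  natDegree_num := by simp
  natDegree_denom := by simp
  leadingCoeff_denom := by simp
  smul_eq := .of_forall fun x => ⟨by simp, fun y h => ⟨y, by simpa using h, by simp⟩⟩

variable [W.IsShortNF]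

lemma nonsingular_equation {x y : F} (h : W.toAffine.Nonsingular x y) :
    y ^ 2 = x ^ 3 + W.a₄ * x + W.a₆ := by
  have := (Affine.equation_iff _ _).1 h.1
  simpa using this

lemma exists_nonsingular [IsAlgClosed F] [W.IsElliptic] (x : F) :
    ∃ y, W.toAffine.Nonsingular x y := by
  obtain ⟨y, hy⟩ := IsAlgClosed.exists_pow_nat_eq (x ^ 3 + W.a₄ * x + W.a₆) two_pos
  refine ⟨y, (Affine.equation_iff_nonsingular).1 ((Affine.equation_iff _ _).2 ?_)⟩
  simpa using hy

lemma neg_some_eq {x y : F} (h : W.toAffine.Nonsingular x y) :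
    ∃ h', -Affine.Point.some x y h = .some x (-y) h' := by
  have e : W.toAffine.negY x y = -y := by simp [Affine.negY]
  refine ⟨e ▸ (Affine.nonsingular_neg x y).2 h, ?_⟩
  rw [Affine.Point.neg_some]
  simp only [e]

lemma discr_ne_zero [W.IsElliptic] : 4 * W.a₄ ^ 3 + 27 * W.a₆ ^ 2 ≠ 0 := by
  have h := W.isUnit_Δ.ne_zero
  rw [Δ_of_isShortNF] at h
  exact fun h0 => h (by rw [h0, mul_zero])

lemma two_smul_some {x y : F} (h : W.toAffine.Nonsingular x y) (h2 : (2 : F) ≠ 0) (hy : y ≠ 0) :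
    ∃ y' h', 2 • Affine.Point.some x y h =
      .some (((3 * x ^ 2 + W.a₄) / (2 * y)) ^ 2 - 2 * x) y' h' := by
  have hyy : y ≠ W.toAffine.negY x y := by
    simpa [Affine.negY, eq_neg_iff_add_eq_zero, ← two_mul] using ⟨h2, hy⟩
  have e : W.toAffine.addX x x (W.toAffine.slope x x y y) =
      ((3 * x ^ 2 + W.a₄) / (2 * y)) ^ 2 - 2 * x := by
    simp [Affine.addX, Affine.slope_of_Y_ne rfl hyy, Affine.negY, two_mul, sub_sub]
  have h' := Affine.nonsingular_add h h fun hxy => hyy hxy.right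
  rw [e] at h'
  refine ⟨_, h', ?_⟩
  rw [two_smul, Affine.Point.add_self_of_Y_ne hyy]
  simp only [e]

/-- The numerator and denominator of the sum and product of `x(P + Q)` and `x(P - Q)`. -/
lemma add_sub_some [W.IsElliptic] {x y x' y' : F} (h : W.toAffine.Nonsingular x y)
    (h' : W.toAffine.Nonsingular x' y') (hx : x' ≠ x) : ∃ u v z w hu hv,
    Affine.Point.some x' y' h' + .some x y h = .some u z hu ∧
    Affine.Point.some x' y' h' - .some x y h = .some v w hv ∧
    (u + v) * (x' - x) ^ 2 = 2 * ((x' + x) * (x' * x + W.a₄) + 2 * W.a₆) ∧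
    u * v * (x' - x) ^ 2 = (x' * x - W.a₄) ^ 2 - 4 * W.a₆ * (x' + x) := by
  obtain ⟨hn, en⟩ := neg_some_eq h
  obtain ⟨h1, e1⟩ := some_add_some_short h' h hx
  obtain ⟨h2, e2⟩ := some_add_some_short h' hn hx
  refine ⟨_, _, _, _, h1, h2, e1, by rw [sub_eq_add_neg, en, e2], ?_, ?_⟩
  all_goals
    have hx0 := sub_ne_zero.2 hx
    have hy := nonsingular_equation h
    have hy' := nonsingular_equation h'
    field_simp
  · linear_combination 2 * hy + 2 * hy'
  · linear_combination (y' ^ 2 - y ^ 2 + (x' ^ 3 + W.a₄ * x') - (x ^ 3 + W.a₄ * x)) * (hy' - hy) -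
      2 * (x' + x) * (x' - x) ^ 2 * (hy + hy')

lemma isMulBy_two [CharZero F] [IsAlgClosed F] [W.IsElliptic] :
    IsMulBy W 2 ((X ^ 2 - C W.a₄) ^ 2 - C (8 * W.a₆) * X)
      (C 4 * (X ^ 3 + C W.a₄ * X + C W.a₆)) where
  isCoprime := by
    have hd := discr_ne_zero (W := W)
    -- Bézout cofactors from (3x² + 4a)((x² - a)² - 8bx) - (3x³ - 5ax - 27b)(x³ + ax + b) = 4a³ +
    -- 27b².
    refine ⟨C (4 * W.a₄ ^ 3 + 27 * W.a₆ ^ 2)⁻¹ * (C 3 * X ^ 2 + C (4 * W.a₄)),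
      -C (4 * W.a₄ ^ 3 + 27 * W.a₆ ^ 2)⁻¹ * C (4⁻¹) *
        (C 3 * X ^ 3 - C (5 * W.a₄) * X - C (27 * W.a₆)), ?_⟩
    have h1 : C (4 * W.a₄ ^ 3 + 27 * W.a₆ ^ 2)⁻¹ * C (4 * W.a₄ ^ 3 + 27 * W.a₆ ^ 2) = 1 := by
      rw [← C_mul, inv_mul_cancel₀ hd, C_1]
    have h40 : (4 : F) ≠ 0 := by norm_num
    have h4 : C (4⁻¹ : F) * C 4 = 1 := by rw [← C_mul, inv_mul_cancel₀ h40, C_1]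
    have e3 : (C 3 : F[X]) = 3 := rfl
    have e4 : (C 4 : F[X]) = 4 := rfl
    have e5 : (C 5 : F[X]) = 5 := rfl
    have e8 : (C 8 : F[X]) = 8 := rfl
    have e27 : (C 27 : F[X]) = 27 := rfl
    simp only [C_add, C_mul, C_pow, e3, e4, e5, e8, e27] at h1 h4 ⊢
    generalize C (4 * W.a₄ ^ 3 + 27 * W.a₆ ^ 2)⁻¹ = d at *
    linear_combination h1 - d * (3 * X ^ 3 - 5 * C W.a₄ * X - 27 * C W.a₆) *
      (X ^ 3 + C W.a₄ * X + C W.a₆) * h4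
  monic := by monicity!
  natDegree_num := by compute_degree!
  natDegree_denom := by
    have : (C 4 * (X ^ 3 + C W.a₄ * X + C W.a₆)).natDegree = 3 := by compute_degree!
    rw [this]
    norm_num
  leadingCoeff_denom := by
    have : (C 4 * (X ^ 3 + C W.a₄ * X + C W.a₆)).natDegree = 3 := by compute_degree!
    rw [leadingCoeff, this]
    simp
    norm_num
  smul_eq := by
    have h0 : C 4 * (X ^ 3 + C W.a₄ * X + C W.a₆) ≠ 0 := by
      refine mul_ne_zero (C_ne_zero.2 (by norm_num)) (Monic.ne_zero ?_)
      monicity!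
    filter_upwards [eventually_eval_ne_zero h0] with x hx
    refine ⟨hx, fun y h => ?_⟩
    have hxy := nonsingular_equation h
    have hy : y ≠ 0 := by
      rintro rfl
      apply hx
      simp [← hxy]
    obtain ⟨y', h', e⟩ := two_smul_some h two_ne_zero hy
    have ex : ((3 * x ^ 2 + W.a₄) / (2 * y)) ^ 2 - 2 * x =
        ((X ^ 2 - C W.a₄) ^ 2 - C (8 * W.a₆) * X).eval x /
          (C 4 * (X ^ 3 + C W.a₄ * X + C W.a₆)).eval x := by
      simp only [eval_mul, eval_add, eval_sub, eval_pow, eval_X, eval_C, ← hxy]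
      field_simp
      linear_combination (-32 * x) * hxy
    rw [ex] at h'
    exact ⟨y', h', by simp only [e, ex]⟩

end MulByN


section MulByN

variable {F : Type*} [Field F] {W : WeierstrassCurve F} {n : ℕ} {N D : F[X]}

/-- The zeros are the `x` with x(nP) = x(P). The leading terms of `N` and `X * D` have coefficients
1 and n², and do not cancel for n ≥ 2; this is why `IsMulBy` records the leading coefficient of `D`.
-/
lemma IsMulBy.sub_X_mul [CharZero F] (h : IsMulBy W n N D) (hn : 2 ≤ n) :
    N - X * D ≠ 0 ∧ (N - X * D).natDegree = n ^ 2 ∧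
      (N - X * D).leadingCoeff = 1 - (n : F) ^ 2 := by
  have hc : (N - X * D).coeff (n ^ 2) = 1 - (n : F) ^ 2 := by
    rw [coeff_sub, ← h.natDegree_num, h.monic.coeff_natDegree, h.natDegree_num,
      ← h.natDegree_denom, coeff_X_mul, coeff_natDegree, h.leadingCoeff_denom]
  have hne : 1 - (n : F) ^ 2 ≠ 0 := by
    rw [sub_ne_zero]
    have : (1 : ℕ) ≠ n ^ 2 := by nlinarith
    exact_mod_cast this
  have hle : (N - X * D).natDegree ≤ n ^ 2 := by
    refine (natDegree_sub_le _ _).trans (max_le h.natDegree_num.le ?_)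
    refine natDegree_mul_le.trans ?_
    rw [natDegree_X, add_comm, h.natDegree_denom]
  have hd := natDegree_eq_of_le_of_coeff_ne_zero hle (hc ▸ hne)
  exact ⟨fun h0 => hne (by rw [← hc, h0, coeff_zero]), hd, by rw [leadingCoeff, hd, hc]⟩

lemma IsMulBy.product_num (h : IsMulBy W n N D) :
    ((X * N - C W.a₄ * D) ^ 2 - C (4 * W.a₆) * D * (N + X * D)).Monic ∧
    ((X * N - C W.a₄ * D) ^ 2 - C (4 * W.a₆) * D * (N + X * D)).natDegree = 2 * (n ^ 2 + 1) := by
  have h0 := h.natDegree_num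
  have h1 := h.natDegree_denom
  have hm : (X * N).Monic := monic_X.mul h.monic
  have hmd : (X * N).natDegree = n ^ 2 + 1 := by
    rw [monic_X.natDegree_mul h.monic, natDegree_X, h0, add_comm]
  have hlt : (C W.a₄ * D).degree < (X * N).degree := by
    rw [degree_eq_natDegree hm.ne_zero, hmd]
    refine degree_le_natDegree.trans_lt ?_
    have := natDegree_C_mul_le W.a₄ D
    exact_mod_cast (by omega : (C W.a₄ * D).natDegree < n ^ 2 + 1)
  have hP := hm.sub_of_left hlt
  have hPd : (X * N - C W.a₄ * D).natDegree = n ^ 2 + 1 := by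
    rw [natDegree_eq_of_degree_eq (degree_sub_eq_left_of_degree_lt hlt), hmd]
  have hP2d : ((X * N - C W.a₄ * D) ^ 2).natDegree = 2 * (n ^ 2 + 1) := by
    rw [hP.natDegree_pow, hPd]
  have hlt2 : (C (4 * W.a₆) * D * (N + X * D)).degree < ((X * N - C W.a₄ * D) ^ 2).degree := by
    rw [degree_eq_natDegree (hP.pow 2).ne_zero, hP2d]
    refine degree_le_natDegree.trans_lt ?_
    have e1 := natDegree_C_mul_le (4 * W.a₆) D
    have e2 : (N + X * D).natDegree ≤ n ^ 2 := by
      refine (natDegree_add_le _ _).trans (max_le h0.le ?_)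
      refine natDegree_mul_le.trans ?_
      rw [natDegree_X, add_comm, h1]
    have e3 := natDegree_mul_le (p := C (4 * W.a₆) * D) (q := N + X * D)
    exact_mod_cast (by omega :
      (C (4 * W.a₆) * D * (N + X * D)).natDegree < 2 * (n ^ 2 + 1))
  exact ⟨(hP.pow 2).sub_of_left hlt2, by
    rw [natDegree_eq_of_degree_eq (degree_sub_eq_left_of_degree_lt hlt2), hP2d]⟩

lemma IsMulBy.eval_denom_ne_zero (h : IsMulBy W n N D) {x : F} (hx : N.eval x = 0) :
    D.eval x ≠ 0 := fun h0 => by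
  obtain ⟨a, b, hab⟩ := h.isCoprime
  simpa [hx, h0] using congrArg (eval x) hab

/-- At a common zero N = xD with D ≠ 0, so the other two entries reduce to multiples of the
denominator and numerator of the duplication formula, which are coprime as the discriminant is
nonzero. -/
lemma IsMulBy.span_eq_top [CharZero F] [IsAlgClosed F] [W.IsShortNF] [W.IsElliptic]
    (h : IsMulBy W n N D) :
    Ideal.span {(N - X * D) ^ 2,
      2 * ((N + X * D) * (X * N + C W.a₄ * D) + C (2 * W.a₆) * D ^ 2),
      (X * N - C W.a₄ * D) ^ 2 - C (4 * W.a₆) * D * (N + X * D)} = ⊤ := by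
  refine span_triple_eq_top_of_eval fun x hU hS hT => discr_ne_zero (W := W) ?_
  have e2 : eval x (2 : F[X]) = 2 := eval_ofNat ..
  simp only [eval_mul, eval_add, eval_sub, eval_pow, eval_X, eval_C, e2] at hU hS hT
  have hN : N.eval x = x * D.eval x := sub_eq_zero.1 (pow_eq_zero_iff two_ne_zero |>.1 hU)
  have hD : D.eval x ≠ 0 := fun h0 => h.eval_denom_ne_zero (by rw [hN, h0, mul_zero]) h0
  rw [hN] at hS hT
  have h1 : x ^ 3 + W.a₄ * x + W.a₆ = 0 := by
    have : 4 * D.eval x ^ 2 * (x ^ 3 + W.a₄ * x + W.a₆) = 0 := by linear_combination hS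
    exact (mul_eq_zero.1 this).resolve_left (mul_ne_zero (by norm_num) (pow_ne_zero 2 hD))
  have h2 : (x ^ 2 - W.a₄) ^ 2 - 8 * W.a₆ * x = 0 := by
    have : D.eval x ^ 2 * ((x ^ 2 - W.a₄) ^ 2 - 8 * W.a₆ * x) = 0 := by linear_combination hT
    exact (mul_eq_zero.1 this).resolve_left (pow_ne_zero 2 hD)
  linear_combination (3 * x ^ 2 + 4 * W.a₄) * h2 - (3 * x ^ 3 - 5 * W.a₄ * x - 27 * W.a₆) * h1

lemma exists_isCoprime_mul_eq_mul (a b : F[X]) (hb : b ≠ 0) :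
    ∃ a' b', IsCoprime a' b' ∧ b' ≠ 0 ∧ b * a' = a * b' := by
  let := EuclideanDomain.gcdMonoid F[X]
  have hg : gcd a b ≠ 0 := fun h => hb ((gcd_eq_zero_iff a b).1 h).2
  have ha' := EuclideanDomain.mul_div_cancel' hg (gcd_dvd_left a b)
  have hb' := EuclideanDomain.mul_div_cancel' hg (gcd_dvd_right a b)
  refine ⟨a / gcd a b, b / gcd a b, isCoprime_div_gcd_div_gcd hb, fun h => hb ?_, ?_⟩
  · rw [← hb', h, mul_zero]
  · linear_combination (b / gcd a b) * ha' - (a / gcd a b) * hb'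

/-- Passing from multiplication by `n` and `n + 1` to multiplication by `n + 2`. -/
lemma IsMulBy.exists_next [CharZero F] [IsAlgClosed F] [W.IsShortNF] [W.IsElliptic]
    {N' D' : F[X]} (hn : 1 ≤ n) (h' : IsMulBy W n N' D') (h : IsMulBy W (n + 1) N D) :
    ∃ N'' D'', IsMulBy W (n + 2) N'' D'' := by
  obtain ⟨hV0, hVd, hVl⟩ := h.sub_X_mul (by omega)
  obtain ⟨hTm, hTd⟩ := h.product_num
  have hspan := h.span_eq_top
  have hUd : ((N - X * D) ^ 2).natDegree = 2 * (n + 1) ^ 2 := by rw [natDegree_pow, hVd]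
  have hUl : ((N - X * D) ^ 2).leadingCoeff = (1 - ((n : F) + 1) ^ 2) ^ 2 := by
    rw [leadingCoeff_pow, hVl]
    push_cast
    rfl
  have hU0 : (N - X * D) ^ 2 ≠ 0 := pow_ne_zero 2 hV0
  -- Apply the sum and product formulas to (n + 1)P ± P: here u = x((n + 2)P), and the other
  -- coordinate is x(nP) = N'/D'.
  have hpts : ∀ᶠ x in Filter.cofinite, ∀ y (hxy : W.toAffine.Nonsingular x y), ∃ u y' hu,
      (n + 2) • Affine.Point.some x y hxy = .some u y' hu ∧
      (u * D'.eval x + N'.eval x) * ((N - X * D) ^ 2).eval x = D'.eval x *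
        (2 * ((N + X * D) * (X * N + C W.a₄ * D) + C (2 * W.a₆) * D ^ 2)).eval x ∧
      u * N'.eval x * ((N - X * D) ^ 2).eval x = D'.eval x *
        ((X * N - C W.a₄ * D) ^ 2 - C (4 * W.a₆) * D * (N + X * D)).eval x := by
    filter_upwards [h.smul_eq, h'.smul_eq, eventually_eval_ne_zero hV0] with x hx hx' hx0 y hxy
    obtain ⟨y1, h1, e1⟩ := hx.2 y hxy
    obtain ⟨y2, h2, e2⟩ := hx'.2 y hxy
    have hD := hx.1
    have hD' := hx'.1
    have hne : N.eval x / D.eval x ≠ x := fun he => hx0 <| by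
      rw [div_eq_iff hD] at he
      simp [he]
    obtain ⟨u, v, z, w, hu, hv, eu, ev, hs, ht⟩ := add_sub_some hxy h1 hne
    rw [← e1, succ_nsmul, add_sub_cancel_right, e2, Affine.Point.some.injEq,
      div_eq_iff hD'] at ev
    rw [← e1, ← succ_nsmul] at eu
    have hN : N.eval x = N.eval x / D.eval x * D.eval x := (div_mul_cancel₀ _ hD).symm
    generalize N.eval x / D.eval x = x' at *
    have e2 : eval x (2 : F[X]) = 2 := eval_ofNat ..
    refine ⟨u, z, hu, eu, ?_, ?_⟩ <;>
      simp only [eval_mul, eval_add, eval_sub, eval_pow, eval_X, eval_C, e2, hN, ev.1]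
    · linear_combination D'.eval x * D.eval x ^ 2 * hs
    · linear_combination D'.eval x * D.eval x ^ 2 * ht
  generalize (N - X * D) ^ 2 = U at *
  generalize 2 * ((N + X * D) * (X * N + C W.a₄ * D) + C (2 * W.a₆) * D ^ 2) = S at *
  generalize (X * N - C W.a₄ * D) ^ 2 - C (4 * W.a₆) * D * (N + X * D) = T at *
  have hD0 : D' ≠ 0 := by
    rw [← leadingCoeff_ne_zero, h'.leadingCoeff_denom]
    exact pow_ne_zero 2 (Nat.cast_ne_zero.2 (by omega))
  -- `N₀ / D₀` is S/U - N'/D' in lowest terms, the candidate for x((n + 2)P).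
  obtain ⟨N₀, D₀, hco, hD₀, hid⟩ := exists_isCoprime_mul_eq_mul (S * D' - U * N') (U * D')
    (mul_ne_zero hU0 hD0)
  have hpts₀ : ∀ᶠ x in Filter.cofinite, ∀ y (hxy : W.toAffine.Nonsingular x y), ∃ u y' hu,
      (n + 2) • Affine.Point.some x y hxy = .some u y' hu ∧ u * D₀.eval x = N₀.eval x ∧
      u * N'.eval x * U.eval x = D'.eval x * T.eval x := by
    filter_upwards [hpts, eventually_eval_ne_zero hU0, eventually_eval_ne_zero hD0]
      with x hx hxU hxD y hxy
    obtain ⟨u, y', hu, e, e1, e2⟩ := hx y hxy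
    refine ⟨u, y', hu, e, mul_left_cancel₀ (mul_ne_zero hxU hxD) ?_, e2⟩
    have := congrArg (eval x) hid
    simp only [eval_mul, eval_sub] at this
    linear_combination D₀.eval x * e1 - this
  have hid2 : U * (N' * N₀) = T * (D' * D₀) := by
    refine eq_of_eventually_eval_eq ?_
    filter_upwards [hpts₀] with x hx
    obtain ⟨y, hxy⟩ := exists_nonsingular (W := W) x
    obtain ⟨u, y', hu, e, e1, e2⟩ := hx y hxy
    simp only [eval_mul]
    linear_combination -(U.eval x * N'.eval x) * e1 + D₀.eval x * e2
  -- Gauss's lemma: the coefficients of a product of two primitive linear forms are coprime. Being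
  -- proportional to (U, S, T), this triple agrees with it up to a unit, so D'D₀ and N'N₀ are known
  -- up to that unit and give the degrees and leading coefficients.
  have hspan' : Ideal.span {D' * D₀, N' * D₀ + N₀ * D', N' * N₀} = ⊤ := by
    obtain ⟨a, b, hab⟩ := h'.isCoprime
    obtain ⟨a₀, b₀, hab₀⟩ := hco
    refine span_triple_eq_top_of_eval fun x h1 h2 h3 => ?_
    have e := congrArg (eval x) hab
    have e₀ := congrArg (eval x) hab₀
    simp only [eval_mul, eval_add, eval_one] at h1 h2 h3 e e₀
    refine one_ne_zero (α := F) ?_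
    rcases mul_eq_zero.1 h1 with h1 | h1 <;> rcases mul_eq_zero.1 h3 with h3 | h3
    · linear_combination -e + a.eval x * h3 + b.eval x * h1
    · linear_combination -(a₀.eval x * N₀.eval x + b₀.eval x * D₀.eval x) * e - e₀ +
        a.eval x * a₀.eval x * N'.eval x * h3 + a.eval x * b₀.eval x * (h2 - D'.eval x * h3) +
        b.eval x * (a₀.eval x * N₀.eval x + b₀.eval x * D₀.eval x) * h1
    · linear_combination -(a₀.eval x * N₀.eval x + b₀.eval x * D₀.eval x) * e - e₀ +
        a.eval x * (a₀.eval x * N₀.eval x + b₀.eval x * D₀.eval x) * h3 +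
        b.eval x * a₀.eval x * (h2 - D₀.eval x * h3) + b.eval x * D'.eval x * b₀.eval x * h1
    · linear_combination -e₀ + a₀.eval x * h3 + b₀.eval x * h1
  obtain ⟨c, hc1, hc2⟩ := exists_unit_mul_of_span_triple_eq_top hspan hspan' hU0
    (by linear_combination hid) hid2
  have hcc : (↑c⁻¹ : F[X]) * c = 1 := c.inv_mul
  have e1 : D' * (↑c⁻¹ * D₀) = U := by linear_combination (↑c⁻¹ : F[X]) * hc1 + U * hcc
  have e2 : N' * (↑c⁻¹ * N₀) = T := by linear_combination (↑c⁻¹ : F[X]) * hc2 + T * hcc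
  have hN'' : (↑c⁻¹ * N₀).Monic := h'.monic.of_mul_monic_left (e2 ▸ hTm)
  have hD'' : ↑c⁻¹ * D₀ ≠ 0 := mul_ne_zero c⁻¹.ne_zero hD₀
  refine ⟨↑c⁻¹ * N₀, ↑c⁻¹ * D₀, ?_, hN'', ?_, ?_, ?_, ?_⟩
  · exact (isCoprime_mul_unit_left c⁻¹.isUnit _ _).2 hco
  · have := h'.monic.natDegree_mul hN''
    rw [e2, hTd, h'.natDegree_num] at this
    nlinarith
  · have := natDegree_mul hD0 hD''
    rw [e1, hUd] at this
    have := h'.natDegree_denom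
    nlinarith
  · have := leadingCoeff_mul D' (↑c⁻¹ * D₀)
    rw [e1, hUl, h'.leadingCoeff_denom] at this
    have hn0 : (n : F) ^ 2 ≠ 0 := pow_ne_zero 2 (Nat.cast_ne_zero.2 (by omega))
    refine mul_left_cancel₀ hn0 ?_
    rw [← this]
    push_cast
    ring
  · filter_upwards [hpts₀, eventually_eval_ne_zero hD''] with x hx hx0
    refine ⟨hx0, fun y hxy => ?_⟩
    obtain ⟨u, y', hu, e, e1, -⟩ := hx y hxy
    have : u = (↑c⁻¹ * N₀).eval x / (↑c⁻¹ * D₀).eval x := by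
      rw [eq_div_iff hx0, eval_mul, eval_mul, ← e1]
      ring
    subst this
    exact ⟨y', hu, e⟩

theorem exists_isMulBy [CharZero F] [IsAlgClosed F] [W.IsShortNF] [W.IsElliptic] (hn : 1 ≤ n) :
    ∃ N D, IsMulBy W n N D := by
  suffices ∀ m, (∃ N D, IsMulBy W (m + 1) N D) ∧ ∃ N D, IsMulBy W (m + 2) N D by
    obtain ⟨m, rfl⟩ := Nat.exists_eq_add_of_le' hn
    exact (this m).1
  intro m
  induction m with
  | zero => exact ⟨⟨_, _, isMulBy_one⟩, _, _, isMulBy_two⟩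
  | succ m ih =>
    obtain ⟨⟨N', D', h'⟩, N, D, h⟩ := ih
    exact ⟨⟨N, D, h⟩, h'.exists_next (by omega) h⟩

end MulByN


/-! ### Counting torsion points -/

section TorsionCount

variable {F : Type*} [Field F] [CharZero F] {W : WeierstrassCurve F} {n : ℕ} {N D : F[X]}

lemma wronskian_ne_zero_of_natDegree_pos (h : IsCoprime N D) (hN : 0 < N.natDegree) (hD : D ≠ 0) :
    derivative N * D - N * derivative D ≠ 0 := fun h0 => by
  have hdvd : D ∣ derivative D := h.symm.dvd_of_dvd_mul_left
    ⟨derivative N, by linear_combination -h0⟩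
  have hD' : derivative D = 0 := eq_zero_of_dvd_of_degree_lt hdvd (degree_derivative_lt hD)
  rw [hD', mul_zero, sub_zero] at h0
  have := derivative_eq_zero.1 ((mul_eq_zero.1 h0).resolve_right hD)
  omega

variable [IsAlgClosed F]

/-- A double root of N - cD is a zero of the Wronskian N'D - ND', so it suffices that `c` avoid the
finitely many values of N/D at such zeros and on `Z`. -/
lemma exists_card_roots_sub_C_mul (h : IsCoprime N D) (hN : N.Monic) (hN0 : 0 < N.natDegree)
    (hD : D ≠ 0) (hdeg : D.natDegree < N.natDegree) {Z : Set F} (hZ : Z.Finite) :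
    ∃ c : F, (N - C c * D).roots.toFinset.card = N.natDegree ∧
      ∀ x, N.eval x = c * D.eval x → x ∉ Z := by
  have hw := wronskian_ne_zero_of_natDegree_pos h hN0 hD
  have hfin : (Z ∪ {x | (derivative N * D - N * derivative D).IsRoot x}).Finite :=
    hZ.union (finite_setOfPred_isRoot hw)
  obtain ⟨c, hc⟩ := (hfin.image fun x => N.eval x / D.eval x).infinite_compl.nonempty
  have hroot {x : F} (hx : N.eval x = c * D.eval x) :
      x ∉ Z ∧ (derivative N * D - N * derivative D).eval x ≠ 0 := by
    have hDx : D.eval x ≠ 0 := fun h0 => by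
      obtain ⟨a, b, hab⟩ := h
      rw [h0, mul_zero] at hx
      simpa [hx, h0] using congrArg (eval x) hab
    have hxc : N.eval x / D.eval x = c := by rw [hx, mul_div_cancel_right₀ _ hDx]
    have : x ∉ Z ∪ {x | (derivative N * D - N * derivative D).IsRoot x} :=
      fun hmem => hc ⟨x, hmem, hxc⟩
    simpa [not_or] using this
  have hlt : (C c * D).degree < N.degree := by
    rw [degree_eq_natDegree hN.ne_zero]
    refine degree_le_natDegree.trans_lt ?_
    exact_mod_cast (natDegree_C_mul_le c D).trans_lt hdeg
  have hQ := hN.sub_of_left hlt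
  refine ⟨c, ?_, fun x hx => (hroot hx).1⟩
  rw [Multiset.toFinset_card_of_nodup, ← (IsAlgClosed.splits _).natDegree_eq_card_roots,
    natDegree_eq_of_degree_eq (degree_sub_eq_left_of_degree_lt hlt)]
  refine Multiset.nodup_iff_count_le_one.2 fun x => ?_
  by_contra! hx
  rw [count_roots, one_lt_rootMultiplicity_iff_isRoot hQ.ne_zero] at hx
  obtain ⟨h1, h2⟩ := hx
  simp only [IsRoot, derivative_sub, derivative_mul, derivative_C, zero_mul, zero_add, eval_sub,
    eval_mul, eval_C] at h1 h2
  refine (hroot (sub_eq_zero.1 h1)).2 ?_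
  simp only [eval_sub, eval_mul]
  linear_combination D.eval x * h2 - (derivative D).eval x * h1

/-- An elliptic curve over an algebraically closed field of characteristic zero has `n²` points
annihilated by `n`. -/
theorem exists_finset_torsion [W.IsShortNF] [W.IsElliptic] (hn : 1 ≤ n) :
    ∃ T : Finset W.toAffine.Point, T.card = n ^ 2 ∧ ∀ P ∈ T, n • P = 0 := by
  obtain ⟨N, D, h⟩ := exists_isMulBy (W := W) hn
  have hn2 : 0 < n ^ 2 := by positivity
  have h1 := h.natDegree_num
  have h2 := h.natDegree_denom
  have hD : D ≠ 0 := by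
    rw [← leadingCoeff_ne_zero, h.leadingCoeff_denom]
    exact pow_ne_zero 2 (Nat.cast_ne_zero.2 (by omega))
  obtain ⟨c, hcard, hc⟩ := exists_card_roots_sub_C_mul h.isCoprime h.monic (by omega) hD (by omega)
    (Filter.eventually_cofinite.1 h.smul_eq)
  obtain ⟨y₀, hy₀⟩ := exists_nonsingular (W := W) c
  -- Every `x` in the fibre lifts to a point whose multiple has abscissa `c`; changing the sign of
  -- the lift if necessary, all these multiples equal one fixed point.
  have hpt (x : F) (hx : x ∈ (N - C c * D).roots.toFinset) :
      ∃ y hxy, n • Affine.Point.some (W' := W.toAffine) x y hxy = .some c y₀ hy₀ := by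
    have hx : N.eval x = c * D.eval x := by
      rw [Multiset.mem_toFinset] at hx
      simpa [sub_eq_zero] using (mem_roots'.1 hx).2
    have hgood := hc x hx
    simp only [Set.mem_ofPred_eq, not_not] at hgood
    obtain ⟨hDx, hgood⟩ := hgood
    rw [hx, mul_div_cancel_right₀ _ hDx] at hgood
    obtain ⟨y, hxy⟩ := exists_nonsingular (W := W) x
    obtain ⟨y₁, hy₁, e⟩ := hgood y hxy
    have hsq : y₁ ^ 2 = y₀ ^ 2 := by
      rw [nonsingular_equation hy₁, nonsingular_equation hy₀]
    rcases sq_eq_sq_iff_eq_or_eq_neg.1 hsq with rfl | rfl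
    · exact ⟨y, hxy, e⟩
    · obtain ⟨hxy', e'⟩ := neg_some_eq hxy
      obtain ⟨hy', e''⟩ := neg_some_eq hy₁
      refine ⟨-y, hxy', ?_⟩
      rw [← e', smul_neg, e, e'']
      simp
  choose! y hxy hsmul using hpt
  let P (x : (N - C c * D).roots.toFinset) : W.toAffine.Point := .some x (y x) (hxy x x.2)
  have hP : Function.Injective P := fun x x' hxx => Subtype.ext (by
    simpa [P] using (Affine.Point.some.inj hxx).1)
  obtain ⟨x₁, hx₁⟩ := Finset.card_pos.1 (by omega : 0 < (N - C c * D).roots.toFinset.card)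
  -- Differences of points with the same multiple are torsion.
  refine ⟨Finset.univ.image fun x => P x - P ⟨x₁, hx₁⟩, ?_, ?_⟩
  · rw [Finset.card_image_of_injective _ fun x x' hxx => hP (sub_left_injective hxx),
      Finset.card_univ, Fintype.card_coe, hcard, h1]
  · simp only [Finset.mem_image, Finset.mem_univ, true_and, forall_exists_index,
      forall_apply_eq_imp_iff]
    intro x
    rw [smul_sub, hsmul x x.2, hsmul x₁ hx₁, sub_self]

end TorsionCount


/-! ### Division fields contain roots of unity -/

section DivisionField

variable {E : WeierstrassCurve ℚ}

lemma divisionField_mono {m n : ℕ} (h : m ∣ n) : divisionField E m ≤ divisionField E n := by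
  refine adjoin.mono _ _ _ ?_
  rintro z ⟨x, y, hxy, h0, hz⟩
  obtain ⟨c, rfl⟩ := h
  exact ⟨x, y, hxy, by rw [mul_comm, mul_nsmul', h0]; exact nsmul_zero c, hz⟩

lemma cyclotomicSubfield_le_of_isPrimitiveRoot {m : ℕ} (hm : m ≠ 0) {K : IntermediateField ℚ Qbar}
    {ζ : K} (h : IsPrimitiveRoot ζ m) : cyclotomicSubfield m ≤ K := by
  refine adjoin_le_iff.2 fun z hz => ?_
  have : NeZero m := ⟨hm⟩
  have h' : IsPrimitiveRoot (ζ : Qbar) m := h.map_of_injective (f := K.val) K.val.injective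
  obtain ⟨i, -, rfl⟩ := h'.eq_pow_of_pow_eq_one hz
  exact pow_mem ζ.2 i

/-- The `p`-division field contains the `p`-th roots of unity. -/
theorem cyclotomicSubfield_le_divisionField [E.IsShortNF] [E.IsElliptic] {p : ℕ} (hp : p.Prime)
    (hp2 : p ≠ 2) : cyclotomicSubfield p ≤ divisionField E p := by
  obtain ⟨m, rfl⟩ := hp.odd_of_ne_two hp2
  set K := divisionField E (2 * m + 1) with hK
  let _ : DecidableEq K := fun a b => Classical.propDecidable (a = b)
  have : IsScalarTower ℚ K Qbar := IsScalarTower.of_algebraMap_eq fun _ => rfl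
  obtain ⟨T, hT, hT'⟩ := exists_finset_torsion (W := E⁄Qbar) (n := 2 * m + 1) (by omega)
  have hm : 1 ≤ m := by
    by_contra! h
    obtain rfl : m = 0 := by omega
    exact Nat.not_prime_one hp
  obtain ⟨ζ, hζ⟩ := exists_isPrimitiveRoot_of_torsion (k := ℚ) (K := K) (F := Qbar) (W := E)
    hm hp T hT hT' fun P hP => by
      rcases P with _ | ⟨x, y, h⟩
      · exact ⟨0, map_zero _⟩
      · have hx : x ∈ K := subset_adjoin _ _ ⟨x, y, h, hT' _ hP, .inl rfl⟩
        have hy : y ∈ K := subset_adjoin _ _ ⟨x, y, h, hT' _ hP, .inr rfl⟩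
        have hxy : (E⁄K).toAffine.Nonsingular (⟨x, hx⟩ : K) ⟨y, hy⟩ :=
          (Affine.baseChange_nonsingular E (f := IsScalarTower.toAlgHom ℚ K Qbar)
            (RingHom.injective _) _ _).1 h
        exact ⟨.some _ _ hxy, Affine.Point.map_some _ hxy⟩
  exact cyclotomicSubfield_le_of_isPrimitiveRoot (by omega) hζ

end DivisionField


/-! ### Cubic Gauss sums -/

instance : Algebra.IsAlgebraic ℚ Qbar := AlgebraicClosure.isAlgebraic ℚ

instance : IsAlgClosure ℚ Qbar := ⟨inferInstance, inferInstance⟩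

instance : Normal ℚ Qbar := IsAlgClosure.normal ℚ Qbar

section GaussSums

lemma exists_eq_add_mul_of_mem_adjoin {R : Type*} [CommRing R] {ω z : R} (hω : ω ^ 2 + ω + 1 = 0)
    (hz : z ∈ Algebra.adjoin ℤ {ω}) : ∃ u v : ℤ, z = u + v * ω := by
  induction hz using Algebra.adjoin_induction with
  | mem x hx => exact ⟨0, 1, by simp [Set.mem_singleton_iff.1 hx]⟩
  | algebraMap r => exact ⟨r, 0, by simp⟩
  | add x y _ _ hx hy =>
    obtain ⟨u, v, rfl⟩ := hx
    obtain ⟨u', v', rfl⟩ := hy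
    exact ⟨u + u', v + v', by push_cast; ring⟩
  | mul x y _ _ hx hy =>
    obtain ⟨u, v, rfl⟩ := hx
    obtain ⟨u', v', rfl⟩ := hy
    exact ⟨u * u' - v * v', u * v' + v * u' - v * v', by
      push_cast; linear_combination (v * v' : R) * hω⟩

variable {p : ℕ} [hp : Fact p.Prime]

/-- The cubic Gauss sum of a prime `p ≡ 1 mod 3` plus its conjugate, and its cubic equation. -/
theorem exists_cubic_gauss_sum (h3 : 3 ∣ p - 1) : ∃ (k v : ℤ) (s : Qbar),
    4 * (p : ℤ) = (3 * k - 2) ^ 2 + 27 * v ^ 2 ∧ s ^ 3 = 3 * p * s + p * (3 * k - 2) ∧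
      s ∈ cyclotomicSubfield p := by
  obtain ⟨ω, hω⟩ := HasEnoughRootsOfUnity.exists_primitiveRoot Qbar 3
  obtain ⟨ζ, hζ⟩ := HasEnoughRootsOfUnity.exists_primitiveRoot Qbar p
  have hω2 : ω ^ 2 + ω + 1 = 0 := by
    have := hω.isRoot_cyclotomic three_pos
    rw [cyclotomic_three] at this
    simpa using this
  have hcard : 3 ∣ Fintype.card (ZMod p) - 1 := by rwa [ZMod.card]
  obtain ⟨χ, hχ⟩ := MulChar.exists_mulChar_orderOf (ZMod p) hcard hω
  have hχ3 : χ ^ 3 = 1 := hχ ▸ pow_orderOf_eq_one χ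
  have hχ1 : χ ≠ 1 := fun h => by simp [h] at hχ
  have hχ2 : χ ^ 2 = χ⁻¹ := eq_inv_of_mul_eq_one_left (by rw [← pow_succ, hχ3])
  -- `σ` plays the part of complex conjugation: it carries χ to χ⁻¹, and J(χ, χ) to its conjugate.
  obtain ⟨σ, hσ⟩ : ∃ σ : Qbar ≃ₐ[ℚ] Qbar, σ ω = ω ^ 2 := by
    refine (isConjRoot_iff_exists_algEquiv (K := ℚ) (L := Qbar)).1 ?_
    rw [IsConjRoot, ← cyclotomic_eq_minpoly_rat hω three_pos,
      ← cyclotomic_eq_minpoly_rat (hω.pow_of_coprime 2 (by norm_num)) three_pos]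
  have hχσ : χ ^ 2 = χ.ringHomComp (σ : Qbar →+* Qbar) := by
    refine MulChar.ext fun a => ?_
    obtain ⟨i, -, hi⟩ := MulChar.exists_apply_eq_pow hχ3 hω a.ne_zero
    rw [MulChar.pow_apply_coe, MulChar.ringHomComp_apply, hi]
    change _ = σ (ω ^ i)
    rw [map_pow, hσ, ← pow_mul, ← pow_mul, mul_comm]
  -- The congruence J ≡ -1 mod (ω - 1)² is what fixes the trace of J modulo 3, hence the shape 3k -
  -- 2.
  obtain ⟨z, hz, hJ⟩ := exists_jacobiSum_eq_neg_one_add (by norm_num) hχ3 hχ3 hcard hω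
  obtain ⟨u, v, rfl⟩ := exists_eq_add_mul_of_mem_adjoin hω2 hz
  have hJ' : jacobiSum χ⁻¹ χ⁻¹ = σ (jacobiSum χ χ) := by
    rw [← hχ2, hχσ, jacobiSum_ringHomComp]
    rfl
  have hJJ : jacobiSum χ χ * jacobiSum χ⁻¹ χ⁻¹ = p := by
    rw [jacobiSum_mul_jacobiSum_inv _ hχ1 hχ1, ZMod.card]
    · rw [← sq, hχ2]
      exact inv_ne_one.2 hχ1
    · rw [ringChar.eq_zero, ZMod.ringChar_zmod_n]
      exact hp.out.ne_zero.symm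
  have hψ := AddChar.zmodChar_primitive_of_primitive_root p hζ
  set ψ := AddChar.zmodChar p ((IsPrimitiveRoot.iff_def ζ p).mp hζ).left with hψdef
  have hneg : χ (-1) = 1 := by
    have h2 : χ (-1) ^ 2 = 1 := by rw [← map_pow]; simp
    have h3 : χ (-1) ^ 3 = 1 := by
      rw [← MulChar.pow_apply' χ three_ne_zero, hχ3, MulChar.one_apply isUnit_neg_one]
    linear_combination h3 - χ (-1) * h2
  have hG : gaussSum χ ψ ^ 3 = p * jacobiSum χ χ := by
    have := gaussSum_pow_eq_prod_jacobiSum (χ := χ) (by omega) hψ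
    simpa [hχ, hneg, ZMod.card] using this
  have hGG : gaussSum χ ψ * gaussSum (χ ^ 2) ψ = p := by
    have := gaussSum_mul_gaussSum_pow_orderOf_sub_one hχ1 hψ
    simpa [hχ, hneg, ZMod.card] using this
  have hp0 : (p : Qbar) ≠ 0 := Nat.cast_ne_zero.2 hp.out.ne_zero
  have hJ0 : jacobiSum χ χ ≠ 0 := left_ne_zero_of_mul (hJJ ▸ hp0)
  have hG' : gaussSum (χ ^ 2) ψ ^ 3 = p * jacobiSum χ⁻¹ χ⁻¹ := by
    refine mul_left_cancel₀ (mul_ne_zero hp0 hJ0) ?_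
    have := congrArg (· ^ 3) hGG
    linear_combination -gaussSum (χ ^ 2) ψ ^ 3 * hG + this - (p : Qbar) ^ 2 * hJJ
  have e1 : -1 + (u + v * ω) * (ω - 1) ^ 2 = (3 * v - 1) + (3 * v - 3 * u) * ω := by
    linear_combination (v * ω + u - 3 * v) * hω2
  have e2 : -1 + (u + v * ω ^ 2) * (ω ^ 2 - 1) ^ 2 = (3 * u - 1) - (3 * v - 3 * u) * ω := by
    linear_combination
      (v * ω ^ 4 - v * ω ^ 3 + (u - 2 * v) * ω ^ 2 + (3 * v - u) * ω - 2 * u) * hω2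
  have hσJ : σ (jacobiSum χ χ) = (3 * u - 1) - (3 * v - 3 * u) * ω := by
    rw [hJ, ← e2, ← hσ]
    simp
  rw [hJ', hσJ, hJ, e1] at hJJ
  rw [hJ', hσJ] at hG'
  rw [hJ, e1] at hG
  -- J = (3v - 1) + 3(v - u)ω has trace 3(u + v) - 2, and four times its norm is trace² + 27(v -
  -- u)².
  refine ⟨u + v, v - u, gaussSum χ ψ + gaussSum (χ ^ 2) ψ, ?_, ?_, ?_⟩
  · have : ((4 * (p : ℤ) : ℤ) : Qbar) =
        ((3 * (u + v) - 2) ^ 2 + 27 * (v - u) ^ 2 : ℤ) := by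
      push_cast
      linear_combination -4 * hJJ - 4 * (3 * v - 3 * u : Qbar) ^ 2 * hω2
    exact_mod_cast this
  · push_cast
    linear_combination hG + hG' + 3 * (gaussSum χ ψ + gaussSum (χ ^ 2) ψ) * hGG
  -- The cubic character values are not in ℚ(ζ_p), but the coefficients χ(a) + χ(a)² are 0, 2 or -1.
  · rw [gaussSum, gaussSum, ← Finset.sum_add_distrib]
    refine sum_mem fun a _ => ?_
    rw [← add_mul]
    refine mul_mem ?_ (subset_adjoin _ _ ?_)
    · rw [MulChar.pow_apply' χ two_ne_zero]
      by_cases ha : a = 0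
      · rw [ha, χ.map_zero]
        simp
      · have h1 : χ a ^ 3 = 1 := by
          rw [← MulChar.pow_apply' χ three_ne_zero, hχ3,
            MulChar.one_apply (isUnit_iff_ne_zero.2 ha)]
        have h2 : (χ a - 1) * (χ a + χ a ^ 2 + 1) = 0 := by linear_combination h1
        rcases mul_eq_zero.1 h2 with h | h
        · rw [sub_eq_zero.1 h]
          exact add_mem (one_mem _) (pow_mem (one_mem _) 2)
        · rw [eq_neg_of_add_eq_zero_left h]
          exact neg_mem (one_mem _)
    · change ψ a ^ p = 1
      rw [hψdef, AddChar.zmodChar_apply, ← pow_mul, mul_comm, pow_mul, hζ.pow_eq_one, one_pow]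

end GaussSums


/-! ### The representation 4p = (3k-2)² + 27N² -/

section GaussParameter

variable {p : ℕ} {k k' : ℤ}

/-- Otherwise p divides N as well, so p² divides 4p. This supplies the Eisenstein condition on the
constant term. -/
lemma IsGaussParameter.not_dvd (hp : p.Prime) (hp7 : 7 ≤ p) (h : IsGaussParameter p k) :
    ¬(p : ℤ) ∣ 3 * k - 2 := by
  obtain ⟨N, hN⟩ := h
  have hpz : Prime (p : ℤ) := Nat.prime_iff_prime_int.1 hp
  intro hd
  have h27 : ¬(p : ℤ) ∣ 27 := fun hd' => by
    have : (p : ℤ) ∣ 3 := hpz.dvd_of_dvd_pow (n := 3) (by simpa using hd')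
    have := Int.le_of_dvd (by norm_num) this
    omega
  have hdN : (p : ℤ) ∣ N := by
    have : (p : ℤ) ∣ 27 * N ^ 2 := by
      rw [show 27 * N ^ 2 = 4 * p - (3 * k - 2) ^ 2 by linarith]
      exact dvd_sub (dvd_mul_left _ _) (dvd_pow hd two_ne_zero)
    exact hpz.dvd_of_dvd_pow ((hpz.dvd_or_dvd this).resolve_left h27)
  obtain ⟨a, ha⟩ := hd
  obtain ⟨b, rfl⟩ := hdN
  rw [ha] at hN
  have : (4 : ℤ) = p * (a ^ 2 + 27 * b ^ 2) :=
    mul_left_cancel₀ hpz.ne_zero (by linear_combination hN)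
  have := Int.le_of_dvd (by norm_num) (Dvd.intro _ this.symm)
  omega

/-- Composing two representations gives 16p² = (LL' ± 27NN')² + 27(LN' ∓ L'N)². For one sign p
divides LN' ∓ L'N, which must then vanish because 27 > 16, and L² = L'² follows. -/
lemma IsGaussParameter.eq (hp : p.Prime) (h : IsGaussParameter p k)
    (h' : IsGaussParameter p k') : k' = k := by
  obtain ⟨N, hN⟩ := h
  obtain ⟨N', hN'⟩ := h'
  have hpz : Prime (p : ℤ) := Nat.prime_iff_prime_int.1 hp
  have hp0 : (0 : ℤ) < p := by exact_mod_cast hp.pos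
  generalize hL : 3 * k - 2 = L at hN
  generalize hL' : 3 * k' - 2 = L' at hN'
  have key (M : ℤ) (hM : M ^ 2 = N ^ 2) (hd : (p : ℤ) ∣ L * N' - L' * M) : L ^ 2 = L' ^ 2 := by
    obtain ⟨m, hm⟩ := hd
    have e : 16 * (p : ℤ) ^ 2 = (L * L' + 27 * M * N') ^ 2 + 27 * (L * N' - L' * M) ^ 2 := by
      linear_combination (4 * p) * hN' + (L' ^ 2 + 27 * N' ^ 2) * hN -
        27 * (L' ^ 2 + 27 * N' ^ 2) * hM
    have hm0 : m = 0 := by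
      by_contra hm0
      have : 1 ≤ m ^ 2 := by have := sq_pos_of_ne_zero hm0; omega
      rw [hm] at e
      nlinarith [sq_nonneg (L * L' + 27 * M * N'),
        mul_le_mul_of_nonneg_left this (sq_nonneg (p : ℤ)), sq_pos_of_pos hp0]
    rw [hm0, mul_zero, sub_eq_zero] at hm
    have e1 : (4 * p : ℤ) * L ^ 2 = 4 * p * L' ^ 2 := by
      linear_combination L ^ 2 * hN' - L' ^ 2 * hN + 27 * (L * N' + L' * M) * hm +
        27 * L' ^ 2 * hM
    exact mul_left_cancel₀ (by positivity) e1
  have hd : (p : ℤ) ∣ (L * N' - L' * N) * (L * N' - L' * -N) :=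
    ⟨4 * (N' ^ 2 - N ^ 2), by linear_combination N ^ 2 * hN' - N' ^ 2 * hN⟩
  have hsq : L ^ 2 = L' ^ 2 := (hpz.dvd_or_dvd hd).elim (key N rfl) (key (-N) (neg_sq N))
  -- L and L' are both 1 modulo 3, so L = -L' is impossible.
  rcases sq_eq_sq_iff_eq_or_eq_neg.1 hsq with h | h <;> omega

lemma ne_zero_of_gauss (hp : p.Prime) {N : ℤ} (h : 4 * (p : ℤ) = (3 * k - 2) ^ 2 + 27 * N ^ 2) :
    N ≠ 0 := by
  rintro rfl
  have hpz : Prime (p : ℤ) := Nat.prime_iff_prime_int.1 hp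
  have h2 : (2 : ℤ) ∣ 3 * k - 2 := Int.prime_two.dvd_of_dvd_pow (n := 2)
    ⟨2 * p, by linear_combination -h⟩
  obtain ⟨m, hm⟩ := h2
  rw [hm] at h
  exact hpz.not_isSquare ⟨m, by linarith⟩

end GaussParameter

/-! ### Subfields of cyclotomic fields -/

section CyclotomicSubfields

/-- In a cyclic group a subgroup of order d is the kernel of the d-th power map. -/
lemma subgroup_eq_of_card_eq {G : Type*} [CommGroup G] [IsCyclic G] [Finite G]
    {H H' : Subgroup G} (h : Nat.card H = Nat.card H') : H = H' := by
  have key (H : Subgroup G) : H = (powMonoidHom (Nat.card H) : G →* G).ker := by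
    refine Subgroup.eq_of_le_of_card_ge (fun x hx => ?_) ?_
    · exact congrArg Subtype.val (pow_card_eq_one' (x := (⟨x, hx⟩ : H)))
    · rw [IsCyclic.card_powMonoidHom_ker, Nat.gcd_eq_right H.card_subgroup_dvd_card]
  rw [key H, key H', h]

lemma intermediateField_eq_of_finrank_eq {K M : Type*} [Field K] [Field M] [Algebra K M]
    [FiniteDimensional K M] [IsGalois K M] {G : Type*} [CommGroup G] [IsCyclic G]
    (e : (M ≃ₐ[K] M) ≃* G) {L L' : IntermediateField K M}
    (h : Module.finrank K L = Module.finrank K L') : L = L' := by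
  have : Finite G := Finite.of_equiv _ e.toEquiv
  have hc : Nat.card L.fixingSubgroup = Nat.card L'.fixingSubgroup := by
    rw [IsGalois.card_fixingSubgroup_eq_finrank, IsGalois.card_fixingSubgroup_eq_finrank]
    have h1 := Module.finrank_mul_finrank K L M
    rw [← Module.finrank_mul_finrank K L' M, h] at h1
    exact Nat.eq_of_mul_eq_mul_left Module.finrank_pos h1
  have hmap : L.fixingSubgroup.map e.toMonoidHom = L'.fixingSubgroup.map e.toMonoidHom := by
    refine subgroup_eq_of_card_eq ?_
    rw [Subgroup.card_map_of_injective e.injective, Subgroup.card_map_of_injective e.injective, hc]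
  rw [← IsGalois.fixedField_fixingSubgroup L, ← IsGalois.fixedField_fixingSubgroup L',
    Subgroup.map_injective e.injective hmap]

section Generic

variable {k M : Type*} [Field k] [Field M] [Algebra k M] {C L L' : IntermediateField k M}

lemma isGalois_of_le (_ : IsAbelianGalois k C) (h : L ≤ C) : IsGalois k L := by
  have := IsAbelianGalois.of_algHom (inclusion h)
  infer_instance

lemma eq_of_mulEquiv_of_finrank_eq (_ : FiniteDimensional k C) (_ : IsGalois k C) {G : Type*} [CommGroup G]
    [IsCyclic G] (e : (C ≃ₐ[k] C) ≃* G) (h : L ≤ C) (h' : L' ≤ C)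
    (hd : Module.finrank k L = Module.finrank k L') : L = L' := by
  rw [← lift_restrict h, ← lift_restrict h']
  congr 1
  refine intermediateField_eq_of_finrank_eq e ?_
  rwa [← (restrictAlgEquiv h).toLinearEquiv.finrank_eq,
    ← (restrictAlgEquiv h').toLinearEquiv.finrank_eq]

end Generic

lemma isCyclotomicExtension_cyclotomicSubfield (m : ℕ) [NeZero m] :
    IsCyclotomicExtension {m} ℚ (cyclotomicSubfield m) := by
  obtain ⟨ζ, hζ⟩ := HasEnoughRootsOfUnity.exists_primitiveRoot Qbar m
  have : cyclotomicSubfield m = ℚ⟮ζ⟯ := by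
    refine le_antisymm ?_ ?_
    · refine adjoin_le_iff.2 fun z hz => ?_
      obtain ⟨i, -, rfl⟩ := hζ.eq_pow_of_pow_eq_one hz
      exact pow_mem (mem_adjoin_simple_self ℚ ζ) i
    · exact adjoin_simple_le_iff.2 (subset_adjoin _ _ hζ.pow_eq_one)
  rw [this]
  exact hζ.intermediateField_adjoin_isCyclotomicExtension ℚ

lemma isGalois_of_le_cyclotomicSubfield {m : ℕ} [NeZero m] {L : IntermediateField ℚ Qbar}
    (h : L ≤ cyclotomicSubfield m) : IsGalois ℚ L := by
  have := isCyclotomicExtension_cyclotomicSubfield m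
  have := IsCyclotomicExtension.isAbelianGalois {m} ℚ (cyclotomicSubfield m)
  exact isGalois_of_le this h

lemma cyclotomicSubfield_mono {m n : ℕ} (h : m ∣ n) :
    cyclotomicSubfield m ≤ cyclotomicSubfield n := by
  refine adjoin.mono _ _ _ fun z hz => ?_
  obtain ⟨c, rfl⟩ := h
  change z ^ (m * c) = 1
  rw [pow_mul, show z ^ m = 1 from hz, one_pow]

/-- A cyclotomic field of odd prime power conductor has at most one subfield of each degree. -/
theorem eq_of_le_cyclotomicSubfield {p n : ℕ} (hp : p.Prime) (hp2 : p ≠ 2)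
    {L L' : IntermediateField ℚ Qbar} (h : L ≤ cyclotomicSubfield (p ^ n))
    (h' : L' ≤ cyclotomicSubfield (p ^ n)) (hd : Module.finrank ℚ L = Module.finrank ℚ L') :
    L = L' := by
  have : NeZero (p ^ n) := ⟨(pow_pos hp.pos n).ne'⟩
  have := isCyclotomicExtension_cyclotomicSubfield (p ^ n)
  have hG := IsCyclotomicExtension.isGalois {p ^ n} ℚ (cyclotomicSubfield (p ^ n))
  have hF := IsCyclotomicExtension.finiteDimensional {p ^ n} ℚ (cyclotomicSubfield (p ^ n))
  have := ZMod.isCyclic_units_of_prime_pow p hp hp2 n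
  have e := IsCyclotomicExtension.autEquivPow (n := p ^ n) (cyclotomicSubfield (p ^ n))
    (cyclotomic.irreducible_rat (NeZero.pos (p ^ n)))
  exact eq_of_mulEquiv_of_finrank_eq hF hG e h h' hd

end CyclotomicSubfields


/-! ### Cubic fields and roots of the Rubin–Silverberg cubic -/

section CubicFields

variable {k M : Type*} [Field k] [Field M] [Algebra k M] {L : IntermediateField k M} {α β : M}

lemma adjoin_simple_eq_of_prime_finrank (hL : (Module.finrank k L).Prime) (hα : α ∈ L)
    (hα' : α ∉ (⊥ : IntermediateField k M)) : k⟮α⟯ = L := by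
  have : FiniteDimensional k L := Module.finite_of_finrank_pos hL.pos
  have hle : k⟮α⟯ ≤ L := adjoin_simple_le_iff.2 hα
  rcases (Nat.dvd_prime hL).1 (finrank_dvd_of_le_right hle) with h | h
  · exact absurd (finrank_adjoin_simple_eq_one_iff.1 h) hα'
  · exact eq_of_le_of_finrank_eq hle h

lemma minpoly_eq_of_finrank {f : k[X]} (hf : f.Monic) (hα : aeval α f = 0)
    (hd : Module.finrank k k⟮α⟯ = f.natDegree) : minpoly k α = f := by
  have hi : IsIntegral k α := ⟨f, hf, hα⟩
  refine (eq_of_monic_of_dvd_of_natDegree_le (minpoly.monic hi) hf (minpoly.dvd k α hα) ?_).symm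
  rw [← hd, adjoin.finrank hi]

lemma eq_zero_of_quadratic (h3 : Module.finrank k k⟮α⟯ = 3) {x y z : k}
    (h : algebraMap k M x * α ^ 2 + algebraMap k M y * α + algebraMap k M z = 0) :
    x = 0 ∧ y = 0 := by
  have : FiniteDimensional k k⟮α⟯ := Module.finite_of_finrank_pos (by omega)
  have hi : IsIntegral k α :=
    (AdjoinSimple.isIntegral_gen k α).1 (.of_finite k _)
  have h0 : C x * X ^ 2 + C y * X + C z = 0 := by
    by_contra hne
    have hle := minpoly.degree_le_of_ne_zero k α hne (by simpa using h)
    have := natDegree_le_natDegree hle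
    rw [← adjoin.finrank hi, h3] at this
    have := natDegree_quadratic_le (a := x) (b := y) (c := z)
    omega
  have h1 := congrArg (coeff · 1) h0
  have h2 := congrArg (coeff · 2) h0
  simp [coeff_C] at h1 h2
  exact ⟨h2, h1⟩

variable {a b : k}

lemma monic_depressed_cubic {R : Type*} [CommRing R] [Nontrivial R] (a b : R) :
    (X ^ 3 + C a * X + C b).Monic ∧ (X ^ 3 + C a * X + C b).natDegree = 3 :=
  ⟨by monicity!, by compute_degree!⟩

lemma minpoly_eq_depressed_cubic (h3 : Module.finrank k k⟮α⟯ = 3)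
    (h : α ^ 3 + algebraMap k M a * α + algebraMap k M b = 0) :
    minpoly k α = X ^ 3 + C a * X + C b :=
  minpoly_eq_of_finrank (monic_depressed_cubic a b).1 (by simpa using h)
    (by rw [h3, (monic_depressed_cubic a b).2])

lemma discr_ne_zero_of_finrank [CharZero k] (h3 : Module.finrank k k⟮α⟯ = 3)
    (h : α ^ 3 + algebraMap k M a * α + algebraMap k M b = 0) : 4 * a ^ 3 + 27 * b ^ 2 ≠ 0 := by
  intro hd
  have hm := minpoly_eq_depressed_cubic h3 h
  have hi : IsIntegral k α := by
    by_contra hi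
    rw [minpoly.eq_zero hi] at hm
    exact (monic_depressed_cubic a b).1.ne_zero hm.symm
  have hirr := hm ▸ minpoly.irreducible hi
  have hroot : ∃ r, (X ^ 3 + C a * X + C b : k[X]).IsRoot r := by
    by_cases ha : a = 0
    · have hb : b = 0 := by simpa [ha] using hd
      exact ⟨0, by simp [ha, hb]⟩
    -- With vanishing discriminant the double root is -3b/(2a), and the roots sum to zero, so the
    -- remaining one is 3b/a.
    · refine ⟨3 * b / a, ?_⟩
      simp only [IsRoot, eval_add, eval_pow, eval_X, eval_mul, eval_C]
      field_simp
      linear_combination b * hd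
  obtain ⟨r, hr⟩ := hroot
  have h1 := natDegree_eq_of_degree_eq_some (degree_eq_one_of_irreducible_of_root hirr hr)
  have h2 := (monic_depressed_cubic a b).2
  rw [h1] at h2
  exact absurd h2 (by norm_num)

/-- The element generating the `2`-division field of a member of the Rubin–Silverberg family. -/
lemma rubinSilverberg_root {t : k} (hδ : 4 * a ^ 3 + 27 * b ^ 2 ≠ 0)
    (h : α ^ 3 + algebraMap k M a * α + algebraMap k M b = 0)
    (hβ : algebraMap k M (4 * a ^ 3 + 27 * b ^ 2) * β =
      algebraMap k M (-18 * a * b * t) * α ^ 2 +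
      algebraMap k M (4 * a ^ 3 + 27 * b ^ 2 + 27 * b ^ 2 * t) * α +
      algebraMap k M (-12 * a ^ 2 * b * t)) :
    β ^ 3 + algebraMap k M (a * (1 + (4 * a ^ 3 / (4 * a ^ 3 + 27 * b ^ 2) - 1) * t ^ 2)) * β +
      algebraMap k M (b * (1 + 3 * t - 3 * (4 * a ^ 3 / (4 * a ^ 3 + 27 * b ^ 2) - 1) * t ^ 2
        - (4 * a ^ 3 / (4 * a ^ 3 + 27 * b ^ 2) - 1) * t ^ 3)) = 0 := by
  have hδ' := (map_ne_zero (algebraMap k M)).2 hδ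
  have e : 4 * a ^ 3 / (4 * a ^ 3 + 27 * b ^ 2) - 1 = -27 * b ^ 2 / (4 * a ^ 3 + 27 * b ^ 2) := by
    field_simp
    ring
  have e1 : -27 * b ^ 2 / (4 * a ^ 3 + 27 * b ^ 2) * (4 * a ^ 3 + 27 * b ^ 2) = -27 * b ^ 2 :=
    div_mul_cancel₀ _ hδ
  rw [e]
  generalize -27 * b ^ 2 / (4 * a ^ 3 + 27 * b ^ 2) = c at *
  have e2 := congrArg (algebraMap k M) e1
  simp only [map_mul, map_add, map_sub, map_one, map_pow, map_ofNat, map_neg] at *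
  generalize algebraMap k M a = a' at *
  generalize algebraMap k M b = b' at *
  generalize algebraMap k M c = c' at *
  generalize algebraMap k M t = x at *
  refine (mul_eq_zero.1 ?_).resolve_left (pow_ne_zero 3 hδ')
  rw [← sub_eq_zero] at hβ
  obtain ⟨R, hR⟩ : ∃ R, R = -18 * a' * b' * x * α ^ 2 +
    (4 * a' ^ 3 + 27 * b' ^ 2 + 27 * b' ^ 2 * x) * α + -12 * a' ^ 2 * b' * x := ⟨_, rfl⟩
  rw [← hR] at hβ
  obtain ⟨d, hd⟩ : ∃ d, d = 4 * a' ^ 3 + 27 * b' ^ 2 := ⟨_, rfl⟩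
  -- The cubic of the family with denominators cleared, at R = dβ. As a polynomial in α it is
  -- divisible by α³ + aα + b, and the cofactor below is the quotient.
  have key : R ^ 3 + d * a' * (d - 27 * b' ^ 2 * x ^ 2) * R +
      d ^ 2 * b' * (d + 3 * d * x + 81 * b' ^ 2 * x ^ 2 + 27 * b' ^ 2 * x ^ 3) = 0 := by
    rw [hR, hd]
    linear_combination
      (-5832 * α ^ 3 * a' ^ 3 * b' ^ 3 * x ^ 3 + 3888 * α ^ 2 * a' ^ 5 * b' ^ 2 * x ^ 2 +
        26244 * α ^ 2 * a' ^ 2 * b' ^ 4 * x ^ 3 + 26244 * α ^ 2 * a' ^ 2 * b' ^ 4 * x ^ 2 -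
        864 * α * a' ^ 7 * b' * x - 5832 * α * a' ^ 4 * b' ^ 3 * x ^ 3 -
        11664 * α * a' ^ 4 * b' ^ 3 * x ^ 2 - 11664 * α * a' ^ 4 * b' ^ 3 * x -
        39366 * α * a' * b' ^ 5 * x ^ 3 - 78732 * α * a' * b' ^ 5 * x ^ 2 -
        39366 * α * a' * b' ^ 5 * x + 64 * a' ^ 9 + 1296 * a' ^ 6 * b' ^ 2 * x ^ 2 +
        1296 * a' ^ 6 * b' ^ 2 * x + 1296 * a' ^ 6 * b' ^ 2 +
        14580 * a' ^ 3 * b' ^ 4 * x ^ 3 + 17496 * a' ^ 3 * b' ^ 4 * x ^ 2 +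
        17496 * a' ^ 3 * b' ^ 4 * x + 8748 * a' ^ 3 * b' ^ 4 + 19683 * b' ^ 6 * x ^ 3 +
        59049 * b' ^ 6 * x ^ 2 + 59049 * b' ^ 6 * x + 19683 * b' ^ 6) * h
  rw [← hd] at hβ e2 ⊢
  linear_combination key + ((d * β) ^ 2 + d * β * R + R ^ 2 + d ^ 2 * a' * (1 + c' * x ^ 2)) * hβ +
    (d * a' * x ^ 2 * R + d ^ 2 * b' * (-3 * x ^ 2 - x ^ 3)) * e2

/-- The degree 3 is prime, so `β` need only be irrational over `k`. Otherwise it would give a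
relation of degree at most 2 for `α`, whose coefficients force t = 0 and then a zero discriminant.
-/
lemma exists_adjoin_eq_rubinSilverberg_root [CharZero k] (h3 : Module.finrank k k⟮α⟯ = 3)
    (h : α ^ 3 + algebraMap k M a * α + algebraMap k M b = 0) (ha : a ≠ 0) (hb : b ≠ 0) (t : k) :
    ∃ β : M, k⟮β⟯ = k⟮α⟯ ∧
      β ^ 3 + algebraMap k M (a * (1 + (4 * a ^ 3 / (4 * a ^ 3 + 27 * b ^ 2) - 1) * t ^ 2)) * β +
      algebraMap k M (b * (1 + 3 * t - 3 * (4 * a ^ 3 / (4 * a ^ 3 + 27 * b ^ 2) - 1) * t ^ 2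
        - (4 * a ^ 3 / (4 * a ^ 3 + 27 * b ^ 2) - 1) * t ^ 3)) = 0 := by
  have hδ := discr_ne_zero_of_finrank h3 h
  have hδ' := (map_ne_zero (algebraMap k M)).2 hδ
  obtain ⟨β, hβ⟩ : ∃ β, algebraMap k M (4 * a ^ 3 + 27 * b ^ 2) * β =
      algebraMap k M (-18 * a * b * t) * α ^ 2 +
      algebraMap k M (4 * a ^ 3 + 27 * b ^ 2 + 27 * b ^ 2 * t) * α +
      algebraMap k M (-12 * a ^ 2 * b * t) := ⟨_, mul_div_cancel₀ _ hδ'⟩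
  refine ⟨β, adjoin_simple_eq_of_prime_finrank (h3 ▸ Nat.prime_three) ?_ ?_,
    rubinSilverberg_root hδ h hβ⟩
  · have hα := mem_adjoin_simple_self k α
    rw [eq_div_of_mul_eq hδ' ((mul_comm _ _).trans hβ)]
    exact div_mem (add_mem (add_mem (mul_mem (k⟮α⟯.algebraMap_mem _) (pow_mem hα 2))
      (mul_mem (k⟮α⟯.algebraMap_mem _) hα)) (k⟮α⟯.algebraMap_mem _)) (k⟮α⟯.algebraMap_mem _)
  · intro hmem
    obtain ⟨r, rfl⟩ := mem_bot.1 hmem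
    obtain ⟨h1, h2⟩ := eq_zero_of_quadratic (x := -18 * a * b * t)
      (y := 4 * a ^ 3 + 27 * b ^ 2 + 27 * b ^ 2 * t)
      (z := -12 * a ^ 2 * b * t - (4 * a ^ 3 + 27 * b ^ 2) * r) h3 (by
        rw [map_sub, map_mul _ _ r, hβ]
        ring)
    have ht : t = 0 := by simpa [ha, hb] using h1
    exact hδ (by simpa [ht] using h2)

end CubicFields


/-! ### The 2-division field -/

section TwoTorsion

variable {F : Type*} [Field F] [CharZero F] {W : WeierstrassCurve F} [W.IsShortNF]

lemma two_smul_eq_zero_iff {x y : F} (h : W.toAffine.Nonsingular x y) :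
    2 • Affine.Point.some x y h = 0 ↔ y = 0 := by
  rw [two_smul, ← eq_neg_iff_add_eq_zero]
  obtain ⟨h', e⟩ := neg_some_eq h
  rw [e, Affine.Point.some.injEq]
  simp [eq_neg_iff_add_eq_zero, ← two_mul]

end TwoTorsion

lemma mem_of_isConjRoot {k M : Type*} [Field k] [Field M] [Algebra k M] (_ : Normal k M)
    {L : IntermediateField k M} (hL : Normal k L) {α β : M} (hα : α ∈ L)
    (h : minpoly k α = minpoly k β) : β ∈ L := by
  obtain ⟨σ, hσ⟩ := (isConjRoot_iff_exists_algEquiv (K := k) (L := M)).1 h.symm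
  exact (normal_iff_forall_map_le'.1 hL) σ ⟨α, hα, hσ⟩

section TwoDivisionField

variable {W : WeierstrassCurve ℚ} [W.IsShortNF] {β : Qbar}

/-- Nonzero 2-torsion points are (x, 0) with x a conjugate of `β`, and normality puts all conjugates
in ℚ(β). -/
lemma divisionField_two_eq [W.IsElliptic] (h3 : Module.finrank ℚ ℚ⟮β⟯ = 3)
    (hN : Normal ℚ ℚ⟮β⟯) (h : β ^ 3 + algebraMap ℚ Qbar W.a₄ * β + algebraMap ℚ Qbar W.a₆ = 0) :
    divisionField W 2 = ℚ⟮β⟯ := by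
  have hm := minpoly_eq_depressed_cubic h3 h
  refine le_antisymm (adjoin_le_iff.2 ?_) (adjoin_simple_le_iff.2 (subset_adjoin _ _ ?_))
  · rintro z ⟨x, y, hxy, h2, hz⟩
    have hy : y = 0 := (two_smul_eq_zero_iff hxy).1 h2
    have hx := (equation_iff_short (W := W) (A := Qbar)).1 hxy.1
    rcases hz with rfl | rfl
    · refine mem_of_isConjRoot inferInstance hN (mem_adjoin_simple_self ℚ β) ?_
      rw [hm]
      refine minpoly.eq_of_irreducible_of_monic ?_ ?_ (monic_depressed_cubic _ _).1
      · exact hm ▸ minpoly.irreducible (Algebra.IsIntegral.isIntegral β)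
      · simpa [hy] using hx.symm
    · rw [hy]
      exact zero_mem _
  · have hβ : (W⁄Qbar).toAffine.Nonsingular β 0 :=
      (Affine.equation_iff_nonsingular).1 ((equation_iff_short (W := W) (A := Qbar)).2 (by
        rw [h]
        ring))
    exact ⟨β, 0, hβ, (two_smul_eq_zero_iff hβ).2 rfl, .inl rfl⟩

lemma isElliptic_of_finrank (h3 : Module.finrank ℚ ℚ⟮β⟯ = 3)
    (h : β ^ 3 + algebraMap ℚ Qbar W.a₄ * β + algebraMap ℚ Qbar W.a₆ = 0) : W.IsElliptic := by
  refine ⟨?_⟩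
  rw [Δ_of_isShortNF, isUnit_iff_ne_zero]
  exact mul_ne_zero (by norm_num) (discr_ne_zero_of_finrank h3 h)

end TwoDivisionField

/-! ### The Rubin–Silverberg family and its j-invariants -/

section RubinSilverberg

variable {a b : ℚ} {α : Qbar}

instance (a b t : ℚ) : (rubinSilverberg a b t).IsShortNF := ⟨rfl, rfl, rfl⟩

/-- All members of the Rubin–Silverberg family of a curve with cyclic cubic `2`-division field
are elliptic curves with the same `2`-division field. -/
theorem rubinSilverberg_divisionField_two (h3 : Module.finrank ℚ ℚ⟮α⟯ = 3)
    (hN : Normal ℚ ℚ⟮α⟯) (h : α ^ 3 + algebraMap ℚ Qbar a * α + algebraMap ℚ Qbar b = 0)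
    (ha : a ≠ 0) (hb : b ≠ 0) (t : ℚ) : (rubinSilverberg a b t).IsElliptic ∧
      divisionField (rubinSilverberg a b t) 2 = ℚ⟮α⟯ := by
  obtain ⟨β, hβ, hroot⟩ := exists_adjoin_eq_rubinSilverberg_root h3 h ha hb t
  rw [← hβ] at h3 hN ⊢
  have := isElliptic_of_finrank (W := rubinSilverberg a b t) h3 hroot
  exact ⟨this, divisionField_two_eq h3 hN hroot⟩

/-- Clearing denominators in the equation for j gives a polynomial in t. If it were zero, its
derivative at 0 would give j = 0, and its value at 0 would then give a = 0. -/
lemma finite_setOf_rubinSilverberg_j (ha : a ≠ 0) (hb : b ≠ 0)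
    (j : ℚ) : {t : ℚ | ∃ _ : (rubinSilverberg a b t).IsElliptic,
      (rubinSilverberg a b t).j = j}.Finite := by
  set c := 4 * a ^ 3 / (4 * a ^ 3 + 27 * b ^ 2) - 1 with hc
  set P : ℚ[X] := C (6912 * a ^ 3) * (1 + C c * X ^ 2) ^ 3 -
    C j * (C (4 * a ^ 3) * (1 + C c * X ^ 2) ^ 3 +
      C (27 * b ^ 2) * (1 + C 3 * X - C (3 * c) * X ^ 2 - C c * X ^ 3) ^ 2) with hP
  have hP0 : P ≠ 0 := by
    intro h0
    have e0 := congrArg (eval 0) h0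
    have e1 := congrArg (fun Q => eval 0 (derivative Q)) h0
    simp [hP, derivative_pow] at e0 e1
    have hj := e1.resolve_right hb
    exact ha (by simpa [hj] using e0)
  refine (finite_setOfPred_isRoot hP0).subset ?_
  rintro t ⟨hE, hj⟩
  have hd := discr_ne_zero (W := rubinSilverberg a b t)
  rw [j_of_isShortNF, div_eq_iff hd] at hj
  simp only [rubinSilverberg, ← hc] at hj
  change eval t P = 0
  simp only [hP, eval_sub, eval_mul, eval_add, eval_pow, eval_C, eval_X, eval_one]
  linear_combination hj

theorem infinite_rubinSilverberg_j (ha : a ≠ 0) (hb : b ≠ 0)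
    (hE : ∀ t, (rubinSilverberg a b t).IsElliptic) :
    {j : ℚ | ∃ (t : ℚ) (_ : (rubinSilverberg a b t).IsElliptic),
      (rubinSilverberg a b t).j = j}.Infinite := by
  intro hfin
  refine Set.infinite_univ (α := ℚ) ((hfin.biUnion fun j _ =>
    finite_setOf_rubinSilverberg_j ha hb j).subset fun t _ => ?_)
  have := hE t
  exact Set.mem_biUnion ⟨t, this, rfl⟩ ⟨this, rfl⟩

end RubinSilverberg


/-! ### Gauss's cubic and the explicit curves -/

section GaussPoly

variable {p : ℕ} {k : ℤ}

lemma irreducible_eisenstein_cubic (hp : p.Prime) {l : ℤ} (hl : ¬(p : ℤ) ∣ l) :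
    Irreducible (X ^ 3 + C (-3 * p : ℚ) * X + C (-p * l : ℚ)) := by
  have hpz : Prime (p : ℤ) := Nat.prime_iff_prime_int.1 hp
  obtain ⟨hm, hd⟩ := monic_depressed_cubic (-3 * p : ℤ) (-p * l)
  have hirr : Irreducible (X ^ 3 + C (-3 * p : ℤ) * X + C (-p * l : ℤ)) := by
    refine IsEisensteinAt.irreducible (𝓟 := Ideal.span {(p : ℤ)}) ⟨?_, ?_, ?_⟩
      ((Ideal.span_singleton_prime hpz.ne_zero).2 hpz) hm.isPrimitive (by omega)
    · rw [hm.leadingCoeff, Ideal.mem_span_singleton]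
      exact fun h => hpz.not_isUnit (isUnit_of_dvd_one h)
    · intro n hn
      rw [hd] at hn
      rw [Ideal.mem_span_singleton]
      interval_cases n <;> simp [coeff_X]
    · rw [Ideal.span_singleton_pow, Ideal.mem_span_singleton]
      simp only [coeff_add, coeff_X_pow, coeff_C_mul, coeff_X_zero, coeff_C_zero]
      norm_num
      rw [sq]
      exact fun h => hl ((mul_dvd_mul_iff_left hpz.ne_zero).1 h)
  have := (hm.irreducible_iff_irreducible_map_fraction_map (K := ℚ)).1 hirr
  have e1 : algebraMap ℤ ℚ (-3 * p) = -3 * p := by simp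
  have e2 : algebraMap ℤ ℚ (-p * l) = -p * l := by simp
  simpa only [Polynomial.map_add, Polynomial.map_mul, Polynomial.map_pow, map_X, map_C, e1, e2]
    using this

lemma monic_gaussPoly : (gaussPoly p k).Monic ∧ (gaussPoly p k).natDegree = 3 :=
  ⟨by unfold gaussPoly; monicity!, by unfold gaussPoly; compute_degree!⟩

/-- The cubic subfield of `ℚ(ζ_p)`, with its generators. -/
theorem exists_cubic_subfield (hp : p.Prime) (hp7 : 7 ≤ p) (h3 : 3 ∣ p - 1) :
    ∃ (k : ℤ) (s : Qbar), IsGaussParameter p k ∧ s ∈ cyclotomicSubfield p ∧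
      s ^ 3 = 3 * p * s + p * (3 * k - 2) ∧ Module.finrank ℚ ℚ⟮s⟯ = 3 := by
  have : Fact p.Prime := ⟨hp⟩
  obtain ⟨k, v, s, hv, hs, hmem⟩ := exists_cubic_gauss_sum h3
  have hk : IsGaussParameter p k := ⟨v, hv⟩
  refine ⟨k, s, hk, hmem, hs, ?_⟩
  have hirr := irreducible_eisenstein_cubic hp (hk.not_dvd hp hp7)
  have hm := monic_depressed_cubic (-3 * p : ℚ) (-p * (3 * k - 2 : ℤ) : ℚ)
  have := minpoly.eq_of_irreducible_of_monic (x := s) hirr (by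
    simp
    linear_combination hs) hm.1
  rw [adjoin.finrank (Algebra.IsIntegral.isIntegral s), ← this, hm.2]

lemma adjoin_affine_eq {k M : Type*} [Field k] [Field M] [Algebra k M] {s α : M} {u v : k}
    (hu : u ≠ 0) (h : s = algebraMap k M u * α + algebraMap k M v) : k⟮α⟯ = k⟮s⟯ := by
  have hu' := (map_ne_zero (algebraMap k M)).2 hu
  refine le_antisymm (adjoin_simple_le_iff.2 ?_) (adjoin_simple_le_iff.2 ?_)
  · have e : α = (s - algebraMap k M v) / algebraMap k M u := by
      rw [h, add_sub_cancel_right, mul_div_cancel_left₀ _ hu']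
    rw [e]
    exact div_mem (sub_mem (mem_adjoin_simple_self k s) (k⟮s⟯.algebraMap_mem _))
      (k⟮s⟯.algebraMap_mem _)
  · rw [h]
    exact add_mem (mul_mem (k⟮α⟯.algebraMap_mem _) (mem_adjoin_simple_self k α))
      (k⟮α⟯.algebraMap_mem _)

lemma gaussCurve_variableChange :
    (⟨1, -1 / 3, 0, 0⟩ : WeierstrassCurve.VariableChange ℚ) • gaussCurve p k = baseCurve p k := by
  have h : (gaussCurve p k).a₂ = 1 ∧ (gaussCurve p k).a₄ = -(((p : ℚ) - 1) / 3) ∧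
      (gaussCurve p k).a₆ = -((((p : ℚ) - 1) / 3 + (k : ℚ) * (p : ℚ)) / 9) := by
    refine ⟨?_, ?_, ?_⟩ <;> simp [gaussCurve, gaussPoly, coeff_X, coeff_C]
  have h1 : (gaussCurve p k).a₁ = 0 ∧ (gaussCurve p k).a₃ = 0 := ⟨rfl, rfl⟩
  ext <;> simp only [WeierstrassCurve.variableChange_a₁, WeierstrassCurve.variableChange_a₂,
    WeierstrassCurve.variableChange_a₃, WeierstrassCurve.variableChange_a₄,
    WeierstrassCurve.variableChange_a₆, h, h1, baseCurve, inv_one, Units.val_one] <;> ring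

lemma familyCurve_eq (hp : p.Prime) (hk : IsGaussParameter p k) (t : ℚ) :
    familyCurve p k t = rubinSilverberg (baseCurve p k).a₄ (baseCurve p k).a₆ t := by
  obtain ⟨N, hN⟩ := hk
  have hN0 : (N : ℚ) ≠ 0 := Int.cast_ne_zero.2 (ne_zero_of_gauss hp hN)
  have hp0 : (p : ℚ) ≠ 0 := Nat.cast_ne_zero.2 hp.ne_zero
  have hNq : 4 * (p : ℚ) = (3 * k - 2) ^ 2 + 27 * N ^ 2 := by exact_mod_cast hN
  have hD : (p : ℚ) - (3 * k - 2) ^ 2 / 4 = 27 / 4 * N ^ 2 := by linear_combination hNq / 4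
  have hD0 : (p : ℚ) - (3 * k - 2) ^ 2 / 4 ≠ 0 := by
    rw [hD]
    positivity
  -- This is J - 1 = M/D; D is nonzero because it equals 27N²/4.
  have hJ : 4 * (-(p : ℚ) / 3) ^ 3 / (4 * (-(p : ℚ) / 3) ^ 3 +
      27 * ((p : ℚ) * (2 - 3 * (k : ℚ)) / 27) ^ 2) - 1 =
      (3 * k - 2) ^ 2 / 4 / ((p : ℚ) - (3 * k - 2) ^ 2 / 4) := by
    have e : 4 * (-(p : ℚ) / 3) ^ 3 + 27 * ((p : ℚ) * (2 - 3 * (k : ℚ)) / 27) ^ 2 =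
        -(4 / 27 * p ^ 2) * ((p : ℚ) - (3 * k - 2) ^ 2 / 4) := by ring
    have e0 : -(4 / 27 * (p : ℚ) ^ 2) ≠ 0 := by simpa using hp0
    rw [e, div_sub_one (mul_ne_zero e0 hD0), div_eq_div_iff (mul_ne_zero e0 hD0) hD0]
    ring
  simp only [familyCurve, rubinSilverberg, baseCurve, hJ]
  clear hD hJ
  generalize (p : ℚ) - (3 * k - 2) ^ 2 / 4 = D at *
  generalize (3 * (k : ℚ) - 2) ^ 2 / 4 = M at *
  congr 1 <;> field_simp

end GaussPoly

end Entanglement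

end

/-! ### The main theorem -/

theorem mainTheorem7 (p n : ℕ) (hp : p.Prime) (hp7 : 7 ≤ p) (h3 : 3 ∣ p - 1) (hn : 1 ≤ n) :
    ∃ (k : ℤ) (L : IntermediateField ℚ Entanglement.Qbar),
      -- `k` is the unique integer with `4p = (3k-2)² + 27N²`
      Entanglement.IsGaussParameter p k ∧
      (∀ k' : ℤ, Entanglement.IsGaussParameter p k' → k' = k) ∧
      -- `L` is the cubic subfield of `ℚ(ζ_p)`, and the only one of `ℚ(ζ_{p^n})`; it is cyclic
      L ≤ Entanglement.cyclotomicSubfield p ∧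
      Module.finrank ℚ L = 3 ∧
      IsGalois ℚ L ∧
      (∀ L' : IntermediateField ℚ Entanglement.Qbar,
        L' ≤ Entanglement.cyclotomicSubfield (p ^ n) → Module.finrank ℚ L' = 3 → L' = L) ∧
      -- Gauss's polynomial is the minimal polynomial of a generator of `L`
      (∃ α : Entanglement.Qbar, minpoly ℚ α = Entanglement.gaussPoly p k ∧
        IntermediateField.adjoin ℚ {α} = L) ∧
      -- `E` is the curve `Y² = g(X)` after the substitution `X = x - 1/3`
      (⟨1, -1 / 3, 0, 0⟩ : WeierstrassCurve.VariableChange ℚ) • Entanglement.gaussCurve p k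
        = Entanglement.baseCurve p k ∧
      -- the `E_t` form the Rubin–Silverberg family of `E`
      (∀ t : ℚ, Entanglement.familyCurve p k t =
        Entanglement.rubinSilverberg (Entanglement.baseCurve p k).a₄
          (Entanglement.baseCurve p k).a₆ t) ∧
      -- every `E_t` is an elliptic curve with the required entanglement field
      (∀ t : ℚ, (Entanglement.familyCurve p k t).IsElliptic ∧
        Entanglement.divisionField (Entanglement.familyCurve p k t) 2 ⊓
          Entanglement.divisionField (Entanglement.familyCurve p k t) (p ^ n) = L) ∧
      -- infinitely many of the `E_t` are pairwise non-isomorphic, even over `Qbar`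
      {j : ℚ | ∃ (t : ℚ) (_ : (Entanglement.familyCurve p k t).IsElliptic),
        (Entanglement.familyCurve p k t).j = j}.Infinite := by
  open Entanglement in
  obtain ⟨k, s, hk, hmem, hs, hrank⟩ := exists_cubic_subfield hp hp7 h3
  have hp0 : (p : ℚ) ≠ 0 := Nat.cast_ne_zero.2 hp.ne_zero
  have hp2 : p ≠ 2 := by omega
  have : NeZero p := ⟨hp.ne_zero⟩
  have hle : IntermediateField.adjoin ℚ {s} ≤ cyclotomicSubfield p :=
    IntermediateField.adjoin_simple_le_iff.2 hmem
  have hgal := isGalois_of_le_cyclotomicSubfield hle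
  have hpn : p ∣ p ^ n := dvd_pow_self p (by omega)
  -- (s - 1)/3 is the root of g, and s/3 that of the cubic of E; they differ by the shift 1/3.
  have hα : IntermediateField.adjoin ℚ {(s - 1) / 3} = IntermediateField.adjoin ℚ {s} :=
    adjoin_affine_eq (u := 3) (v := 1) (by norm_num) (by simp; field_simp; ring)
  have hα₀ : IntermediateField.adjoin ℚ {s / 3} = IntermediateField.adjoin ℚ {s} :=
    adjoin_affine_eq (u := 3) (v := 0) (by norm_num) (by simp; field_simp)
  have hroot : (s / 3) ^ 3 + algebraMap ℚ Qbar (baseCurve p k).a₄ * (s / 3) +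
      algebraMap ℚ Qbar (baseCurve p k).a₆ = 0 := by
    simp [baseCurve]
    linear_combination hs / 27
  have ha : (baseCurve p k).a₄ ≠ 0 := by simpa [baseCurve] using hp0
  have hb : (baseCurve p k).a₆ ≠ 0 := by
    have : (2 : ℚ) - 3 * k ≠ 0 := by
      have : (2 : ℤ) - 3 * k ≠ 0 := by omega
      exact_mod_cast this
    simp only [baseCurve]
    positivity
  have hfam (t : ℚ) := familyCurve_eq hp hk t
  have htwo (t : ℚ) := rubinSilverberg_divisionField_two (α := s / 3) (by rw [hα₀]; exact hrank)
    (by rw [hα₀]; exact hgal.to_normal) hroot ha hb t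
  refine ⟨k, IntermediateField.adjoin ℚ {s}, hk, fun k' hk' => hk.eq hp hk', hle, hrank, hgal,
    fun L' hL' hd => ?_, ⟨(s - 1) / 3, ?_, hα⟩, gaussCurve_variableChange, hfam, fun t => ?_, ?_⟩
  · exact eq_of_le_cyclotomicSubfield hp hp2 hL' (hle.trans (cyclotomicSubfield_mono hpn))
      (hd.trans hrank.symm)
  · refine minpoly_eq_of_finrank monic_gaussPoly.1 ?_ ?_
    · simp [gaussPoly]
      linear_combination hs / 27
    · rw [monic_gaussPoly.2, hα]
      exact hrank
  · rw [hfam]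
    obtain ⟨hE, h2⟩ := htwo t
    refine ⟨hE, ?_⟩
    rw [h2, hα₀, inf_eq_left]
    -- L ⊆ ℚ(ζ_p) ⊆ ℚ(E_t[p]) ⊆ ℚ(E_t[p^n]), so the intersection is all of L.
    exact hle.trans ((cyclotomicSubfield_le_divisionField hp hp2).trans (divisionField_mono hpn))
  · simp only [hfam]
    exact infinite_rubinSilverberg_j ha hb fun t => (htwo t).1
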